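/- **Setting.** Let $X$ be a locally compact Hausdorff space with countable base. For a family $\mathcal V$ of open sets and an open set $U$ let $\mathcal V(U)=\{W\in\mathcal V:\overline W\subset U\}$. A *boundary kernel* for an open set $U$ is a Borel kernel $T$ on $X$ with $T(x,X\setminus\partial U)=0$ for $x\in U$ and $T(x,\cdot)=\varepsilon_x$ (Dirac measure) for $x\notin U$. Let $\mathcal V$ be a base of relatively compact open sets and, for $V\in\mathcal V$, let $H_V$ be a boundary kernel for $V$; write $H_Vf(x)=\int f\,dH_V(x,\cdot)$. A *local choice* $\mathcal W$ from $\mathcal V$ in an open set $U$ assigns to each $x\in U$ a fundamental system $\mathcal W(x)\subset\mathcal V(U)$ of neighborhoods of $x$. A lower semicontinuous $u\colon U\to[0,\infty]$ is *positive $\mathcal W$-hyperharmonic* on $U$ if $H_Wu(x)\le u(x)$ for all $x\in U$, $W\in\mathcal W(x)$, and *positive hyperharmonic* on $U$ if this holds for all $W\in\mathcal V(U)$ and all $x\in W$. $(H_V)_{V\in\mathcal V}$ is a *normal Bauer family* (of harmonic boundary kernels on $X$) if, for every $V\in\mathcal V$: $(H_1)$ $H_WH_V=H_V$ for $W\in\mathcal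 V$, $W\subset V$, where $H_WH_V(x,\cdot)=\int H_V(y,\cdot)\,H_W(x,dy)$; $(H_2)$ $H_Vf\in C(X)$ for $f\in C(X)$, and $H_V1=1$; $(H_3)$ there is a local choice $\mathcal W$ from $\mathcal V$ in $V$ such that the positive $\mathcal W$-hyperharmonic functions on $V$ separate the points of $V$; $(H_4)$ $H_Vf$ is continuous on $V$ for every bounded Borel function $f$. Given such a family, $h\in C(U)$ is *harmonic* on the open set $U$ if $H_Vh=h$ on $U$ for all $V\in\mathcal V(U)$. An open set $U$ is a *$\mathcal P$-set* if the positive hyperharmonic functions on $U$ separate its points. A relatively compact open set $U$ is *regular* if every $f\in C(\partial U)$ has a unique extension in $C(\overline U)$ that is harmonic on $U$, and this extension is $\ge0$ if $f\ge0$; then $H_U$ denotes the boundary kernel for $U$ for which $H_Uf$ is this extension on $\overline U$. A compact $K\neq\emptyset$ is *strongly stable* if it is contained in a $\mathcal P$-set $W$ such that there is a harmonic function $h>0$ on $W\setminus K$ with $\lim_{x\to z}h(x)=0$ for every $z\in\partial K$. **Data.** Let $(H_V)_{V\in\mathcal V}$ be a normal Bauer family on $X$ and $K$ a strongly stable compact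 set. Let $X_0=\{x_0\}\cup(X\setminus K)$ be the quotient space obtained by collapsing $K$ to a point $x_0$. Let $W_0\supset K$ be a regular $\mathcal P$-set such that $W_0\setminus K$ is regular and $g:=H_{W_0\setminus K}1_{\partial W_0}>0$ on $W_0\setminus K$. For $0<r<1$ let $A_r=\{x\in W_0\setminus K: g(x)<r\}$ (these sets are regular), $S_r=\{x\in W_0\setminus K:g(x)=r\}$, $U_r=\{x_0\}\cup A_r\subset X_0$. Let $\mathcal V_0=\{U_r:0<r<1\}\cup\{V\in\mathcal V:\overline V\cap K=\emptyset\}$, where for $V$ of the second kind $H_V$ is regarded as a kernel on $X_0$ (with $H_V(x_0,\cdot)=\varepsilon_{x_0}$). For $0<r<1$ let $\sigma_r$ be a probability measure on $S_r$. **Theorem.** (1) The following are equivalent. (a) There exist boundary kernels $H_{U_r}$, $0<r<1$, on $X_0$ such that $(H_V)_{V\in\mathcal V_0}$ is a normal Bauer family on $X_0$ and $H_{U_t}(x_0,\cdot)=\sigma_t$ for every $0<t<1$. (b) The measures $\sigma_r$ are compatible: for all $0<r<t<1$, $\int H_{A_t}(y,\cdot)\,d\sigma_r(y)=(r/t)\,\sigma_t$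 on $S_t$. (2) Let $H_{U_r}$, $0<r<1$, be any kernels as in (a). Then, for all $0<t<1$, all Borel sets $B$ in $X_0$ and all $y\in A_t$, $$H_{U_t}(y,B)=H_{A_t}(y,B\cap S_t)+\bigl(1-g(y)/t\bigr)\sigma_t(B).$$ With respect to the family $(H_V)_{V\in\mathcal V_0}$ on $X_0$, the singleton $\{x_0\}$ is strongly stable and $\{x_0\}\cup(W_0\setminus K)$ is a $\mathcal P$-set. Moreover, for every open neighborhood $W$ of $x_0$ in $X_0$ and every $h\in C(W)$ that is harmonic on $W\setminus\{x_0\}$ with respect to $(H_V)_{V\in\mathcal V}$, the following are equivalent: (a) $h$ is harmonic on $W$ with respect to $(H_V)_{V\in\mathcal V_0}$; (b) $\int h\,d\sigma_r=h(x_0)$ for every $0<r<1$ with $\overline{U_r}\subset W$; (c) $\int h\,d\sigma_r=h(x_0)$ for some $0<r<1$ with $\overline{U_r}\subset W$. -/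

import Mathlib

open MeasureTheory ProbabilityTheory Set Filter Topology
open scoped ENNReal

namespace Bauer

section Families

variable {X : Type*} [TopologicalSpace X] [MeasurableSpace X]

/-- `T` is a boundary kernel for `U`: `T(x, X ∖ ∂U) = 0` for `x ∈ U`, and `T(x, ·)` is the Dirac
measure at `x` for `x ∉ U`. -/
def IsBoundaryKernel (U : Set X) (T : Kernel X X) : Prop :=
  (∀ x ∈ U, T x (frontier U)ᶜ = 0) ∧ ∀ x ∉ U, T x = Measure.dirac x

/-- All `W ∈ 𝒱` with `x ∈ W` and `closure W ⊆ U`. -/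
def fullChoice (𝒱 : Set (Set X)) (U : Set X) (x : X) : Set (Set X) :=
  {W | W ∈ 𝒱 ∧ closure W ⊆ U ∧ x ∈ W}

/-- A local choice from `𝒱` in `U`: every `𝒲 x`, `x ∈ U`, is a fundamental system of
neighborhoods `W` of `x` with `W ∈ 𝒱` and `closure W ⊆ U`. -/
def IsLocalChoice (𝒱 : Set (Set X)) (U : Set X) (𝒲 : X → Set (Set X)) : Prop :=
  ∀ x ∈ U, 𝒲 x ⊆ fullChoice 𝒱 U x ∧ ∀ N ∈ 𝓝 x, ∃ W ∈ 𝒲 x, W ⊆ N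

/-- `u` is a positive (that is, `[0, ∞]`-valued) `𝒲`-hyperharmonic function on `U`. Only the values
of `u` on `U` matter. -/
def IsPosHyperharmonic (H : Set X → Kernel X X) (𝒲 : X → Set (Set X)) (U : Set X)
    (u : X → ℝ≥0∞) : Prop :=
  LowerSemicontinuousOn u U ∧ ∀ x ∈ U, ∀ W ∈ 𝒲 x, ∫⁻ y, u y ∂(H W x) ≤ u x

/-- The positive `𝒲`-hyperharmonic functions on `U` separate the points of `U`. -/
def PosHyperharmonicSeparates (H : Set X → Kernel X X) (𝒲 : X → Set (Set X))
    (U : Set X) : Prop :=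
  ∀ x ∈ U, ∀ y ∈ U, x ≠ y → ∃ u : X → ℝ≥0∞, IsPosHyperharmonic H 𝒲 U u ∧ u x ≠ u y

/-- `(H V)`, `V ∈ 𝒱`, is a normal Bauer family of harmonic boundary kernels. The values `H V` for
`V ∉ 𝒱` play no role. The product `H_W H_V`, that is `x ↦ ∫ H_V(y, ·) H_W(x, dy)`, is
`H V ∘ₖ H W` in Mathlib's notation. -/
structure IsNormalBauerFamily (𝒱 : Set (Set X)) (H : Set X → Kernel X X) : Prop where
  isBasis : TopologicalSpace.IsTopologicalBasis 𝒱
  isCompact_closure : ∀ V ∈ 𝒱, IsCompact (closure V)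
  isBoundaryKernel : ∀ V ∈ 𝒱, IsBoundaryKernel V (H V)
  comp_eq : ∀ V ∈ 𝒱, ∀ W ∈ 𝒱, W ⊆ V → H V ∘ₖ H W = H V
  continuous_integral : ∀ V ∈ 𝒱, ∀ f : X → ℝ, Continuous f → Continuous fun x => ∫ y, f y ∂(H V x)
  normal : ∀ V ∈ 𝒱, ∀ x, H V x univ = 1
  separates : ∀ V ∈ 𝒱, ∃ 𝒲 : X → Set (Set X),
    IsLocalChoice 𝒱 V 𝒲 ∧ PosHyperharmonicSeparates H 𝒲 V
  continuousOn_integral : ∀ V ∈ 𝒱, ∀ f : X → ℝ, Measurable f → (∃ C, ∀ x, |f x| ≤ C) →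
    ContinuousOn (fun x => ∫ y, f y ∂(H V x)) V

/-- `h` is harmonic on the open set `U`. Only the values of `h` on `U` matter. -/
def IsHarmonic (𝒱 : Set (Set X)) (H : Set X → Kernel X X) (U : Set X) (h : X → ℝ) : Prop :=
  ContinuousOn h U ∧ ∀ V ∈ 𝒱, closure V ⊆ U → ∀ x ∈ U, ∫ y, h y ∂(H V x) = h x

/-- `U` is a `𝒫`-set: an open set whose points are separated by the positive hyperharmonic
functions on `U`. -/
def IsPSet (𝒱 : Set (Set X)) (H : Set X → Kernel X X) (U : Set X) : Prop :=
  IsOpen U ∧ PosHyperharmonicSeparates H (fullChoice 𝒱 U) U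

/-- On `closure U`, `h` is a continuous extension of `f|∂U` that is harmonic on `U`. -/
def SolvesDirichlet (𝒱 : Set (Set X)) (H : Set X → Kernel X X) (U : Set X) (f h : X → ℝ) : Prop :=
  ContinuousOn h (closure U) ∧ EqOn h f (frontier U) ∧ IsHarmonic 𝒱 H U h

/-- `U` is a regular set: it is open and relatively compact, and every `f ∈ C(∂U)` has a unique
continuous extension to `closure U` that is harmonic on `U`, which is positive if `f` is. -/
def IsRegular (𝒱 : Set (Set X)) (H : Set X → Kernel X X) (U : Set X) : Prop :=
  IsOpen U ∧ IsCompact (closure U) ∧ ∀ f : X → ℝ, ContinuousOn f (frontier U) →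
    (∃ h, SolvesDirichlet 𝒱 H U f h) ∧
    (∀ h h', SolvesDirichlet 𝒱 H U f h → SolvesDirichlet 𝒱 H U f h' → EqOn h h' (closure U)) ∧
    ((∀ z ∈ frontier U, 0 ≤ f z) → ∀ h, SolvesDirichlet 𝒱 H U f h → ∀ x ∈ closure U, 0 ≤ h x)

/-- `T` is a boundary kernel for `U` which solves the Dirichlet problem on `U`. -/
def IsDirichletKernel (𝒱 : Set (Set X)) (H : Set X → Kernel X X) (U : Set X)
    (T : Kernel X X) : Prop :=
  IsBoundaryKernel U T ∧ ∀ f : X → ℝ, ContinuousOn f (frontier U) →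
    SolvesDirichlet 𝒱 H U f fun x => ∫ y, f y ∂(T x)

open Classical in
/-- The harmonic kernel `H_U` of a regular set `U`: the boundary kernel that solves the Dirichlet
problem on `U` (which determines it uniquely). If `U` is not regular, this is the junk value `0`. -/
noncomputable def harmonicKernel (𝒱 : Set (Set X)) (H : Set X → Kernel X X) (U : Set X) :
    Kernel X X :=
  if h : IsRegular 𝒱 H U ∧ ∃ T, IsDirichletKernel 𝒱 H U T then h.2.choose else 0

/-- `K` is a strongly stable compact set. -/
def IsStronglyStable (𝒱 : Set (Set X)) (H : Set X → Kernel X X) (K : Set X) : Prop :=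
  IsCompact K ∧ K.Nonempty ∧ ∃ W, IsPSet 𝒱 H W ∧ K ⊆ W ∧ ∃ h : X → ℝ,
    IsHarmonic 𝒱 H (W \ K) h ∧ (∀ x ∈ W \ K, 0 < h x) ∧
    ∀ z ∈ frontier K, Tendsto h (𝓝[W \ K] z) (𝓝 0)

end Families

section Collapse

variable {X : Type*}

/-- The space `X₀` obtained from `X` by collapsing `K` to a point. -/
def Collapse (K : Set X) : Type _ := Option ↥(Kᶜ)

/-- The point `x₀` of `X₀` to which `K` is collapsed. -/
def point (K : Set X) : Collapse K := (none : Option ↥(Kᶜ))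

open Classical in
/-- The canonical map from `X` to `X₀`: it sends `K` to `x₀` and is injective off `K`. -/
noncomputable def proj (K : Set X) (x : X) : Collapse K :=
  if h : x ∈ K then point K else (some ⟨x, h⟩ : Option ↥(Kᶜ))

/-- The quotient topology. If `K` is closed and non-empty, this means that `X₀ ∖ {x₀}` is open and
carries the topology of `X ∖ K`, and that the neighborhoods of `x₀` are the sets `{x₀} ∪ (N ∖ K)`
with `N` a neighborhood of `K`. -/
noncomputable instance (K : Set X) [TopologicalSpace X] : TopologicalSpace (Collapse K) :=
  TopologicalSpace.coinduced (proj K) inferInstance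

noncomputable instance (K : Set X) [TopologicalSpace X] : MeasurableSpace (Collapse K) := borel (Collapse K)

instance (K : Set X) [TopologicalSpace X] : BorelSpace (Collapse K) := ⟨rfl⟩

end Collapse

section Darning

variable {X : Type*} [TopologicalSpace X] [MeasurableSpace X]

/-- `g = H_{W₀ ∖ K} 1_{∂W₀}`. -/
noncomputable def gFun (𝒱 : Set (Set X)) (H : Set X → Kernel X X) (K W₀ : Set X) (x : X) : ℝ :=
  (harmonicKernel 𝒱 H (W₀ \ K) x).real (frontier W₀)

/-- `A_r = {x ∈ W₀ ∖ K : g(x) < r}`. -/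
def ASet (𝒱 : Set (Set X)) (H : Set X → Kernel X X) (K W₀ : Set X) (r : ℝ) : Set X :=
  {x ∈ W₀ \ K | gFun 𝒱 H K W₀ x < r}

/-- `S_r = {x ∈ W₀ ∖ K : g(x) = r}`. -/
def SSet (𝒱 : Set (Set X)) (H : Set X → Kernel X X) (K W₀ : Set X) (r : ℝ) : Set X :=
  {x ∈ W₀ \ K | gFun 𝒱 H K W₀ x = r}

/-- `U_r = {x₀} ∪ A_r`, a subset of `X₀`. -/
def USet (𝒱 : Set (Set X)) (H : Set X → Kernel X X) (K W₀ : Set X) (r : ℝ) : Set (Collapse K) :=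
  insert (point K) (proj K '' ASet 𝒱 H K W₀ r)

/-- `𝒱₀ = {U_r : 0 < r < 1} ∪ {V ∈ 𝒱 : closure V ∩ K = ∅}`, a family of subsets of `X₀`. -/
def VZero (𝒱 : Set (Set X)) (H : Set X → Kernel X X) (K W₀ : Set X) : Set (Set (Collapse K)) :=
  {U | ∃ r ∈ Ioo (0 : ℝ) 1, U = USet 𝒱 H K W₀ r} ∪
    {U | ∃ V ∈ 𝒱, closure V ∩ K = ∅ ∧ U = proj K '' V}

/-- The probability measures `σ_r` on `S_r` are compatible: `σ_r H_{A_t} = (r/t) σ_t` on `S_t`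
for all `0 < r < t < 1`. -/
def IsCompatible (𝒱 : Set (Set X)) (H : Set X → Kernel X X) (K W₀ : Set X)
    (σ : ℝ → Measure X) : Prop :=
  ∀ r t : ℝ, 0 < r → r < t → t < 1 →
    ((σ r).bind (harmonicKernel 𝒱 H (ASet 𝒱 H K W₀ t))).restrict (SSet 𝒱 H K W₀ t) =
      ENNReal.ofReal (r / t) • (σ t).restrict (SSet 𝒱 H K W₀ t)

/-- `(H₀ V)`, `V ∈ 𝒱₀`, is a normal Bauer family on `X₀` which consists of the given kernels `H V`
for `V ∈ 𝒱` with `closure V ∩ K = ∅` (transported to `X₀`) and of kernels for the sets `U_t`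
with `H₀(U_t)(x₀, ·) = σ_t`. -/
structure IsDarning (𝒱 : Set (Set X)) (H : Set X → Kernel X X) (K W₀ : Set X)
    (σ : ℝ → Measure X) (H₀ : Set (Collapse K) → Kernel (Collapse K) (Collapse K)) : Prop where
  agree : ∀ V ∈ 𝒱, closure V ∩ K = ∅ → ∀ x,
    H₀ (proj K '' V) (proj K x) = (H V x).map (proj K)
  isNormalBauerFamily : IsNormalBauerFamily (VZero 𝒱 H K W₀) H₀
  apply_point : ∀ t ∈ Ioo (0 : ℝ) 1, H₀ (USet 𝒱 H K W₀ t) (point K) = (σ t).map (proj K)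

end Darning

end Bauer

set_option linter.unusedSectionVars false

/-! The kernel of `U_t` is forced. If `F` is continuous and bounded on `X₀`, then `x ↦ ∫ F
dH_{U_t}(x, ·)` is harmonic on `A_t`, agrees with `F` on the outer boundary and has the constant
value `∫ F dσ_t` on `K`. Since `g` is harmonic on `A_t`, zero on `K` and equal to `t` on `S_t`,
harmonic measure of `A_t` at `x` gives mass `g(x)/t` to `S_t` and `1 - g(x)/t` to `K`
(`eq_integral_add`). This determines the kernel (`map_sec_eq`). Inserting the formula into (H₁) for
`U_r ⊆ U_t` at `x₀` and cancelling `(1 - r/t) σ_t` leaves exactly compatibility (`isCompatible`).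

Conversely, the formula defines kernels on `X` (`darnKernel`) which have the same measure at all
points of `K`, hence descend to `X₀`; the axioms are checked on `X`. For (H₁),
`darnKernel_comp_darnKernel` combines compatibility with the representation of harmonic functions on
`A_s`. For (H₄), continuity at `x₀` follows from `H_{U_t} f = H_{U_{t/2}} (H_{U_t} f)`, because
`H_{U_t} f` is already continuous on `S_{t/2}`. For (H₃), superharmonic functions on `W₀ ∖ K` that
attain their maximum constantly on `K` descend to hyperharmonic functions: `1 - g` separates
different levels of `g`, and `min (u + N (1 - g)) N` separates points of one level that `u`
separates (`isPSet_image_W`).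

The representation also treats a function `h` that is continuous near `x₀` and harmonic off `x₀`:
the deviation `∫ h dσ_r - h(x₀)` is proportional to `r` (`integral_sigma_sub`), so it vanishes for
one `r` if and only if it vanishes for all.

All this rests on the regularity of `A_t` and on properties of its harmonic kernel, derived from the
axioms: a minimum principle (`not_absorbing`), locality of harmonicity, Perron's method, and
barriers (`isRegular_of_isBarrier`); for `A_t` the barriers are `g` and `t - g`. -/

namespace Bauer

/-! ### Bounded measurable functions. -/

section BoundedMeasurable

variable {X : Type*} [MeasurableSpace X]

/-- A bounded measurable real function. -/
structure BddMeas (f : X → ℝ) : Prop where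
  meas : Measurable f
  bdd : ∃ C, ∀ x, |f x| ≤ C

theorem BddMeas.const (c : ℝ) : BddMeas (fun _ : X => c) :=
  ⟨measurable_const, |c|, fun _ => le_rfl⟩

theorem BddMeas.neg {f : X → ℝ} (hf : BddMeas f) : BddMeas (fun x => -f x) := by
  obtain ⟨C, hC⟩ := hf.bdd
  exact ⟨hf.meas.neg, C, fun x => by rw [abs_neg]; exact hC x⟩

theorem BddMeas.add {f g : X → ℝ} (hf : BddMeas f) (hg : BddMeas g) :
    BddMeas (fun x => f x + g x) := by
  obtain ⟨C, hC⟩ := hf.bdd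
  obtain ⟨C', hC'⟩ := hg.bdd
  exact ⟨hf.meas.add hg.meas, C + C', fun x => (abs_add_le _ _).trans (add_le_add (hC x) (hC' x))⟩

theorem BddMeas.sub {f g : X → ℝ} (hf : BddMeas f) (hg : BddMeas g) :
    BddMeas (fun x => f x - g x) := by
  simpa [sub_eq_add_neg] using hf.add hg.neg

theorem BddMeas.mul {f g : X → ℝ} (hf : BddMeas f) (hg : BddMeas g) :
    BddMeas (fun x => f x * g x) := by
  obtain ⟨C, hC⟩ := hf.bdd
  obtain ⟨C', hC'⟩ := hg.bdd
  refine ⟨hf.meas.mul hg.meas, C * C', fun x => ?_⟩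
  rw [abs_mul]
  exact mul_le_mul (hC x) (hC' x) (abs_nonneg _) ((abs_nonneg _).trans (hC x))

theorem BddMeas.min {f g : X → ℝ} (hf : BddMeas f) (hg : BddMeas g) :
    BddMeas (fun x => min (f x) (g x)) := by
  obtain ⟨C, hC⟩ := hf.bdd
  obtain ⟨C', hC'⟩ := hg.bdd
  refine ⟨hf.meas.min hg.meas, max C C', fun x => ?_⟩
  rcases min_choice (f x) (g x) with h | h <;> rw [h]
  · exact (hC x).trans (le_max_left _ _)
  · exact (hC' x).trans (le_max_right _ _)

theorem BddMeas.indicator {f : X → ℝ} (hf : BddMeas f) {s : Set X} (hs : MeasurableSet s) :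
    BddMeas (s.indicator f) := by
  obtain ⟨C, hC⟩ := hf.bdd
  refine ⟨hf.meas.indicator hs, C, fun x => ?_⟩
  by_cases hx : x ∈ s
  · simpa [hx] using hC x
  · simpa [hx] using (abs_nonneg _).trans (hC x)

theorem BddMeas.integrable {f : X → ℝ} (hf : BddMeas f) (μ : Measure X) [IsFiniteMeasure μ] :
    Integrable f μ := by
  obtain ⟨C, hC⟩ := hf.bdd
  exact Integrable.of_bound hf.meas.aestronglyMeasurable C (ae_of_all _ hC)

theorem BddMeas.integral_kernel {f : X → ℝ} (hf : BddMeas f) (T : Kernel X X) [IsMarkovKernel T] :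
    BddMeas (fun x => ∫ y, f y ∂(T x)) := by
  obtain ⟨C, hC⟩ := hf.bdd
  refine ⟨hf.meas.stronglyMeasurable.integral_kernel.measurable, C, fun x => ?_⟩
  have := norm_integral_le_of_norm_le_const (μ := T x) (f := f) (C := C) (ae_of_all _ hC)
  simpa using this

/-- A continuous function on a compact set, extended by zero, is bounded and measurable. -/
theorem BddMeas.of_continuousOn [TopologicalSpace X] [T2Space X] [BorelSpace X]
    {f : X → ℝ} {s : Set X} (hs : IsCompact s) (hf : ContinuousOn f s) :
    BddMeas (s.indicator f) := by
  obtain ⟨C, hC⟩ := hs.exists_bound_of_continuousOn hf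
  refine ⟨?_, |C|, fun x => ?_⟩
  · classical
    rw [← piecewise_eq_indicator]
    exact hf.measurable_piecewise continuousOn_const hs.measurableSet
  · by_cases hx : x ∈ s
    · simpa [hx] using (hC x hx).trans (le_abs_self C)
    · simp [hx]

/-- The equality case of the mean value inequality: `v - m` is nonnegative almost everywhere and has
nonpositive integral. It makes the set of minimum points of a superharmonic function absorbing. -/
theorem ae_eq_of_integral_le {μ : Measure X} [IsProbabilityMeasure μ] {v : X → ℝ}
    (hv : BddMeas v) {m : ℝ} (hm : ∀ᵐ x ∂μ, m ≤ v x) (h : ∫ x, v x ∂μ ≤ m) :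
    ∀ᵐ x ∂μ, v x = m := by
  have h0 : 0 ≤ᵐ[μ] fun x => v x - m := by
    filter_upwards [hm] with x hx using sub_nonneg.2 hx
  have hi : Integrable (fun x => v x - m) μ := (hv.sub (BddMeas.const m)).integrable μ
  have h1 : ∫ x, (v x - m) ∂μ = 0 := by
    refine le_antisymm ?_ (integral_nonneg_of_ae h0)
    rw [integral_sub (hv.integrable μ) (integrable_const _)]
    simpa using h
  filter_upwards [(integral_eq_zero_iff_of_nonneg_ae h0 hi).1 h1] with x hx
  simpa [sub_eq_zero] using hx

end BoundedMeasurable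

/-! ### Small neighborhoods from a base; lower semicontinuity. -/

section Topology

variable {X : Type*} [TopologicalSpace X] {𝒱 : Set (Set X)}

/-- Expressing smallness by the filter `smallSets` allows several smallness conditions on a
neighborhood to be imposed at once. -/
theorem eventually_smallSets_closure_subset [RegularSpace X] {x : X} {O : Set X} (hO : O ∈ 𝓝 x) :
    ∀ᶠ W in (𝓝 x).smallSets, closure W ⊆ O := by
  obtain ⟨C, hC, hCc, hCO⟩ := exists_mem_nhds_isClosed_subset hO
  exact eventually_smallSets.2 ⟨C, hC, fun W hW => (closure_minimal hW hCc).trans hCO⟩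

theorem IsLocalChoice.exists_mem {U : Set X} {𝒲 : X → Set (Set X)} (h𝒲 : IsLocalChoice 𝒱 U 𝒲)
    {x : X} (hx : x ∈ U) {P : Set X → Prop} (hP : ∀ᶠ W in (𝓝 x).smallSets, P W) :
    ∃ W ∈ 𝒲 x, P W := by
  obtain ⟨N, hN, hNP⟩ := eventually_smallSets.1 hP
  obtain ⟨W, hW, hWN⟩ := (h𝒲 x hx).2 N hN
  exact ⟨W, hW, hNP W hWN⟩

theorem isLocalChoice_fullChoice [RegularSpace X] (h𝒱 : TopologicalSpace.IsTopologicalBasis 𝒱)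
    {U : Set X} (hU : IsOpen U) : IsLocalChoice 𝒱 U (fullChoice 𝒱 U) := by
  refine fun x hx => ⟨subset_rfl, fun N hN => ?_⟩
  obtain ⟨C, hC, hCc, hCO⟩ := exists_mem_nhds_isClosed_subset (inter_mem hN (hU.mem_nhds hx))
  obtain ⟨W, hW, hxW, hWC⟩ := h𝒱.mem_nhds_iff.1 hC
  exact ⟨W, ⟨hW, (closure_minimal hWC hCc).trans (hCO.trans inter_subset_right), hxW⟩,
    hWC.trans (hCO.trans inter_subset_left)⟩

theorem exists_mem_basis [RegularSpace X] (h𝒱 : TopologicalSpace.IsTopologicalBasis 𝒱)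
    {x : X} {P : Set X → Prop} (hP : ∀ᶠ W in (𝓝 x).smallSets, P W) :
    ∃ W ∈ 𝒱, x ∈ W ∧ P W := by
  obtain ⟨W, hW, hPW⟩ := (isLocalChoice_fullChoice h𝒱 isOpen_univ).exists_mem (mem_univ x) hP
  exact ⟨W, hW.1, hW.2.2, hPW⟩

/-- The extension by `0`, the least value, costs nothing outside `U`. It turns hyperharmonic
functions on `U` into Borel functions on `X`. -/
theorem LowerSemicontinuousOn.lowerSemicontinuous_indicator {u : X → ℝ≥0∞} {U : Set X}
    (hU : IsOpen U) (hu : LowerSemicontinuousOn u U) : LowerSemicontinuous (U.indicator u) := by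
  intro x a ha
  by_cases hx : x ∈ U
  · rw [indicator_of_mem hx] at ha
    have := hu x hx a ha
    rw [hU.nhdsWithin_eq hx] at this
    filter_upwards [this, hU.mem_nhds hx] with y hy hyU
    rwa [indicator_of_mem hyU]
  · simp [hx] at ha

end Topology

/-! ### Absorbing sets and the minimum principle. -/

section Minimum

variable {X : Type*} [TopologicalSpace X] [MeasurableSpace X]
  {𝒱 : Set (Set X)} {H : Set X → Kernel X X}

theorem IsNormalBauerFamily.isProbabilityMeasure (hH : IsNormalBauerFamily 𝒱 H) {V : Set X}
    (hV : V ∈ 𝒱) (x : X) : IsProbabilityMeasure (H V x) := ⟨hH.normal V hV x⟩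

theorem IsNormalBauerFamily.isMarkovKernel (hH : IsNormalBauerFamily 𝒱 H) {V : Set X}
    (hV : V ∈ 𝒱) : IsMarkovKernel (H V) := ⟨fun x => hH.isProbabilityMeasure hV x⟩

theorem IsBoundaryKernel.ae_mem_frontier {U : Set X} {T : Kernel X X} (hT : IsBoundaryKernel U T)
    {x : X} (hx : x ∈ U) : ∀ᵐ y ∂(T x), y ∈ frontier U :=
  mem_ae_iff.2 (hT.1 x hx)

/-- The pointwise mean value inequality for all sufficiently small sets of `𝒱` containing `x`. -/
def LocSuperAt (𝒱 : Set (Set X)) (H : Set X → Kernel X X) (u : X → ℝ) (x : X) : Prop :=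
  ∀ᶠ W in (𝓝 x).smallSets, W ∈ 𝒱 → x ∈ W → ∫ y, u y ∂(H W x) ≤ u x

/-- A truncated positive hyperharmonic function is a bounded real superharmonic function. -/
theorem IsPosHyperharmonic.truncate [BorelSpace X] (hH : IsNormalBauerFamily 𝒱 H)
    {U : Set X} (hU : IsOpen U) {𝒲 : X → Set (Set X)} (h𝒲 : ∀ x ∈ U, 𝒲 x ⊆ fullChoice 𝒱 U x)
    {u : X → ℝ≥0∞} (hu : IsPosHyperharmonic H 𝒲 U u) (n : ℕ) :
    BddMeas (fun x => (min (U.indicator u x) n).toReal) ∧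
    LowerSemicontinuousOn (fun x => (min (U.indicator u x) n).toReal) U ∧
    ∀ x ∈ U, ∀ W ∈ 𝒲 x, ∫ y, (min (U.indicator u y) n).toReal ∂(H W x) ≤
      (min (U.indicator u x) n).toReal := by
  have hlsc := LowerSemicontinuousOn.lowerSemicontinuous_indicator hU hu.1
  have hfin : ∀ x, min (U.indicator u x) (n : ℝ≥0∞) ≠ ∞ := fun x =>
    ne_top_of_le_ne_top (ENNReal.natCast_ne_top n) (min_le_right _ _)
  have hmeas : Measurable fun x => min (U.indicator u x) (n : ℝ≥0∞) :=
    hlsc.measurable.min measurable_const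
  refine ⟨⟨hmeas.ennreal_toReal, n, fun x => ?_⟩, ?_, ?_⟩
  · rw [abs_of_nonneg ENNReal.toReal_nonneg]
    simpa using ENNReal.toReal_mono (ENNReal.natCast_ne_top n) (min_le_right (U.indicator u x) n)
  · have h1 : LowerSemicontinuous fun x => min (U.indicator u x) (n : ℝ≥0∞) :=
      hlsc.inf lowerSemicontinuous_const
    intro x _ a ha
    rcases lt_or_ge a 0 with ha0 | ha0
    · exact Eventually.of_forall fun y => ha0.trans_le ENNReal.toReal_nonneg
    have := h1 x (ENNReal.ofReal a) ((ENNReal.ofReal_lt_iff_lt_toReal ha0 (hfin x)).2 ha)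
    filter_upwards [mem_nhdsWithin_of_mem_nhds this] with y hy
    exact (ENNReal.ofReal_lt_iff_lt_toReal ha0 (hfin y)).1 hy
  · intro x hx W hW
    have hW' := h𝒲 x hx hW
    have := hH.isProbabilityMeasure hW'.1 x
    rw [integral_toReal hmeas.aemeasurable (ae_of_all _ fun y => (hfin y).lt_top)]
    refine ENNReal.toReal_mono (hfin x) (le_min ?_ ?_)
    · calc ∫⁻ y, min (U.indicator u y) (n : ℝ≥0∞) ∂(H W x) ≤ ∫⁻ y, u y ∂(H W x) :=
            lintegral_mono fun y => (min_le_left _ _).trans (indicator_le_self _ _ _)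
        _ ≤ u x := hu.2 x hx W hW
        _ = U.indicator u x := by rw [indicator_of_mem hx]
    · calc ∫⁻ y, min (U.indicator u y) (n : ℝ≥0∞) ∂(H W x) ≤ ∫⁻ _, n ∂(H W x) :=
            lintegral_mono fun y => min_le_right _ _
        _ = n := by simp

/-- Points that are separated by positive hyperharmonic functions are separated by bounded ones. -/
theorem PosHyperharmonicSeparates.exists_real [BorelSpace X] (hH : IsNormalBauerFamily 𝒱 H)
    {U : Set X} (hU : IsOpen U) {𝒲 : X → Set (Set X)} (h𝒲 : ∀ x ∈ U, 𝒲 x ⊆ fullChoice 𝒱 U x)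
    (hsep : PosHyperharmonicSeparates H 𝒲 U) {x y : X} (hx : x ∈ U) (hy : y ∈ U) (hxy : x ≠ y) :
    ∃ v : X → ℝ, BddMeas v ∧ (∀ z, 0 ≤ v z) ∧ LowerSemicontinuousOn v U ∧
      (∀ z ∈ U, ∀ W ∈ 𝒲 z, ∫ p, v p ∂(H W z) ≤ v z) ∧ v x ≠ v y := by
  obtain ⟨u, hu, hne⟩ := hsep x hx y hy hxy
  have key : ∀ a b : ℝ≥0∞, a < b → ∃ n : ℕ, (min a n).toReal ≠ (min b n).toReal := by
    intro a b hab
    -- Truncating above the smaller value leaves that value unchanged and the other one strictly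
    -- larger.
    obtain ⟨n, hn⟩ := ENNReal.exists_nat_gt hab.ne_top
    refine ⟨n, ne_of_lt ?_⟩
    rw [min_eq_left hn.le]
    exact (ENNReal.toReal_lt_toReal hab.ne_top
      (ne_top_of_le_ne_top (ENNReal.natCast_ne_top n) (min_le_right _ _))).2 (lt_min hab hn)
  obtain ⟨n, hn⟩ : ∃ n : ℕ, (min (u x) n).toReal ≠ (min (u y) n).toReal := by
    rcases lt_or_gt_of_ne hne with h | h
    · exact key _ _ h
    · obtain ⟨n, hn⟩ := key _ _ h
      exact ⟨n, hn.symm⟩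
  obtain ⟨h1, h2, h3⟩ := hu.truncate hH hU h𝒲 n
  refine ⟨_, h1, fun _ => ENNReal.toReal_nonneg, h2, h3, ?_⟩
  simpa [hx, hy] using hn

/-- A set separated by positive hyperharmonic functions contains no non-empty compact absorbing
set. -/
theorem not_absorbing [T2Space X] [SecondCountableTopology X] [BorelSpace X]
    (hH : IsNormalBauerFamily 𝒱 H)
    {U : Set X} (hU : IsOpen U) {𝒲 : X → Set (Set X)} (h𝒲 : ∀ x ∈ U, 𝒲 x ⊆ fullChoice 𝒱 U x)
    (hsep : PosHyperharmonicSeparates H 𝒲 U) {M : Set X} (hMc : IsCompact M) (hMne : M.Nonempty)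
    (hMU : M ⊆ U) (hM : ∀ x ∈ M, ∃ W ∈ 𝒲 x, H W x Mᶜ = 0) : False := by
  choose! w hw hw0 using hM
  -- Zorn's lemma is applied to non-empty closed subsets that are absorbing for one fixed choice `w`
  -- of neighborhoods. A minimal set will be a single point, which a measure on the boundary of a
  -- neighborhood cannot charge.
  let S : Set (Set X) := {L | L ⊆ M ∧ IsClosed L ∧ L.Nonempty ∧ ∀ x ∈ L, H (w x) x Lᶜ = 0}
  obtain ⟨L, hL⟩ : ∃ L, Minimal (· ∈ S) L := by
    refine zorn_superset S fun c hc hchain => ?_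
    rcases c.eq_empty_or_nonempty with rfl | hcne
    · exact ⟨M, ⟨subset_rfl, hMc.isClosed, hMne, hw0⟩, by simp⟩
    have hcM : ∀ L ∈ c, L ⊆ M := fun L hL => (hc hL).1
    refine ⟨⋂₀ c, ⟨?_, isClosed_sInter fun L hL => (hc hL).2.1, ?_, ?_⟩,
      fun s hs => sInter_subset_of_mem hs⟩
    · obtain ⟨L, hL⟩ := hcne
      exact (sInter_subset_of_mem hL).trans (hcM L hL)
    · have := hcne.to_subtype
      refine IsCompact.nonempty_sInter_of_directed_nonempty_isCompact_isClosed
        (fun a ha b hb => ?_) (fun L hL => (hc hL).2.2.1)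
        (fun L hL => hMc.of_isClosed_subset (hc hL).2.1 (hcM L hL)) (fun L hL => (hc hL).2.1)
      rcases hchain.total ha hb with h | h
      · exact ⟨a, ha, subset_rfl, h⟩
      · exact ⟨b, hb, h, subset_rfl⟩
    · intro x hx
      -- The complement of the intersection is a possibly uncountable union of open null sets; the
      -- second countable topology makes it null.
      refine measure_null_of_locally_null _ fun y hy => ?_
      simp only [mem_compl_iff, mem_sInter, not_forall] at hy
      obtain ⟨L, hL, hyL⟩ := hy
      exact ⟨Lᶜ, mem_nhdsWithin_of_mem_nhds ((hc hL).2.1.isOpen_compl.mem_nhds hyL),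
        (hc hL).2.2.2 x (hx L hL)⟩
  obtain ⟨hLM, hLc, ⟨x, hx⟩, hL0⟩ := hL.prop
  have hLcomp : IsCompact L := hMc.of_isClosed_subset hLc hLM
  have hLU : L ⊆ U := hLM.trans hMU
  have hsub : L ⊆ {x} := by
    intro y hy
    by_contra hyx
    obtain ⟨v, hv, -, hvl, hvs, hne⟩ := hsep.exists_real hH hU h𝒲 (hLU hx) (hLU hy)
      (fun h => hyx h.symm)
    obtain ⟨p, hpL, hp⟩ := (hvl.mono hLU).exists_isMinOn ⟨x, hx⟩ hLcomp
    -- The set of minimum points of `v` on `L` is again absorbing. Minimality of `L` forces `v` to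
    -- be constant on `L`, although `v` separates `x` and `y`.
    have hL' : L ∩ v ⁻¹' Iic (v p) ∈ S := by
      refine ⟨inter_subset_left.trans hLM,
        ((hvl.mono hLU).isCompact_inter_preimage_Iic hLcomp _).isClosed, ⟨p, hpL, le_refl (v p)⟩, ?_⟩
      intro z hz
      have hzW := hw z (hLM hz.1)
      have := hH.isProbabilityMeasure (h𝒲 z (hLU hz.1) hzW).1 z
      have hae : ∀ᵐ q ∂(H (w z) z), q ∈ L := mem_ae_iff.2 (hL0 z hz.1)
      have hmin : ∀ᵐ q ∂(H (w z) z), v p ≤ v q := by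
        filter_upwards [hae] with q hq using hp hq
      have := ae_eq_of_integral_le hv hmin ((hvs z (hLU hz.1) _ hzW).trans hz.2)
      refine mem_ae_iff.1 ?_
      filter_upwards [hae, this] with q hq hq'
      exact ⟨hq, hq'.le⟩
    have hle := hL.le_of_le hL' inter_subset_left
    exact hne (le_antisymm ((hle hx).2.trans (hp hy)) ((hle hy).2.trans (hp hx)))
  have hxW := hw x (hLM hx)
  have hW := h𝒲 x (hLU hx) hxW
  have hne : x ∉ frontier (w x) := fun h => by
    rw [(hH.isBasis.isOpen hW.1).frontier_eq] at h
    exact h.2 hW.2.2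
  have := hH.isProbabilityMeasure hW.1 x
  have h1 := (hH.isBoundaryKernel _ hW.1).ae_mem_frontier hW.2.2
  have h2 : ∀ᵐ q ∂(H (w x) x), q ∈ L := mem_ae_iff.2 (hL0 x hx)
  have : ∀ᵐ q ∂(H (w x) x), False := by
    filter_upwards [h1, h2] with q hq hq'
    rw [hsub hq'] at hq
    exact hne hq
  simp at this
  exact IsProbabilityMeasure.ne_zero _ this

/-- The minimum principle. -/
theorem minimum_principle [T2Space X] [SecondCountableTopology X] [BorelSpace X]
    (hH : IsNormalBauerFamily 𝒱 H)
    {U : Set X} (hU : IsOpen U) {𝒲 : X → Set (Set X)} (h𝒲 : ∀ x ∈ U, 𝒲 x ⊆ fullChoice 𝒱 U x)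
    (hsep : PosHyperharmonicSeparates H 𝒲 U) {A : Set X} (hA : IsOpen A)
    (hAc : IsCompact (closure A)) (hAU : A ⊆ U) {v : X → ℝ} (hv : BddMeas v)
    (hvl : LowerSemicontinuousOn v (closure A)) (hv0 : ∀ z ∈ frontier A, 0 ≤ v z)
    (hvs : ∀ x ∈ A, ∃ W ∈ 𝒲 x, W ⊆ A ∧ ∫ y, v y ∂(H W x) ≤ v x) :
    ∀ x ∈ closure A, 0 ≤ v x := by
  intro x hx
  by_contra! hneg
  obtain ⟨p, hpA, hp⟩ := hvl.exists_isMinOn ⟨x, hx⟩ hAc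
  have hpneg : v p < 0 := (hp hx).trans_lt hneg
  -- Nonnegative boundary values keep the points of the negative minimum inside `A`; they form a
  -- compact absorbing set.
  have hMA : closure A ∩ v ⁻¹' Iic (v p) ⊆ A := by
    rintro y ⟨hy, hyp⟩
    by_contra hyA
    have := hv0 y (by rw [hA.frontier_eq]; exact ⟨hy, hyA⟩)
    exact absurd (this.trans hyp) (not_le.2 hpneg)
  refine not_absorbing hH hU h𝒲 hsep (hvl.isCompact_inter_preimage_Iic hAc (v p))
    ⟨p, hpA, le_refl (v p)⟩ (hMA.trans hAU) fun z hz => ?_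
  obtain ⟨W, hW, hWA, hint⟩ := hvs z (hMA hz)
  refine ⟨W, hW, ?_⟩
  have hW' := h𝒲 z (hAU (hMA hz)) hW
  have := hH.isProbabilityMeasure hW'.1 z
  have hae : ∀ᵐ q ∂(H W z), q ∈ closure A := by
    filter_upwards [(hH.isBoundaryKernel _ hW'.1).ae_mem_frontier hW'.2.2] with q hq
    exact closure_mono hWA (frontier_subset_closure hq)
  have hmin : ∀ᵐ q ∂(H W z), v p ≤ v q := by
    filter_upwards [hae] with q hq using hp hq
  have := ae_eq_of_integral_le hv hmin (hint.trans hz.2)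
  refine mem_ae_iff.1 ?_
  filter_upwards [hae, this] with q hq hq'
  exact ⟨hq, hq'.le⟩

end Minimum

/-! ### Continuous minorants. -/

section Approximation

/-- A bounded lower semicontinuous function on a subset of a metric space is a limit of continuous
minorants. -/
theorem exists_seq_continuous_tendsto {X : Type*} [TopologicalSpace X]
    [TopologicalSpace.MetrizableSpace X] {C : Set X} {u : X → ℝ} {K : ℝ}
    (hu : LowerSemicontinuousOn u C) (hK : ∀ x, |u x| ≤ K) :
    ∃ φ : ℕ → X → ℝ, (∀ n, Continuous (φ n)) ∧ (∀ n x, |φ n x| ≤ K) ∧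
      (∀ n, ∀ x ∈ C, φ n x ≤ u x) ∧ ∀ x ∈ C, Tendsto (fun n => φ n x) atTop (𝓝 (u x)) := by
  let _ := TopologicalSpace.metrizableSpaceMetric X
  rcases C.eq_empty_or_nonempty with rfl | hne
  · rcases isEmpty_or_nonempty X with hX | ⟨⟨x⟩⟩
    · exact ⟨fun _ _ => 0, fun _ => continuous_const, fun _ x => (hX.false x).elim, by simp, by simp⟩
    · exact ⟨fun _ _ => 0, fun _ => continuous_const,
        fun _ _ => by simpa using (abs_nonneg _).trans (hK x), by simp, by simp⟩
  have : Nonempty C := hne.to_subtype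
  -- The inf-convolution of `u` with `n · dist`, which is Lipschitz with constant `n`.
  let ψ : ℕ → X → ℝ := fun n x => ⨅ y : C, (u y + n * dist x y)
  have hlow : ∀ (n : ℕ) (x : X) (y : C), -K ≤ u y + n * dist x (y : X) := fun n x y =>
    (abs_le.1 (hK y)).1.trans (le_add_of_nonneg_right (by positivity))
  have hbdd : ∀ (n : ℕ) (x : X), BddBelow (range fun y : C => u y + n * dist x (y : X)) := fun n x =>
    ⟨-K, by rintro _ ⟨y, rfl⟩; exact hlow n x y⟩
  have hψlow : ∀ n x, -K ≤ ψ n x := fun n x => le_ciInf (hlow n x)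
  have hψu : ∀ n, ∀ x ∈ C, ψ n x ≤ u x := fun n x hx => by
    simpa using ciInf_le (hbdd n x) ⟨x, hx⟩
  have hψc : ∀ n, Continuous (ψ n) := fun n => by
    refine (LipschitzWith.of_le_add_mul (n : NNReal) fun x x' => ?_).continuous
    simp only [NNReal.coe_natCast]
    rw [← sub_le_iff_le_add]
    refine le_ciInf fun y => ?_
    have h1 := ciInf_le (hbdd n x) y
    have h2 : (n : ℝ) * dist x y ≤ n * (dist x x' + dist x' y) :=
      mul_le_mul_of_nonneg_left (dist_triangle _ _ _) (by positivity)
    simp only [ψ]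
    linarith
  have hK0 : ∀ x ∈ C, u x ≤ K := fun x _ => (abs_le.1 (hK x)).2
  -- The cap at `K` matters off `C`, where `ψ n` may exceed the bound of `u`.
  refine ⟨fun n x => min K (ψ n x), fun n => continuous_const.min (hψc n), fun n x => ?_,
    fun n x hx => (min_le_right _ _).trans (hψu n x hx), fun x hx => ?_⟩
  · have : 0 ≤ K := (abs_nonneg _).trans (hK x)
    exact abs_le.2 ⟨le_min (by linarith) (hψlow n x), min_le_left _ _⟩
  · rw [tendsto_order]
    refine ⟨fun a ha => ?_, fun a ha => Eventually.of_forall fun n =>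
      ((min_le_right _ _).trans (hψu n x hx)).trans_lt ha⟩
    obtain ⟨b, hab, hbu⟩ := exists_between ha
    obtain ⟨δ, hδ, hball⟩ := Metric.mem_nhdsWithin_iff.1 (hu x hx b hbu)
    -- With this `N`, points at distance at least `δ` contribute more than `-K + (b + K) = b`;
    -- closer points contribute more than `b` by lower semicontinuity.
    obtain ⟨N, hN⟩ := exists_nat_gt ((b + K) / δ)
    filter_upwards [eventually_ge_atTop N] with n hn
    refine lt_min (hab.trans (hbu.trans_le (hK0 x hx))) (hab.trans_le (le_ciInf fun y => ?_))
    rcases lt_or_ge (dist (y : X) x) δ with h | h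
    · have : b < u y := hball ⟨h, y.2⟩
      exact this.le.trans (le_add_of_nonneg_right (by positivity))
    · have h1 : (b + K) < N * δ := (div_lt_iff₀ hδ).1 hN
      have h2 : (N : ℝ) * δ ≤ n * dist x y := by
        rw [dist_comm]
        exact mul_le_mul (by exact_mod_cast hn) h hδ.le (by positivity)
      have := (abs_le.1 (hK y)).1
      linarith

end Approximation

/-! ### Superharmonic functions; harmonicity is local. -/

section Super

variable {X : Type*} [TopologicalSpace X] [T2Space X] [LocallyCompactSpace X]
  [SecondCountableTopology X] [MeasurableSpace X] [BorelSpace X]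
  {𝒱 : Set (Set X)} {H : Set X → Kernel X X}

/-- A kernel that solves the Dirichlet problem for continuous data is dominated by superharmonic
functions. -/
theorem integral_le_of_super (hH : IsNormalBauerFamily 𝒱 H)
    {U : Set X} (hU : IsOpen U) {𝒲 : X → Set (Set X)} (h𝒲 : ∀ x ∈ U, 𝒲 x ⊆ fullChoice 𝒱 U x)
    (hsep : PosHyperharmonicSeparates H 𝒲 U) {A : Set X} (hA : IsOpen A)
    (hAc : IsCompact (closure A)) (hAU : A ⊆ U) {T : Kernel X X} [IsMarkovKernel T]
    (hT : IsBoundaryKernel A T)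
    (hTc : ∀ φ : X → ℝ, Continuous φ → ContinuousOn (fun x => ∫ y, φ y ∂(T x)) (closure A))
    (hTh : ∀ φ : X → ℝ, Continuous φ → BddMeas φ → ∀ x ∈ A, ∀ W ∈ 𝒲 x, closure W ⊆ A →
      ∫ z, ∫ y, φ y ∂(T z) ∂(H W x) = ∫ y, φ y ∂(T x))
    {u : X → ℝ} (hu : BddMeas u) (hul : LowerSemicontinuousOn u (closure A))
    (hus : ∀ x ∈ A, ∃ W ∈ 𝒲 x, closure W ⊆ A ∧ ∫ y, u y ∂(H W x) ≤ u x) {x : X} (hx : x ∈ A) :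
    ∫ y, u y ∂(T x) ≤ u x := by
  obtain ⟨K, hK⟩ := hu.bdd
  obtain ⟨φ, hφc, hφK, hφu, hφt⟩ := exists_seq_continuous_tendsto hul hK
  have hφm : ∀ n, BddMeas (φ n) := fun n => ⟨(hφc n).measurable, K, hφK n⟩
  -- For a continuous minorant `φ n` of `u`, the function `u - T (φ n)` satisfies the hypotheses of
  -- the minimum principle: it is nonnegative on the frontier because `T` is Dirac there. Dominated
  -- convergence then replaces `φ n` by `u`.
  have key : ∀ n, ∫ y, φ n y ∂(T x) ≤ u x := by
    intro n
    have hm := (hφm n).integral_kernel T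
    refine sub_nonneg.1 (minimum_principle hH hU h𝒲 hsep hA hAc hAU
      (v := fun x => u x - ∫ y, φ n y ∂(T x)) (hu.sub hm) ?_ ?_ ?_ x (subset_closure hx))
    · simp only [sub_eq_add_neg]
      exact hul.add (hTc _ (hφc n)).neg.lowerSemicontinuousOn
    · intro z hz
      rw [hA.frontier_eq] at hz
      simp only [hT.2 z hz.2, integral_dirac, sub_nonneg]
      exact hφu n z hz.1
    · intro z hz
      obtain ⟨W, hW, hWA, hle⟩ := hus z hz
      have hW' := h𝒲 z (hAU hz) hW
      have := hH.isProbabilityMeasure hW'.1 z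
      refine ⟨W, hW, subset_closure.trans hWA, ?_⟩
      rw [integral_sub (hu.integrable _) (hm.integrable _), hTh _ (hφc n) (hφm n) z hz W hW hWA]
      exact sub_le_sub_right hle _
  have hlim : Tendsto (fun n => ∫ y, φ n y ∂(T x)) atTop (𝓝 (∫ y, u y ∂(T x))) := by
    refine tendsto_integral_of_dominated_convergence (fun _ => K)
      (fun n => (hφm n).meas.aestronglyMeasurable) (integrable_const _)
      (fun n => ae_of_all _ (hφK n)) ?_
    filter_upwards [hT.ae_mem_frontier hx] with y hy
    exact hφt y (frontier_subset_closure hy)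
  exact le_of_tendsto' hlim key

theorem IsNormalBauerFamily.integral_integral (hH : IsNormalBauerFamily 𝒱 H) {V W : Set X}
    (hV : V ∈ 𝒱) (hW : W ∈ 𝒱) (hWV : W ⊆ V) {f : X → ℝ} (hf : BddMeas f) (x : X) :
    ∫ z, ∫ y, f y ∂(H V z) ∂(H W x) = ∫ y, f y ∂(H V x) := by
  have := hH.isMarkovKernel hV
  have := hH.isMarkovKernel hW
  rw [← Kernel.integral_comp (hf.integrable _), hH.comp_eq V hV W hW hWV]

theorem isPosHyperharmonic_ofReal (hH : IsNormalBauerFamily 𝒱 H)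
    {U : Set X} {𝒲 : X → Set (Set X)} (h𝒲 : ∀ x ∈ U, 𝒲 x ⊆ fullChoice 𝒱 U x) {v : X → ℝ}
    (hv : BddMeas v) (hv0 : ∀ x, 0 ≤ v x) (hvl : LowerSemicontinuousOn v U)
    (hvs : ∀ x ∈ U, ∀ W ∈ 𝒲 x, ∫ y, v y ∂(H W x) ≤ v x) :
    IsPosHyperharmonic H 𝒲 U (fun x => ENNReal.ofReal (v x)) := by
  refine ⟨ENNReal.continuous_ofReal.comp_lowerSemicontinuousOn hvl
    (fun _ _ h => ENNReal.ofReal_le_ofReal h), fun x hx W hW => ?_⟩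
  have := hH.isProbabilityMeasure (h𝒲 x hx hW).1 x
  rw [← ofReal_integral_eq_lintegral_ofReal (hv.integrable _) (ae_of_all _ hv0)]
  exact ENNReal.ofReal_le_ofReal (hvs x hx W hW)

/-- The sets of a normal Bauer family are `𝒫`-sets. -/
theorem IsNormalBauerFamily.isPSet (hH : IsNormalBauerFamily 𝒱 H) {V : Set X} (hV : V ∈ 𝒱) :
    IsPSet 𝒱 H V := by
  have hVo := hH.isBasis.isOpen hV
  refine ⟨hVo, fun x hx y hy hxy => ?_⟩
  obtain ⟨𝒲, h𝒲, hsep⟩ := hH.separates V hV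
  have h𝒲' := fun x hx => (h𝒲 x hx).1
  obtain ⟨v, hv, hv0, hvl, hvs, hne⟩ := hsep.exists_real hH hVo h𝒲' hx hy hxy
  refine ⟨fun x => ENNReal.ofReal (v x), isPosHyperharmonic_ofReal hH (fun _ _ => subset_rfl) hv hv0
    hvl fun z hz W hW => ?_, fun h => hne ?_⟩
  · have hWo := hH.isBasis.isOpen hW.1
    have := hH.isMarkovKernel hW.1
    -- (H₃) supplies the inequality only for the sets of one local choice. Comparison with the
    -- kernel of `W` upgrades it to every `W ∈ 𝒱` with closure in `V`.
    refine integral_le_of_super hH hVo h𝒲' hsep hWo (hH.isCompact_closure _ hW.1)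
      (subset_closure.trans hW.2.1) (hH.isBoundaryKernel _ hW.1)
      (fun φ hφ => (hH.continuous_integral _ hW.1 φ hφ).continuousOn)
      (fun φ hφ hφb p hp W' hW' hsub => hH.integral_integral hW.1
        (h𝒲' p (hW.2.1 (subset_closure hp)) hW').1 (subset_closure.trans hsub) hφb p)
      hv (hvl.mono hW.2.1) (fun p hp => ?_) hW.2.2
    obtain ⟨W', hW', hsub⟩ := h𝒲.exists_mem (hW.2.1 (subset_closure hp))
      (eventually_smallSets_closure_subset (hWo.mem_nhds hp))
    exact ⟨W', hW', hsub, hvs p (hW.2.1 (subset_closure hp)) _ hW'⟩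
  · rwa [ENNReal.ofReal_eq_ofReal_iff (hv0 x) (hv0 y)] at h

theorem IsPSet.exists_fullChoice (hH : IsNormalBauerFamily 𝒱 H) {U A : Set X}
    (hU : IsPSet 𝒱 H U) (hA : IsOpen A) (hAU : A ⊆ U) {x : X} (hx : x ∈ A) {P : Set X → Prop}
    (hP : ∀ᶠ W in (𝓝 x).smallSets, W ∈ 𝒱 → x ∈ W → P W) :
    ∃ W ∈ fullChoice 𝒱 U x, closure W ⊆ A ∧ P W := by
  obtain ⟨W, hW, hsub, hPW⟩ := (isLocalChoice_fullChoice hH.isBasis hU.1).exists_mem (hAU hx)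
    ((eventually_smallSets_closure_subset (hA.mem_nhds hx)).and hP)
  exact ⟨W, hW, hsub, hPW hW.1 hW.2.2⟩

/-- The minimum principle for locally superharmonic functions on subsets of `𝒫`-sets. -/
theorem IsPSet.minimum_principle (hH : IsNormalBauerFamily 𝒱 H) {U : Set X} (hU : IsPSet 𝒱 H U)
    {A : Set X} (hA : IsOpen A) (hAc : IsCompact (closure A)) (hAU : A ⊆ U) {v : X → ℝ}
    (hv : BddMeas v) (hvl : LowerSemicontinuousOn v (closure A))
    (hv0 : ∀ z ∈ frontier A, 0 ≤ v z) (hvs : ∀ x ∈ A, LocSuperAt 𝒱 H v x) :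
    ∀ x ∈ closure A, 0 ≤ v x := by
  refine Bauer.minimum_principle hH hU.1 (fun _ _ => subset_rfl) hU.2 hA hAc hAU hv hvl hv0
    fun x hx => ?_
  obtain ⟨W, hW, hsub, hle⟩ := hU.exists_fullChoice hH hA hAU hx (hvs x hx)
  exact ⟨W, hW, subset_closure.trans hsub, hle⟩

/-- Locally superharmonic functions on `V` which are lower semicontinuous on `closure V` dominate
their mean values. -/
theorem IsNormalBauerFamily.integral_le (hH : IsNormalBauerFamily 𝒱 H) {V : Set X} (hV : V ∈ 𝒱)
    {u : X → ℝ} (hu : BddMeas u) (hul : LowerSemicontinuousOn u (closure V))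
    (hus : ∀ x ∈ V, LocSuperAt 𝒱 H u x) (x : X) : ∫ y, u y ∂(H V x) ≤ u x := by
  by_cases hx : x ∈ V
  · have hVo := hH.isBasis.isOpen hV
    have := hH.isMarkovKernel hV
    have hP := hH.isPSet hV
    refine integral_le_of_super hH hVo (fun _ _ => subset_rfl) hP.2 hVo (hH.isCompact_closure _ hV)
      subset_rfl (hH.isBoundaryKernel _ hV)
      (fun φ hφ => (hH.continuous_integral _ hV φ hφ).continuousOn)
      (fun φ hφ hφb p hp W' hW' hsub => hH.integral_integral hV hW'.1
        (subset_closure.trans hsub) hφb p) hu hul (fun p hp => ?_) hx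
    exact hP.exists_fullChoice hH hVo subset_rfl hp (hus p hp)
  · rw [(hH.isBoundaryKernel _ hV).2 x hx, integral_dirac]

theorem IsNormalBauerFamily.integral_congr (hH : IsNormalBauerFamily 𝒱 H) {V : Set X}
    (hV : V ∈ 𝒱) {f g : X → ℝ} (hfg : EqOn f g (closure V)) {x : X} (hx : x ∈ V) :
    ∫ y, f y ∂(H V x) = ∫ y, g y ∂(H V x) := by
  refine integral_congr_ae ?_
  filter_upwards [(hH.isBoundaryKernel _ hV).ae_mem_frontier hx] with y hy
  exact hfg (frontier_subset_closure hy)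

/-- The pointwise mean value property for all sufficiently small sets of `𝒱` containing `x`. -/
def LocHarmAt (𝒱 : Set (Set X)) (H : Set X → Kernel X X) (h : X → ℝ) (x : X) : Prop :=
  ∀ᶠ W in (𝓝 x).smallSets, W ∈ 𝒱 → x ∈ W → ∫ y, h y ∂(H W x) = h x

theorem LocHarmAt.locSuperAt {h : X → ℝ} {x : X} (hh : LocHarmAt 𝒱 H h x) :
    LocSuperAt 𝒱 H h x := by
  filter_upwards [hh] with W hW h1 h2 using (hW h1 h2).le

theorem LocHarmAt.neg {h : X → ℝ} {x : X} (hh : LocHarmAt 𝒱 H h x) :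
    LocHarmAt 𝒱 H (fun y => -h y) x := by
  filter_upwards [hh] with W hW h1 h2
  rw [integral_neg, hW h1 h2]

theorem LocHarmAt.congr (hH : IsNormalBauerFamily 𝒱 H) {f h : X → ℝ} {x : X}
    (hh : LocHarmAt 𝒱 H h x) (hfh : f =ᶠ[𝓝 x] h) : LocHarmAt 𝒱 H f x := by
  filter_upwards [hh, eventually_smallSets_closure_subset hfh] with W hW hsub h1 h2
  rw [hH.integral_congr h1 (g := h) (fun y hy => hsub hy) h2, hW h1 h2]
  exact (hsub (subset_closure h2)).symm

theorem IsHarmonic.locHarmAt {U : Set X} {h : X → ℝ} (hU : IsOpen U)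
    (hh : IsHarmonic 𝒱 H U h) {x : X} (hx : x ∈ U) : LocHarmAt 𝒱 H h x := by
  filter_upwards [eventually_smallSets_closure_subset (hU.mem_nhds hx)] with W hW h1 _
  exact hh.2 W h1 hW x hx

/-- For `x ∈ V`, cut `h` off outside the compact set `closure V`, which makes it bounded and Borel,
and apply `integral_le` to the result and to its negative. -/
theorem IsNormalBauerFamily.integral_eq_of_locHarmAt (hH : IsNormalBauerFamily 𝒱 H) {V : Set X}
    (hV : V ∈ 𝒱) {h : X → ℝ} (hc : ContinuousOn h (closure V))
    (hl : ∀ x ∈ V, LocHarmAt 𝒱 H h x) (x : X) : ∫ y, h y ∂(H V x) = h x := by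
  by_cases hx : x ∈ V
  · have hVo := hH.isBasis.isOpen hV
    let f := (closure V).indicator h
    have hfh : EqOn f h (closure V) := fun y hy => indicator_of_mem hy h
    have hf : BddMeas f := BddMeas.of_continuousOn (hH.isCompact_closure _ hV) hc
    have hfc : ContinuousOn f (closure V) := hc.congr hfh
    have hfl : ∀ x ∈ V, LocHarmAt 𝒱 H f x := fun x hx => (hl x hx).congr hH <| by
      filter_upwards [hVo.mem_nhds hx] with y hy using hfh (subset_closure hy)
    rw [← hH.integral_congr hV hfh hx, ← hfh (subset_closure hx)]
    refine le_antisymm (hH.integral_le hV hf hfc.lowerSemicontinuousOn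
      (fun x hx => (hfl x hx).locSuperAt) x) ?_
    have := hH.integral_le hV hf.neg hfc.neg.lowerSemicontinuousOn
      (fun x hx => (hfl x hx).neg.locSuperAt) x
    rwa [integral_neg, neg_le_neg_iff] at this
  · rw [(hH.isBoundaryKernel _ hV).2 x hx, integral_dirac]

/-- Harmonicity is a local property. -/
theorem IsNormalBauerFamily.isHarmonic_of_locHarmAt (hH : IsNormalBauerFamily 𝒱 H) {U : Set X}
    {h : X → ℝ} (hc : ContinuousOn h U) (hl : ∀ x ∈ U, LocHarmAt 𝒱 H h x) :
    IsHarmonic 𝒱 H U h :=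
  ⟨hc, fun _ hV hVU x _ => hH.integral_eq_of_locHarmAt hV (hc.mono hVU)
    (fun y hy => hl y (hVU (subset_closure hy))) x⟩

theorem IsHarmonic.mono {U U' : Set X} {h : X → ℝ} (hh : IsHarmonic 𝒱 H U h) (hU : U' ⊆ U) :
    IsHarmonic 𝒱 H U' h :=
  ⟨hh.1.mono hU, fun V hV hVU x hx => hh.2 V hV (hVU.trans hU) x (hU hx)⟩

end Super

/-! ### Perron solutions. -/

section Dirichlet

variable {X : Type*} [TopologicalSpace X] [T2Space X] [LocallyCompactSpace X]
  [SecondCountableTopology X] [MeasurableSpace X] [BorelSpace X]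
  {𝒱 : Set (Set X)} {H : Set X → Kernel X X}

/-- No measurability of `h` off `closure V` is needed: the measure lives on the compact frontier of
`V` or is a Dirac measure. -/
theorem IsNormalBauerFamily.integrable (hH : IsNormalBauerFamily 𝒱 H) {V : Set X} (hV : V ∈ 𝒱)
    {h : X → ℝ} (hc : ContinuousOn h (closure V)) (x : X) : Integrable h (H V x) := by
  have := hH.isProbabilityMeasure hV x
  by_cases hx : x ∈ V
  · refine ((BddMeas.of_continuousOn (hH.isCompact_closure _ hV) hc).integrable (H V x)).congr ?_
    filter_upwards [(hH.isBoundaryKernel _ hV).ae_mem_frontier hx] with y hy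
    exact indicator_of_mem (frontier_subset_closure hy) h
  · rw [(hH.isBoundaryKernel _ hV).2 x hx]
    exact integrable_dirac (by simp)

theorem IsHarmonic.add (hH : IsNormalBauerFamily 𝒱 H) {U : Set X} {h h' : X → ℝ}
    (hh : IsHarmonic 𝒱 H U h) (hh' : IsHarmonic 𝒱 H U h') :
    IsHarmonic 𝒱 H U (fun x => h x + h' x) := by
  refine ⟨hh.1.add hh'.1, fun V hV hVU x hx => ?_⟩
  rw [integral_add (hH.integrable hV (hh.1.mono hVU) x) (hH.integrable hV (hh'.1.mono hVU) x),
    hh.2 V hV hVU x hx, hh'.2 V hV hVU x hx]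

theorem IsHarmonic.const_mul {U : Set X} {h : X → ℝ}
    (hh : IsHarmonic 𝒱 H U h) (c : ℝ) : IsHarmonic 𝒱 H U (fun x => c * h x) := by
  refine ⟨continuousOn_const.mul hh.1, fun V hV hVU x hx => ?_⟩
  rw [integral_const_mul, hh.2 V hV hVU x hx]

theorem IsHarmonic.const (hH : IsNormalBauerFamily 𝒱 H) (U : Set X) (c : ℝ) :
    IsHarmonic 𝒱 H U (fun _ => c) := by
  refine ⟨continuousOn_const, fun V hV _ x _ => ?_⟩
  have := hH.isProbabilityMeasure hV x
  simp

theorem IsHarmonic.congr (hH : IsNormalBauerFamily 𝒱 H) {U : Set X} {h h' : X → ℝ}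
    (hh : IsHarmonic 𝒱 H U h) (he : EqOn h' h U) : IsHarmonic 𝒱 H U h' := by
  refine ⟨hh.1.congr he, fun V hV hVU x hx => ?_⟩
  rw [he hx, ← hh.2 V hV hVU x hx]
  by_cases hxV : x ∈ V
  · exact hH.integral_congr hV (he.mono hVU) hxV
  · rw [(hH.isBoundaryKernel _ hV).2 x hxV, integral_dirac, integral_dirac, he hx]

theorem SolvesDirichlet.add (hH : IsNormalBauerFamily 𝒱 H) {U : Set X} {f f' h h' : X → ℝ}
    (hh : SolvesDirichlet 𝒱 H U f h) (hh' : SolvesDirichlet 𝒱 H U f' h') :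
    SolvesDirichlet 𝒱 H U (fun x => f x + f' x) (fun x => h x + h' x) :=
  ⟨hh.1.add hh'.1, fun x hx => by simp only [hh.2.1 hx, hh'.2.1 hx], hh.2.2.add hH hh'.2.2⟩

theorem SolvesDirichlet.const_mul {U : Set X} {f h : X → ℝ}
    (hh : SolvesDirichlet 𝒱 H U f h) (c : ℝ) :
    SolvesDirichlet 𝒱 H U (fun x => c * f x) (fun x => c * h x) :=
  ⟨continuousOn_const.mul hh.1, fun x hx => by simp only [hh.2.1 hx], hh.2.2.const_mul c⟩

theorem SolvesDirichlet.congr (hH : IsNormalBauerFamily 𝒱 H) {U : Set X} {f h h' : X → ℝ}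
    (hh : SolvesDirichlet 𝒱 H U f h) (he : EqOn h' h (closure U)) :
    SolvesDirichlet 𝒱 H U f h' :=
  ⟨hh.1.congr he, fun _ hx => (he (frontier_subset_closure hx)).trans (hh.2.1 hx),
    hh.2.2.congr hH (he.mono subset_closure)⟩

/-- The minimum principle for harmonic functions. -/
theorem IsPSet.nonneg_of_isHarmonic (hH : IsNormalBauerFamily 𝒱 H) {U : Set X}
    (hU : IsPSet 𝒱 H U) {A : Set X} (hA : IsOpen A) (hAc : IsCompact (closure A)) (hAU : A ⊆ U)
    {h : X → ℝ} (hc : ContinuousOn h (closure A)) (hh : IsHarmonic 𝒱 H A h)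
    (h0 : ∀ z ∈ frontier A, 0 ≤ h z) : ∀ x ∈ closure A, 0 ≤ h x := by
  have he : EqOn ((closure A).indicator h) h (closure A) := fun y hy => indicator_of_mem hy h
  intro x hx
  rw [← he hx]
  refine hU.minimum_principle hH hA hAc hAU (BddMeas.of_continuousOn hAc hc)
    (hc.congr he).lowerSemicontinuousOn
    (fun z hz => by rw [he (frontier_subset_closure hz)]; exact h0 z hz) (fun y hy => ?_) x hx
  exact ((hh.congr hH (he.mono subset_closure)).locHarmAt hA hy).locSuperAt

theorem LocSuperAt.add (hH : IsNormalBauerFamily 𝒱 H) {u v : X → ℝ} {x : X} (hu : BddMeas u)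
    (hv : BddMeas v) (hus : LocSuperAt 𝒱 H u x) (hvs : LocSuperAt 𝒱 H v x) :
    LocSuperAt 𝒱 H (fun y => u y + v y) x := by
  filter_upwards [hus, hvs] with W h1 h2 hW hxW
  have := hH.isProbabilityMeasure hW x
  rw [integral_add (hu.integrable _) (hv.integrable _)]
  exact add_le_add (h1 hW hxW) (h2 hW hxW)

theorem LocSuperAt.min (hH : IsNormalBauerFamily 𝒱 H) {u v : X → ℝ} {x : X} (hu : BddMeas u)
    (hv : BddMeas v) (hus : LocSuperAt 𝒱 H u x) (hvs : LocSuperAt 𝒱 H v x) :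
    LocSuperAt 𝒱 H (fun y => min (u y) (v y)) x := by
  filter_upwards [hus, hvs] with W h1 h2 hW hxW
  have := hH.isProbabilityMeasure hW x
  refine le_min (le_trans ?_ (h1 hW hxW)) (le_trans ?_ (h2 hW hxW))
  · exact integral_mono ((hu.min hv).integrable _) (hu.integrable _) fun y => min_le_left _ _
  · exact integral_mono ((hu.min hv).integrable _) (hv.integrable _) fun y => min_le_right _ _

theorem LocSuperAt.const_add_mul (hH : IsNormalBauerFamily 𝒱 H) {u : X → ℝ} {x : X}
    (hu : BddMeas u) (hus : LocSuperAt 𝒱 H u x) (a : ℝ) {b : ℝ} (hb : 0 ≤ b) :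
    LocSuperAt 𝒱 H (fun y => a + b * u y) x := by
  filter_upwards [hus] with W h1 hW hxW
  have := hH.isProbabilityMeasure hW x
  rw [integral_add (integrable_const _) ((hu.integrable _).const_mul b), integral_const_mul]
  simpa using mul_le_mul_of_nonneg_left (h1 hW hxW) hb

theorem locSuperAt_const (hH : IsNormalBauerFamily 𝒱 H) (c : ℝ) (x : X) :
    LocSuperAt 𝒱 H (fun _ => c) x := by
  refine Eventually.of_forall fun W hW _ => ?_
  have := hH.isProbabilityMeasure hW x
  simp

theorem lowerSemicontinuousOn_const_add_mul {u : X → ℝ} {s : Set X}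
    (hu : LowerSemicontinuousOn u s) (a : ℝ) {b : ℝ} (hb : 0 ≤ b) :
    LowerSemicontinuousOn (fun y => a + b * u y) s :=
  Continuous.comp_lowerSemicontinuousOn (g := fun t : ℝ => a + b * t) (by fun_prop) hu
    (fun _ _ h => by simpa using mul_le_mul_of_nonneg_left h hb)

/-- A superharmonic majorant of the boundary function `f`, bounded by `M`. -/
structure IsUpper (𝒱 : Set (Set X)) (H : Set X → Kernel X X) (A : Set X) (f : X → ℝ) (M : ℝ)
    (u : X → ℝ) : Prop where
  meas : Measurable u
  bound : ∀ x, |u x| ≤ M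
  lsc : LowerSemicontinuousOn u (closure A)
  boundary : ∀ z ∈ frontier A, f z ≤ u z
  super : ∀ x ∈ A, LocSuperAt 𝒱 H u x

theorem IsUpper.bddMeas {A : Set X} {f u : X → ℝ} {M : ℝ} (hu : IsUpper 𝒱 H A f M u) :
    BddMeas u := ⟨hu.meas, M, hu.bound⟩

theorem IsUpper.min (hH : IsNormalBauerFamily 𝒱 H) {A : Set X} {f u v : X → ℝ} {M : ℝ}
    (hu : IsUpper 𝒱 H A f M u) (hv : IsUpper 𝒱 H A f M v) :
    IsUpper 𝒱 H A f M (fun x => min (u x) (v x)) where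
  meas := hu.meas.min hv.meas
  bound x := by
    rcases min_choice (u x) (v x) with h | h <;> rw [h]
    exacts [hu.bound x, hv.bound x]
  lsc := hu.lsc.inf hv.lsc
  boundary z hz := le_min (hu.boundary z hz) (hv.boundary z hz)
  super x hx := (hu.super x hx).min hH hu.bddMeas hv.bddMeas (hv.super x hx)

theorem IsUpper.integral_le (hH : IsNormalBauerFamily 𝒱 H) {A : Set X} {f u : X → ℝ} {M : ℝ}
    (hu : IsUpper 𝒱 H A f M u) {V : Set X} (hV : V ∈ 𝒱) (hVA : closure V ⊆ A) (x : X) :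
    ∫ y, u y ∂(H V x) ≤ u x :=
  hH.integral_le hV hu.bddMeas (hu.lsc.mono (hVA.trans subset_closure))
    (fun y hy => hu.super y (hVA (subset_closure hy))) x

/-- Perron's modification of an upper function inside `V`. Within `V` the result is continuous by
(H₄) and harmonic by (H₁). Off `V` it coincides with `u` and elsewhere lies below `u`, so the mean
value inequality of `u` at such points survives. Lower semicontinuity there comes from continuous
minorants of `u`, whose modifications are continuous by (H₂). -/
theorem IsUpper.integral (hH : IsNormalBauerFamily 𝒱 H) {A : Set X} (hA : IsOpen A)
    {f u : X → ℝ} {M : ℝ}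
    (hu : IsUpper 𝒱 H A f M u) {V : Set X} (hV : V ∈ 𝒱) (hVA : closure V ⊆ A) :
    IsUpper 𝒱 H A f M (fun x => ∫ y, u y ∂(H V x)) := by
  have hVo := hH.isBasis.isOpen hV
  have := hH.isMarkovKernel hV
  have hm := hu.bddMeas.integral_kernel (H V)
  have hoff : ∀ x ∉ V, ∫ y, u y ∂(H V x) = u x := fun x hx => by
    rw [(hH.isBoundaryKernel _ hV).2 x hx, integral_dirac]
  refine ⟨hm.meas, fun x => ?_, fun x hx a ha => ?_, fun z hz => ?_, fun x hx => ?_⟩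
  · simpa using norm_integral_le_of_norm_le_const (μ := H V x) (f := u) (C := M)
      (ae_of_all _ hu.bound)
  · by_cases hxV : x ∈ V
    · have hc := (hH.continuousOn_integral V hV u hu.meas hu.bddMeas.bdd).continuousAt
        (hVo.mem_nhds hxV)
      exact mem_nhdsWithin_of_mem_nhds (hc.eventually (lt_mem_nhds ha))
    · replace ha : a < u x := by
        rw [← hoff x hxV]
        exact ha
      obtain ⟨φ, hφc, hφK, hφu, hφt⟩ := exists_seq_continuous_tendsto hu.lsc hu.bound
      obtain ⟨n, hn⟩ := ((hφt x hx).eventually (lt_mem_nhds ha)).exists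
      have hc := (hH.continuous_integral V hV _ (hφc n)).continuousAt (x := x)
      have hlt : a < ∫ y, φ n y ∂(H V x) := by
        rwa [(hH.isBoundaryKernel _ hV).2 x hxV, integral_dirac]
      filter_upwards [mem_nhdsWithin_of_mem_nhds (hc.eventually (lt_mem_nhds hlt)),
        self_mem_nhdsWithin] with y hy hyA
      refine hy.trans_le ?_
      by_cases hyV : y ∈ V
      · refine integral_mono_ae
          (BddMeas.integrable ⟨(hφc n).measurable, M, hφK n⟩ _) (hu.bddMeas.integrable _) ?_
        filter_upwards [(hH.isBoundaryKernel _ hV).ae_mem_frontier hyV] with p hp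
        exact hφu n p (subset_closure (hVA (frontier_subset_closure hp)))
      · rw [(hH.isBoundaryKernel _ hV).2 y hyV, integral_dirac, integral_dirac]
        exact hφu n y hyA
  · rw [hoff]
    · exact hu.boundary z hz
    · intro hzV
      rw [hA.frontier_eq] at hz
      exact hz.2 (hVA (subset_closure hzV))
  · by_cases hxV : x ∈ V
    · filter_upwards [eventually_smallSets_closure_subset (hVo.mem_nhds hxV)] with W hWV hW _
      exact (hH.integral_integral hV hW (subset_closure.trans hWV) hu.bddMeas x).le
    · filter_upwards [hu.super x hx] with W h1 hW hxW
      have := hH.isProbabilityMeasure hW x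
      rw [hoff x hxV]
      exact (integral_mono (hm.integrable _) (hu.bddMeas.integrable _)
        fun y => hu.integral_le hH hV hVA y).trans (h1 hW hxW)

/-- The minimum principle applies to `u + s`. Thus upper functions for `-f` bound the Perron
solution for `f` from below. -/
theorem IsUpper.neg_le (hH : IsNormalBauerFamily 𝒱 H) {U : Set X}
    (hU : IsPSet 𝒱 H U) {A : Set X} (hA : IsOpen A) (hAc : IsCompact (closure A)) (hAU : A ⊆ U)
    {f u s : X → ℝ} {M : ℝ} (hu : IsUpper 𝒱 H A f M u)
    (hs : IsUpper 𝒱 H A (fun x => -f x) M s) {x : X} (hx : x ∈ closure A) : -s x ≤ u x := by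
  have := hU.minimum_principle hH hA hAc hAU (v := fun x => u x + s x) (hu.bddMeas.add hs.bddMeas)
    (hu.lsc.add hs.lsc)
    (fun z hz => by linarith [hu.boundary z hz, hs.boundary z hz])
    (fun y hy => (hu.super y hy).add hH hu.bddMeas hs.bddMeas (hs.super y hy)) x hx
  linarith

/-- The upper Perron solution. -/
noncomputable def perron (𝒱 : Set (Set X)) (H : Set X → Kernel X X) (A : Set X) (f : X → ℝ) (M : ℝ)
    (x : X) : ℝ := ⨅ u : {u : X → ℝ // IsUpper 𝒱 H A f M u}, u.1 x

theorem perron_le {A : Set X} {f u : X → ℝ} {M : ℝ} (hu : IsUpper 𝒱 H A f M u) (x : X) :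
    perron 𝒱 H A f M x ≤ u x := by
  refine ciInf_le (f := fun u : {u : X → ℝ // IsUpper 𝒱 H A f M u} => u.1 x) ⟨-M, ?_⟩ ⟨u, hu⟩
  rintro _ ⟨v, rfl⟩
  exact (abs_le.1 (v.2.bound x)).1

/-- Locally, the Perron solution is given by one of the kernels of the family. -/
theorem exists_perron_eq_integral (hH : IsNormalBauerFamily 𝒱 H) {A : Set X} (hA : IsOpen A)
    {f : X → ℝ} {M : ℝ} (hne : ∃ u, IsUpper 𝒱 H A f M u) {V : Set X} (hV : V ∈ 𝒱)
    (hVA : closure V ⊆ A) :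
    ∃ w : X → ℝ, BddMeas w ∧ ∀ x ∈ V, perron 𝒱 H A f M x = ∫ y, w y ∂(H V x) := by
  have hVo := hH.isBasis.isOpen hV
  have := hH.isMarkovKernel hV
  rcases V.eq_empty_or_nonempty with rfl | hVne
  · exact ⟨fun _ => 0, BddMeas.const 0, by simp⟩
  have : Nonempty V := hVne.to_subtype
  have : Nonempty {u : X → ℝ // IsUpper 𝒱 H A f M u} := let ⟨u, hu⟩ := hne; ⟨⟨u, hu⟩⟩
  let h := perron 𝒱 H A f M
  let d := TopologicalSpace.denseSeq V
  -- The index `k` codes a pair `(j, n)`: at the `j`-th point of a dense sequence in `V`, an upper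
  -- function is chosen within `1/(n+1)` of the infimum.
  have hex : ∀ k : ℕ, ∃ u, IsUpper 𝒱 H A f M u ∧
      u (d k.unpair.1) < h (d k.unpair.1) + 1 / ((k.unpair.2 : ℝ) + 1) := fun k => by
    obtain ⟨u, hu⟩ := exists_lt_of_ciInf_lt
      (lt_add_of_pos_right (h (d k.unpair.1)) (Nat.one_div_pos_of_nat (n := k.unpair.2) (α := ℝ)))
    exact ⟨u.1, u.2, hu⟩
  choose a ha hlt using hex
  -- Running minima turn the chosen upper functions into a decreasing sequence, so that its limit
  -- `w` passes through integrals.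
  let b : ℕ → X → ℝ := fun n => Nat.rec (a 0) (fun n v x => min (v x) (a (n + 1) x)) n
  have hb : ∀ n, IsUpper 𝒱 H A f M (b n) := fun n => by
    induction n with
    | zero => exact ha 0
    | succ n ih => exact ih.min hH (ha (n + 1))
  have hba : ∀ n x, b n x ≤ a n x := fun n x => by
    cases n with
    | zero => exact le_rfl
    | succ n => exact min_le_right _ _
  have hanti : ∀ x, Antitone fun n => b n x := fun x =>
    antitone_nat_of_succ_le fun n => min_le_left _ _
  have hbelow : ∀ x, BddBelow (range fun n => b n x) := fun x =>
    ⟨-M, by rintro _ ⟨n, rfl⟩; exact (abs_le.1 ((hb n).bound x)).1⟩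
  let w : X → ℝ := fun x => ⨅ n, b n x
  have hbw : ∀ x, Tendsto (fun n => b n x) atTop (𝓝 (w x)) := fun x =>
    tendsto_atTop_ciInf (hanti x) (hbelow x)
  have hwm : Measurable w := measurable_of_tendsto_metrizable (fun n => (hb n).meas)
    (tendsto_pi_nhds.2 hbw)
  have hwM : ∀ x, |w x| ≤ M := fun x =>
    le_of_tendsto' (hbw x).abs fun n => (hb n).bound x
  have hw : BddMeas w := ⟨hwm, M, hwM⟩
  -- The modification of `min u (b n)` is itself an upper function and hence dominates the infimum;
  -- then `n → ∞`.
  have hlow : ∀ u, IsUpper 𝒱 H A f M u → ∀ x, h x ≤ ∫ y, min (u y) (w y) ∂(H V x) := by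
    intro u hu x
    have hlim : Tendsto (fun n => ∫ y, min (u y) (b n y) ∂(H V x)) atTop
        (𝓝 (∫ y, min (u y) (w y) ∂(H V x))) :=
      tendsto_integral_of_dominated_convergence (fun _ => M)
        (fun n => (hu.min hH (hb n)).meas.aestronglyMeasurable) (integrable_const _)
        (fun n => ae_of_all _ (hu.min hH (hb n)).bound)
        (ae_of_all _ fun y => tendsto_const_nhds.min (hbw y))
    exact ge_of_tendsto' hlim fun n =>
      perron_le ((hu.min hH (hb n)).integral hH hA hV hVA) x
  have hw_le : ∀ u, IsUpper 𝒱 H A f M u → ∀ x,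
      ∫ y, min (u y) (w y) ∂(H V x) ≤ ∫ y, w y ∂(H V x) := fun u hu x =>
    integral_mono ((hu.bddMeas.min hw).integrable _) (hw.integrable _) fun y => min_le_right _ _
  have hdense : ∀ j, ∫ y, w y ∂(H V (d j)) ≤ h (d j) := by
    intro j
    refine le_of_forall_pos_le_add fun ε hε => ?_
    obtain ⟨n, hn⟩ := exists_nat_one_div_lt hε
    have h1 := hlt (Nat.pair j n)
    simp only [Nat.unpair_pair] at h1
    have h2 : ∫ y, w y ∂(H V (d j)) ≤ ∫ y, a (Nat.pair j n) y ∂(H V (d j)) :=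
      integral_mono (hw.integrable _) ((ha _).bddMeas.integrable _) fun y =>
        (ciInf_le (hbelow y) _).trans (hba _ y)
    have h3 := (ha (Nat.pair j n)).integral_le hH hV hVA (d j)
    linarith
  refine ⟨w, hw, fun x hx => le_antisymm ?_ (le_ciInf fun u => ?_)⟩
  · obtain ⟨u, hu⟩ := hne
    exact (hlow u hu x).trans (hw_le u hu x)
  · obtain ⟨u, hu⟩ := u
    have hmw := hu.bddMeas.min hw
    -- Both `H_V w` and `H_V (min u w)` are continuous on `V` by (H₄). They agree on the dense
    -- sequence, hence on `V`, so `H_V w ≤ u` for every upper function `u`.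
    have hc1 := continuousOn_iff_continuous_domRestrict.1
      (hH.continuousOn_integral V hV w hw.meas hw.bdd)
    have hc2 := continuousOn_iff_continuous_domRestrict.1
      (hH.continuousOn_integral V hV _ hmw.meas hmw.bdd)
    have heq := (TopologicalSpace.denseRange_denseSeq V).equalizer hc1 hc2 <| funext fun j =>
      le_antisymm ((hdense j).trans (hlow u hu _)) (hw_le u hu _)
    have hx' : ∫ y, w y ∂(H V x) = ∫ y, min (u y) (w y) ∂(H V x) := congrFun heq ⟨x, hx⟩
    rw [hx']
    exact (integral_mono (hmw.integrable _) (hu.bddMeas.integrable _)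
      fun y => min_le_left _ _).trans (hu.integral_le hH hV hVA x)

/-- Locally the Perron solution is some `H_V w`, continuous by (H₄) and reproduced by smaller
kernels by (H₁); harmonicity is local. -/
theorem isHarmonic_perron (hH : IsNormalBauerFamily 𝒱 H) {A : Set X} (hA : IsOpen A)
    {f : X → ℝ} {M : ℝ} (hne : ∃ u, IsUpper 𝒱 H A f M u) :
    IsHarmonic 𝒱 H A (perron 𝒱 H A f M) := by
  have key : ∀ x ∈ A, ContinuousAt (perron 𝒱 H A f M) x ∧ LocHarmAt 𝒱 H (perron 𝒱 H A f M) x := by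
    intro x hx
    obtain ⟨V, hV, hxV, hVA⟩ := exists_mem_basis hH.isBasis
      (eventually_smallSets_closure_subset (hA.mem_nhds hx))
    have hVn := (hH.isBasis.isOpen hV).mem_nhds hxV
    obtain ⟨w, hw, heq⟩ := exists_perron_eq_integral hH hA hne hV hVA
    have heq' : perron 𝒱 H A f M =ᶠ[𝓝 x] fun x => ∫ y, w y ∂(H V x) := by
      filter_upwards [hVn] with y hy using heq y hy
    refine ⟨((hH.continuousOn_integral V hV w hw.meas hw.bdd).continuousAt hVn).congr heq'.symm, ?_⟩
    refine LocHarmAt.congr hH ?_ heq'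
    filter_upwards [eventually_smallSets_closure_subset hVn] with W hWV hW _
    exact hH.integral_integral hV hW (subset_closure.trans hWV) hw x
  exact hH.isHarmonic_of_locHarmAt (fun x hx => (key x hx).1.continuousWithinAt)
    fun x hx => (key x hx).2

end Dirichlet

/-! ### Barriers and regularity. -/

section Barrier

variable {X : Type*} [TopologicalSpace X] [T2Space X] [LocallyCompactSpace X]
  [SecondCountableTopology X] [MeasurableSpace X] [BorelSpace X]
  {𝒱 : Set (Set X)} {H : Set X → Kernel X X}

/-- A barrier at the point `z` for the set `A`. -/
structure IsBarrier (𝒱 : Set (Set X)) (H : Set X → Kernel X X) (A : Set X) (z : X)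
    (b : X → ℝ) : Prop where
  bddMeas : BddMeas b
  pos : ∀ x ∈ A, 0 < b x
  harmonic : IsHarmonic 𝒱 H A b
  tendsto : Tendsto b (𝓝[A] z) (𝓝 0)

/-- From a barrier at `z`, which may be small on parts of the boundary away from `z`, one obtains
superharmonic functions on `A` which are small at `z` and equal to `1` outside a given neighborhood
of `z`. -/
theorem IsBarrier.exists_peak (hH : IsNormalBauerFamily 𝒱 H) {A : Set X} (hA : IsOpen A)
    {z : X} {b : X → ℝ} (hb : IsBarrier 𝒱 H A z b) {V : Set X} (hV : V ∈ 𝒱)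
    (hzV : z ∈ V) {η : ℝ} (hη : 0 < η) :
    ∃ p : X → ℝ, Measurable p ∧ (∀ x, 0 ≤ p x) ∧ (∀ x, p x ≤ 1) ∧
      LowerSemicontinuousOn p (closure A) ∧ (∀ x ∈ A, LocSuperAt 𝒱 H p x) ∧
      (∀ x, x ∉ closure V → p x = 1) ∧ ∀ᶠ x in 𝓝[closure A] z, p x < η := by
  classical
  have hVo := hH.isBasis.isOpen hV
  have := hH.isMarkovKernel hV
  have hE : MeasurableSet (frontier V ∩ A) := isClosed_frontier.measurableSet.inter hA.measurableSet
  -- The barrier has a positive lower bound only on compact subsets of `A`. The part `Q` of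
  -- `frontier V ∩ A` left over by `L` is made small for the measure `H V z`; its contribution is `q
  -- = H_V 1_Q`.
  obtain ⟨L, hLE, hLc, hLlt⟩ := hE.exists_isCompact_sdiff_lt (μ := H V z) (measure_ne_top _ _)
    (ε := ENNReal.ofReal (η / 2)) (by simpa using hη)
  set Q := (frontier V ∩ A) \ L with hQ
  have hQm : MeasurableSet Q := hE.diff hLc.measurableSet
  have hQb : BddMeas (Q.indicator fun _ => (1 : ℝ)) := (BddMeas.const 1).indicator hQm
  let q : X → ℝ := fun x => ∫ y, Q.indicator (fun _ => (1 : ℝ)) y ∂(H V x)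
  have hqb : BddMeas q := hQb.integral_kernel (H V)
  have hq0 : ∀ x, 0 ≤ q x := fun x => integral_nonneg fun y => indicator_nonneg (by simp) y
  have hqc : ContinuousOn q V := hH.continuousOn_integral V hV _ hQb.meas hQb.bdd
  have hqz : q z < η / 2 := by
    have : q z = (H V z).real Q := by
      simp only [q]
      rw [integral_indicator hQm]
      simp
    rw [this, Measure.real]
    exact (ENNReal.toReal_lt_of_lt_ofReal hLlt)
  have hbc : ContinuousOn b A := hb.harmonic.1
  obtain ⟨c, hc0, hcL⟩ := hLc.exists_forall_le' (hbc.mono (hLE.trans inter_subset_right))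
    (fun x hx => hb.pos x (hLE hx).2)
  -- On `frontier V ∩ A` the cap `1` is reached: `b / c ≥ 1` on `L`, and `q = 1` on `Q`, where the
  -- kernel is Dirac. This permits gluing with the constant `1` outside `V`.
  let r : X → ℝ := fun x => min 1 (b x / c + q x)
  have hbcb : BddMeas fun x => b x / c := by
    simpa [div_eq_mul_inv] using hb.bddMeas.mul (BddMeas.const c⁻¹)
  have hrb : BddMeas r := (BddMeas.const 1).min (hbcb.add hqb)
  -- The value `0` on `closure V \ A` is the least one, so lower semicontinuity is automatic at
  -- these points.
  let p : X → ℝ := fun x => if x ∈ A ∩ V then r x else if x ∈ closure V \ A then 0 else 1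
  have hr0 : ∀ x ∈ A, 0 ≤ r x := fun x hx =>
    le_min zero_le_one (add_nonneg (div_nonneg (hb.pos x hx).le hc0.le) (hq0 x))
  have hpm : Measurable p := Measurable.ite (hA.inter hVo).measurableSet hrb.meas
    (Measurable.ite (isClosed_closure.measurableSet.diff hA.measurableSet) measurable_const
      measurable_const)
  have hp0 : ∀ x, 0 ≤ p x := fun x => by
    simp only [p]
    split_ifs with h1 h2
    exacts [hr0 x h1.1, le_rfl, zero_le_one]
  have hp1 : ∀ x, p x ≤ 1 := fun x => by
    simp only [p]
    split_ifs with h1 h2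
    exacts [min_le_left _ _, zero_le_one, le_rfl]
  have hpr : ∀ x ∈ A ∩ V, p x = r x := fun x hx => if_pos hx
  have hpb : BddMeas p := ⟨hpm, 1, fun x => abs_le.2 ⟨by linarith [hp0 x], hp1 x⟩⟩
  refine ⟨p, hpm, hp0, hp1, ?_, ?_, ?_, ?_⟩
  · intro x hx a ha
    change a < p x at ha
    change ∀ᶠ y in 𝓝[closure A] x, a < p y
    by_cases hxA : x ∈ A
    · refine mem_nhdsWithin_of_mem_nhds ?_
      by_cases hxV : x ∈ V
      · have hn : A ∩ V ∈ 𝓝 x := (hA.inter hVo).mem_nhds ⟨hxA, hxV⟩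
        have hrc : ContinuousAt r x := continuousAt_const.min
          (((hbc.continuousAt (hA.mem_nhds hxA)).div_const c).add
            (hqc.continuousAt (hVo.mem_nhds hxV)))
        rw [hpr x ⟨hxA, hxV⟩] at ha
        filter_upwards [hrc.eventually (lt_mem_nhds ha), hn] with y hy hyn
        rwa [hpr y hyn]
      · have ha1 : a < 1 := ha.trans_le (hp1 x)
        have key : ∀ᶠ y in 𝓝 x, y ∈ V → a < b y / c + q y ∨ y ∉ A := by
          by_cases hxc : x ∈ closure V
          · have hxf : x ∈ frontier V := by rw [hVo.frontier_eq]; exact ⟨hxc, hxV⟩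
            by_cases hxL : x ∈ L
            · have h1 : a < b x / c := ha1.trans_le ((one_le_div hc0).2 (hcL x hxL))
              have hcont := (hbc.continuousAt (hA.mem_nhds hxA)).div_const c
              filter_upwards [hcont.eventually (lt_mem_nhds h1)] with y hy _
              exact Or.inl (hy.trans_le (le_add_of_nonneg_right (hq0 y)))
            · have hO : IsOpen (A \ L) := hA.sdiff hLc.isClosed
              -- On `frontier V` this bump function is at most the indicator of `Q`, and it equals
              -- `1` at `x`. Since `H_V φ` is continuous, `q` is close to `1` at nearby points of
              -- `V` that lie in `A`.
              obtain ⟨φ, hφ0, hφ1, hφI⟩ := exists_continuous_zero_one_of_isClosed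
                hO.isClosed_compl (isClosed_singleton (x := x))
                (by simpa using ⟨hxA, hxL⟩)
              have hφc := hH.continuous_integral V hV φ φ.continuous
              have hx1 : a < ∫ y, φ y ∂(H V x) := by
                rw [(hH.isBoundaryKernel _ hV).2 x hxV, integral_dirac, hφ1 rfl]
                exact ha1
              filter_upwards [hφc.continuousAt.eventually (lt_mem_nhds hx1)] with y hy hyV
              by_cases hyA : y ∈ A
              · refine Or.inl ((hy.trans_le ?_).trans_le
                  (le_add_of_nonneg_left (div_nonneg (hb.pos y hyA).le hc0.le)))
                refine integral_mono_ae (BddMeas.integrable ⟨φ.continuous.measurable, 1, fun y =>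
                  abs_le.2 ⟨by linarith [(hφI y).1], (hφI y).2⟩⟩ _) (hQb.integrable _) ?_
                filter_upwards [(hH.isBoundaryKernel _ hV).ae_mem_frontier hyV] with w hw
                by_cases hwO : w ∈ A \ L
                · rw [indicator_of_mem (show w ∈ Q from ⟨⟨hw, hwO.1⟩, hwO.2⟩)]
                  exact (hφI w).2
                · rw [hφ0 hwO]
                  exact indicator_nonneg (by simp) w
              · exact Or.inr hyA
          · filter_upwards [isClosed_closure.isOpen_compl.mem_nhds hxc] with y hy hyV
            exact absurd (subset_closure hyV) hy
        filter_upwards [key, hA.mem_nhds hxA] with y hy hyA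
        by_cases hyV : y ∈ V
        · rw [hpr y ⟨hyA, hyV⟩]
          exact lt_min ha1 ((hy hyV).resolve_right (not_not.2 hyA))
        · have : p y = 1 := by
            simp only [p]
            rw [if_neg (fun h => hyV h.2), if_neg (fun h => h.2 hyA)]
          rwa [this]
    · by_cases hxc : x ∈ closure V
      · have : p x = 0 := by
          simp only [p]
          rw [if_neg (fun h => hxA h.1), if_pos ⟨hxc, hxA⟩]
        rw [this] at ha
        exact Eventually.of_forall fun y => ha.trans_le (hp0 y)
      · refine mem_nhdsWithin_of_mem_nhds ?_
        filter_upwards [isClosed_closure.isOpen_compl.mem_nhds hxc] with y hy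
        have : p y = 1 := by
          simp only [p]
          rw [if_neg (fun h => hy (subset_closure h.2)), if_neg (fun h => hy h.1)]
        rw [this]
        exact ha.trans_le (hp1 x)
  · intro x hxA
    by_cases hxV : x ∈ V
    · filter_upwards [eventually_smallSets_closure_subset
        ((hA.inter hVo).mem_nhds ⟨hxA, hxV⟩), hb.harmonic.locHarmAt hA hxA] with W hWs hbW hW hxW
      have := hH.isProbabilityMeasure hW x
      rw [hpr x ⟨hxA, hxV⟩, hH.integral_congr hW (g := r) (fun y hy => hpr y (hWs hy)) hxW]
      refine le_min ?_ ?_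
      · have := integral_mono (hrb.integrable (H W x)) (integrable_const 1)
          (fun y => min_le_left _ _)
        simpa using this
      · refine (integral_mono (hrb.integrable (H W x)) ((hbcb.add hqb).integrable (H W x))
          (fun y => min_le_right _ _)).trans (le_of_eq ?_)
        rw [integral_add (hbcb.integrable _) (hqb.integrable _), integral_div, hbW hW hxW,
          hH.integral_integral hV hW (subset_closure.trans (hWs.trans inter_subset_right)) hQb x]
    -- At a point of `A` off `V` the function has its maximal value `1`.
    · refine Eventually.of_forall fun W hW hxW => ?_
      have := hH.isProbabilityMeasure hW x
      have hpx : p x = 1 := by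
        simp only [p]
        rw [if_neg (fun h => hxV h.2), if_neg (fun h => h.2 hxA)]
      rw [hpx]
      simpa using integral_mono (hpb.integrable (H W x)) (integrable_const 1) hp1
  · intro x hx
    simp only [p]
    rw [if_neg (fun h => hx (subset_closure h.2)), if_neg (fun h => hx h.1)]
  · have h1 : ∀ᶠ x in 𝓝[A] z, b x / c < η / 2 := by
      have := hb.tendsto.div_const c
      rw [zero_div] at this
      exact this.eventually (gt_mem_nhds (by positivity))
    have h2 : ∀ᶠ x in 𝓝 z, q x < η / 2 :=
      (hqc.continuousAt (hVo.mem_nhds hzV)).eventually (gt_mem_nhds hqz)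
    rw [eventually_nhdsWithin_iff] at h1
    filter_upwards [mem_nhdsWithin_of_mem_nhds h1, mem_nhdsWithin_of_mem_nhds h2,
      mem_nhdsWithin_of_mem_nhds (hVo.mem_nhds hzV)] with x hx1 hx2 hxV
    by_cases hxA : x ∈ A
    · rw [hpr x ⟨hxA, hxV⟩]
      exact (min_le_right _ _).trans_lt (by linarith [hx1 hxA])
    · have : p x = 0 := by
        simp only [p]
        rw [if_neg (fun h => hxA h.1), if_pos ⟨subset_closure hxV, hxA⟩]
      rwa [this]

/-- Take `f z + ε/2 + 2M p` for a peak function `p` at `z`. Inside `closure V` the boundary data lie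
below `f z + ε/2`; outside, `p = 1` and the summand `2M` dominates the oscillation of `f`. The
choice `η = ε / (4 (M + 1))` makes `2M p ≤ ε/2` near `z`, and the total is at most `3M + 1` in
absolute value. -/
theorem IsBarrier.exists_isUpper (hH : IsNormalBauerFamily 𝒱 H) {A : Set X} (hA : IsOpen A)
    {z : X} (hz : z ∈ frontier A) {b : X → ℝ} (hb : IsBarrier 𝒱 H A z b) {f : X → ℝ}
    (hf : ContinuousOn f (frontier A)) {M : ℝ} (hM : ∀ x ∈ frontier A, |f x| ≤ M) {ε : ℝ}
    (hε : 0 < ε) (hε1 : ε ≤ 1) :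
    ∃ s, IsUpper 𝒱 H A f (3 * M + 1) s ∧ ∀ᶠ x in 𝓝[closure A] z, s x ≤ f z + ε := by
  have hM0 : 0 ≤ M := (abs_nonneg _).trans (hM z hz)
  have hlt := (hf z hz).eventually (gt_mem_nhds (show f z < f z + ε / 2 by linarith))
  rw [eventually_nhdsWithin_iff] at hlt
  obtain ⟨V, hV, hzV, hVs⟩ := exists_mem_basis hH.isBasis (eventually_smallSets_closure_subset hlt)
  obtain ⟨p, hpm, hp0, hp1, hpl, hps, hpV, hpz⟩ := hb.exists_peak hH hA hV hzV
    (η := ε / (4 * (M + 1))) (by positivity)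
  have hpb : BddMeas p := ⟨hpm, 1, fun x => abs_le.2 ⟨by linarith [hp0 x], hp1 x⟩⟩
  have hfz := abs_le.1 (hM z hz)
  refine ⟨fun x => (f z + ε / 2) + (2 * M) * p x, ⟨?_, fun x => ?_, ?_, fun x hx => ?_,
    fun x hx => ?_⟩, ?_⟩
  · fun_prop
  · have h1 : 0 ≤ (2 * M) * p x := mul_nonneg (by linarith) (hp0 x)
    have h2 : (2 * M) * p x ≤ 2 * M := mul_le_of_le_one_right (by linarith) (hp1 x)
    exact abs_le.2 ⟨by linarith [hfz.1], by linarith [hfz.2]⟩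
  · exact lowerSemicontinuousOn_const_add_mul hpl _ (by linarith)
  · by_cases hxV : x ∈ closure V
    · have h1 : 0 ≤ (2 * M) * p x := mul_nonneg (by linarith) (hp0 x)
      have h2 : f x < f z + ε / 2 := hVs hxV hx
      linarith
    · rw [hpV x hxV]
      have := (abs_le.1 (hM x hx)).2
      linarith [hfz.1]
  · exact (hps x hx).const_add_mul hH hpb _ (by linarith)
  · filter_upwards [hpz] with x hx
    have h1 : (2 * M) * p x ≤ (2 * M) * (ε / (4 * (M + 1))) :=
      mul_le_mul_of_nonneg_left hx.le (by linarith)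
    have h2 : (2 * M) * (ε / (4 * (M + 1))) ≤ ε / 2 := by
      rw [← mul_div_assoc, div_le_div_iff₀ (by positivity) (by positivity)]
      nlinarith
    linarith

/-- A relatively compact open subset of a `𝒫`-set is regular if all boundary points have
barriers. -/
theorem isRegular_of_isBarrier (hH : IsNormalBauerFamily 𝒱 H) {U : Set X}
    (hU : IsPSet 𝒱 H U) {A : Set X} (hA : IsOpen A) (hAc : IsCompact (closure A)) (hAU : A ⊆ U)
    (hb : ∀ z ∈ frontier A, ∃ b, IsBarrier 𝒱 H A z b) : IsRegular 𝒱 H A := by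
  refine ⟨hA, hAc, fun f hf => ⟨?_, ?_, ?_⟩⟩
  · have hfc : IsCompact (frontier A) :=
      hAc.of_isClosed_subset isClosed_frontier frontier_subset_closure
    obtain ⟨M₀, hM₀⟩ := hfc.exists_bound_of_continuousOn hf
    obtain ⟨M, hM0, hM⟩ : ∃ M, 0 ≤ M ∧ ∀ x ∈ frontier A, |f x| ≤ M :=
      ⟨|M₀|, abs_nonneg _, fun x hx => (hM₀ x hx).trans (le_abs_self _)⟩
    have hne : ∃ u, IsUpper 𝒱 H A f (3 * M + 1) u :=
      ⟨fun _ => M, measurable_const, fun _ => by rw [abs_of_nonneg hM0]; linarith,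
        lowerSemicontinuousOn_const, fun z hz => (abs_le.1 (hM z hz)).2,
        fun x _ => locSuperAt_const hH M x⟩
    have : Nonempty {u : X → ℝ // IsUpper 𝒱 H A f (3 * M + 1) u} := let ⟨u, hu⟩ := hne; ⟨⟨u, hu⟩⟩
    have hharm := isHarmonic_perron hH hA hne
    set h := perron 𝒱 H A f (3 * M + 1) with hh
    have hbd : ∀ z ∈ frontier A, ∀ ε, 0 < ε → ε ≤ 1 →
        ∀ᶠ x in 𝓝[closure A] z, |h x - f z| ≤ ε := by
      intro z hz ε hε hε1
      obtain ⟨b, hbz⟩ := hb z hz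
      -- Upper functions for `f` and for `-f` squeeze the Perron solution to within `ε` of `f z`
      -- near `z`.
      obtain ⟨s, hs, hsz⟩ := hbz.exists_isUpper hH hA hz hf hM hε hε1
      obtain ⟨s', hs', hsz'⟩ := hbz.exists_isUpper hH hA hz (f := fun x => -f x) hf.neg
        (fun x hx => (abs_neg (f x)).trans_le (hM x hx)) hε hε1
      filter_upwards [hsz, hsz', self_mem_nhdsWithin] with x hx hx' hxA
      have h1 : h x ≤ s x := perron_le hs x
      have h2 : -s' x ≤ h x := le_ciInf fun u => u.2.neg_le hH hU hA hAc hAU hs' hxA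
      exact abs_le.2 ⟨by linarith, by linarith⟩
    have heq : EqOn h f (frontier A) := by
      intro z hz
      refine sub_eq_zero.1 (abs_nonpos_iff.1 (le_of_forall_pos_le_add fun ε hε => ?_))
      have := (hbd z hz (min ε 1) (lt_min hε one_pos) (min_le_right _ _)).self_of_nhdsWithin
        (frontier_subset_closure hz)
      rw [zero_add]
      exact this.trans (min_le_left _ _)
    refine ⟨h, fun x hx => ?_, heq, hharm⟩
    by_cases hxA : x ∈ A
    · exact (hharm.1.continuousAt (hA.mem_nhds hxA)).continuousWithinAt
    · have hz : x ∈ frontier A := by rw [hA.frontier_eq]; exact ⟨hx, hxA⟩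
      rw [ContinuousWithinAt, Metric.tendsto_nhds]
      intro ε hε
      filter_upwards [hbd x hz (min (ε / 2) 1) (lt_min (by linarith) one_pos) (min_le_right _ _)]
        with y hy
      rw [Real.dist_eq, heq hz]
      linarith [min_le_left (ε / 2) 1]
  · intro h h' hh hh' x hx
    have h1 := hh.add hH (hh'.const_mul (-1))
    have h2 := hh'.add hH (hh.const_mul (-1))
    have h3 := hU.nonneg_of_isHarmonic hH hA hAc hAU h1.1 h1.2.2
      (fun z hz => by rw [hh.2.1 hz, hh'.2.1 hz]; linarith) x hx
    have h4 := hU.nonneg_of_isHarmonic hH hA hAc hAU h2.1 h2.2.2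
      (fun z hz => by rw [hh.2.1 hz, hh'.2.1 hz]; linarith) x hx
    linarith
  · intro hf0 h hh
    exact hU.nonneg_of_isHarmonic hH hA hAc hAU hh.1 hh.2.2
      (fun z hz => by rw [hh.2.1 hz]; exact hf0 z hz)

end Barrier

/-! ### Harmonic kernels of regular sets. -/

section RegularKernel

open scoped CompactlySupported BoundedContinuousFunction

/-- Closed sets form a generating π-system, and their indicators are limits of bounded continuous
functions. -/
theorem measurable_of_measurable_integral {X Y : Type*} [TopologicalSpace X] [MeasurableSpace X]
    [BorelSpace X] [HasOuterApproxClosed X] [MeasurableSpace Y] {μ : Y → Measure X}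
    (hμ : ∀ y, IsProbabilityMeasure (μ y))
    (h : ∀ f : X →ᵇ ℝ, Measurable fun y => ∫ x, f x ∂(μ y)) : Measurable μ := by
  refine Measurable.measure_of_isPiSystem_of_isProbabilityMeasure
    ((BorelSpace.measurable_eq (α := X)).trans borel_eq_generateFrom_isClosed)
    isPiSystem_isClosed fun F hF => ?_
  have hF' : IsClosed F := hF
  refine measurable_of_tendsto_metrizable (f := fun n y => ∫⁻ x, hF'.apprSeq n x ∂(μ y)) (fun n => ?_)
    (tendsto_pi_nhds.2 fun y => HasOuterApproxClosed.tendsto_lintegral_apprSeq hF' (μ y))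
  have heq : ∀ y, ∫⁻ x, hF'.apprSeq n x ∂(μ y) =
      ENNReal.ofReal (∫ x, (hF'.apprSeq n x : ℝ) ∂(μ y)) := fun y => by
    rw [← BoundedContinuousFunction.toReal_lintegral_coe_eq_integral, ENNReal.ofReal_toReal]
    exact (BoundedContinuousFunction.lintegral_lt_top_of_nnreal (μ y) _).ne
  simp_rw [heq]
  exact (h ⟨⟨fun x => (hF'.apprSeq n x : ℝ),
    NNReal.continuous_coe.comp (hF'.apprSeq n).continuous⟩, (hF'.apprSeq n).map_bounded'⟩).ennreal_ofReal

variable {X : Type*} [TopologicalSpace X] [T2Space X] [LocallyCompactSpace X]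
  [SecondCountableTopology X] [MeasurableSpace X] [BorelSpace X]
  {𝒱 : Set (Set X)} {H : Set X → Kernel X X}

/-- The harmonic measure at a point of a regular set. -/
theorem IsRegular.exists_measure (hH : IsNormalBauerFamily 𝒱 H) {A : Set X}
    (hA : IsRegular 𝒱 H A) {x : X} (hx : x ∈ A) :
    ∃ μ : Measure X, IsProbabilityMeasure μ ∧ μ (frontier A)ᶜ = 0 ∧
      ∀ f h : X → ℝ, ContinuousOn f (frontier A) → SolvesDirichlet 𝒱 H A f h →
        ∫ y, f y ∂μ = h x := by
  classical
  obtain ⟨hAo, hAc, hsolve⟩ := hA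
  have hfc : IsCompact (frontier A) :=
    hAc.of_isClosed_subset isClosed_frontier frontier_subset_closure
  have : CompactSpace (frontier A) := isCompact_iff_compactSpace.1 hfc
  -- Riesz representation works on the compact space `frontier A`, while Dirichlet data are
  -- functions on `X`; the value `0` off the frontier is irrelevant.
  let ext : (frontier A → ℝ) → X → ℝ := fun F y => if hy : y ∈ frontier A then F ⟨y, hy⟩ else 0
  have hext : ∀ F, ∀ y : frontier A, ext F y = F y := fun F y => by simp [ext]
  have hextc : ∀ F, Continuous F → ContinuousOn (ext F) (frontier A) := fun F hF => by
    rw [continuousOn_iff_continuous_domRestrict]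
    convert hF using 1
    ext y
    exact hext F y
  have hex : ∀ F : C_c(frontier A, ℝ), ∃ h, SolvesDirichlet 𝒱 H A (ext F) h := fun F =>
    (hsolve _ (hextc F F.continuous)).1
  choose sol hsol using hex
  have hxc := subset_closure hx
  have huniq : ∀ (F : C_c(frontier A, ℝ)) (f h : X → ℝ), SolvesDirichlet 𝒱 H A f h →
      (∀ y : frontier A, f y = F y) → h x = sol F x := by
    intro F f h hh hfF
    refine (hsolve _ (hextc F F.continuous)).2.1 h (sol F) ⟨hh.1, fun y hy => ?_, hh.2.2⟩ (hsol F) hxc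
    rw [hh.2.1 hy, hfF ⟨y, hy⟩, ← hext F ⟨y, hy⟩]
  let Λ₀ : C_c(frontier A, ℝ) →ₗ[ℝ] ℝ :=
    { toFun := fun F => sol F x
      map_add' := fun F G => by
        refine (huniq _ _ _ ((hsol F).add hH (hsol G)) fun y => ?_).symm
        simp [hext]
      map_smul' := fun c F => by
        refine (huniq _ _ _ ((hsol F).const_mul c) fun y => ?_).symm
        simp [hext] }
  let Λ : C_c(frontier A, ℝ) →ₚ[ℝ] ℝ := PositiveLinearMap.mk₀ Λ₀ fun F hF => by
    refine (hsolve _ (hextc F F.continuous)).2.2 (fun z hz => ?_) (sol F) (hsol F) x hxc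
    rw [hext F ⟨z, hz⟩]
    exact hF ⟨z, hz⟩
  let ν := RealRMK.rieszMeasure Λ
  have hme : MeasurableEmbedding (Subtype.val : frontier A → X) :=
    MeasurableEmbedding.subtype_coe isClosed_frontier.measurableSet
  have hint : ∀ f h : X → ℝ, ContinuousOn f (frontier A) → SolvesDirichlet 𝒱 H A f h →
        ∫ y, f y ∂(ν.map Subtype.val) = h x := by
    intro f h hf hh
    rw [hme.integral_map]
    let F : C_c(frontier A, ℝ) := ⟨⟨fun y => f y, continuousOn_iff_continuous_domRestrict.1 hf⟩,
      HasCompactSupport.of_compactSpace _⟩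
    have h1 : ∫ y, F y ∂ν = Λ F := RealRMK.integral_rieszMeasure Λ F
    rw [huniq F f h hh fun y => rfl]
    exact h1
  have hfin : IsFiniteMeasure ν := by
    infer_instance
  -- The constant `1` solves its own Dirichlet problem, so the Riesz measure has mass `1`.
  have hone := hint (fun _ => 1) (fun _ => 1) continuousOn_const
    ⟨continuousOn_const, fun _ _ => rfl, IsHarmonic.const hH A 1⟩
  refine ⟨ν.map Subtype.val, ⟨?_⟩, ?_, hint⟩
  · simp only [integral_const, smul_eq_mul, mul_one, Measure.real] at hone
    exact (ENNReal.toReal_eq_one_iff _).1 hone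
  · rw [hme.map_apply]
    simp

/-- Harmonic measures at points of `A` are combined with Dirac measures off `A`. Measurability
follows because integrating a bounded continuous `f` gives its Dirichlet solution on `A` and `f`
itself off `A`. -/
theorem IsRegular.exists_isDirichletKernel (hH : IsNormalBauerFamily 𝒱 H) {A : Set X}
    (hA : IsRegular 𝒱 H A) : ∃ T, IsDirichletKernel 𝒱 H A T := by
  classical
  have hex : ∀ x, ∃ μ : Measure X, IsProbabilityMeasure μ ∧ (x ∈ A → μ (frontier A)ᶜ = 0 ∧
      ∀ f h : X → ℝ, ContinuousOn f (frontier A) → SolvesDirichlet 𝒱 H A f h →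
        ∫ y, f y ∂μ = h x) ∧ (x ∉ A → μ = Measure.dirac x) := fun x => by
    by_cases hx : x ∈ A
    · obtain ⟨μ, h1, h2, h3⟩ := hA.exists_measure hH hx
      exact ⟨μ, h1, fun _ => ⟨h2, h3⟩, fun h => absurd hx h⟩
    · exact ⟨Measure.dirac x, inferInstance, fun h => absurd h hx, fun _ => rfl⟩
  choose μ hμp hμA hμ using hex
  obtain ⟨hAo, hAc, hsolve⟩ := hA
  have hm : Measurable μ := by
    refine measurable_of_measurable_integral hμp fun f => ?_
    have hfc : ContinuousOn (f : X → ℝ) (frontier A) := f.continuous.continuousOn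
    obtain ⟨h, hh⟩ := (hsolve f hfc).1
    have : (fun y => ∫ x, f x ∂(μ y)) = A.piecewise h f := by
      ext y
      by_cases hy : y ∈ A
      · rw [piecewise_eq_of_mem _ _ _ hy]
        exact (hμA y hy).2 f h hfc hh
      · rw [piecewise_eq_of_notMem _ _ _ hy, hμ y hy, integral_dirac]
    rw [this]
    exact (hh.1.mono subset_closure).measurable_piecewise f.continuous.continuousOn
      hAo.measurableSet
  refine ⟨⟨μ, hm⟩, ⟨fun x hx => (hμA x hx).1, fun x hx => hμ x hx⟩, fun f hf => ?_⟩
  obtain ⟨h, hh⟩ := (hsolve f hf).1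
  refine hh.congr hH fun x hx => ?_
  by_cases hxA : x ∈ A
  · exact (hμA x hxA).2 f h hf hh
  · have hxf : x ∈ frontier A := by rw [hAo.frontier_eq]; exact ⟨hx, hxA⟩
    simp only [Kernel.coe_mk, hμ x hxA, integral_dirac]
    exact (hh.2.1 hxf).symm

theorem IsRegular.isDirichletKernel (hH : IsNormalBauerFamily 𝒱 H) {A : Set X}
    (hA : IsRegular 𝒱 H A) : IsDirichletKernel 𝒱 H A (harmonicKernel 𝒱 H A) := by
  have h : IsRegular 𝒱 H A ∧ ∃ T, IsDirichletKernel 𝒱 H A T :=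
    ⟨hA, hA.exists_isDirichletKernel hH⟩
  rw [harmonicKernel, dif_pos h]
  exact h.2.choose_spec

theorem IsDirichletKernel.integral_eq {A : Set X}
    (hA : IsRegular 𝒱 H A) {T : Kernel X X} (hT : IsDirichletKernel 𝒱 H A T) {f h : X → ℝ}
    (hf : ContinuousOn f (frontier A)) (hh : SolvesDirichlet 𝒱 H A f h) {x : X}
    (hx : x ∈ closure A) : ∫ y, f y ∂(T x) = h x :=
  (hA.2.2 f hf).2.1 _ _ (hT.2 f hf) hh hx

theorem IsDirichletKernel.integral_self {A : Set X}
    (hA : IsRegular 𝒱 H A) {T : Kernel X X} (hT : IsDirichletKernel 𝒱 H A T) {h : X → ℝ}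
    (hc : ContinuousOn h (closure A)) (hh : IsHarmonic 𝒱 H A h) {x : X}
    (hx : x ∈ closure A) : ∫ y, h y ∂(T x) = h x :=
  hT.integral_eq hA (hc.mono frontier_subset_closure) ⟨hc, fun _ _ => rfl, hh⟩ hx

theorem IsDirichletKernel.isMarkovKernel (hH : IsNormalBauerFamily 𝒱 H) {A : Set X}
    (hA : IsRegular 𝒱 H A) {T : Kernel X X} (hT : IsDirichletKernel 𝒱 H A T) :
    IsMarkovKernel T := by
  refine ⟨fun x => ⟨?_⟩⟩
  by_cases hx : x ∈ A
  · have hone := hT.integral_self hA (h := fun _ => 1) continuousOn_const (IsHarmonic.const hH A 1)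
      (subset_closure hx)
    simp only [integral_const, smul_eq_mul, mul_one, Measure.real] at hone
    exact (ENNReal.toReal_eq_one_iff _).1 hone
  · rw [hT.1.2 x hx]
    simp

/-- For bounded continuous data this is harmonicity of the Dirichlet solution. Such data determine
finite measures, so the identity extends to bounded Borel data. -/
theorem IsDirichletKernel.integral_integral (hH : IsNormalBauerFamily 𝒱 H) {A : Set X}
    (hA : IsRegular 𝒱 H A) {T : Kernel X X} (hT : IsDirichletKernel 𝒱 H A T) {V : Set X}
    (hV : V ∈ 𝒱) (hVA : closure V ⊆ A) {f : X → ℝ} (hf : BddMeas f) {x : X} (hx : x ∈ A) :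
    ∫ z, ∫ y, f y ∂(T z) ∂(H V x) = ∫ y, f y ∂(T x) := by
  have := hH.isMarkovKernel hV
  have := hT.isMarkovKernel hH hA
  have heq : (T ∘ₖ H V) x = T x := by
    refine ext_of_forall_integral_eq_of_IsFiniteMeasure fun φ => ?_
    rw [Kernel.integral_comp (φ.integrable _)]
    exact (hT.2 φ φ.continuous.continuousOn).2.2.2 V hV hVA x hx
  rw [← Kernel.integral_comp (hf.integrable _), heq]

/-- Property (H₄) passes to regular sets because locally `T f = H_V (T f)` with `T f` bounded and
Borel. -/
theorem IsDirichletKernel.continuousOn_integral (hH : IsNormalBauerFamily 𝒱 H) {A : Set X}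
    (hA : IsRegular 𝒱 H A) {T : Kernel X X} (hT : IsDirichletKernel 𝒱 H A T) {f : X → ℝ}
    (hf : BddMeas f) : ContinuousOn (fun x => ∫ y, f y ∂(T x)) A := by
  intro x hx
  obtain ⟨V, hV, hxV, hVA⟩ := exists_mem_basis hH.isBasis
    (eventually_smallSets_closure_subset (hA.1.mem_nhds hx))
  have hVn := (hH.isBasis.isOpen hV).mem_nhds hxV
  have := hT.isMarkovKernel hH hA
  have hb := hf.integral_kernel T
  refine (((hH.continuousOn_integral V hV _ hb.meas hb.bdd).continuousAt hVn).congr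
    ?_).continuousWithinAt
  filter_upwards [hVn] with y hy
  exact hT.integral_integral hH hA hV hVA hf (hVA (subset_closure hy))

theorem IsDirichletKernel.isHarmonic_integral (hH : IsNormalBauerFamily 𝒱 H) {A : Set X}
    (hA : IsRegular 𝒱 H A) {T : Kernel X X} (hT : IsDirichletKernel 𝒱 H A T) {f : X → ℝ}
    (hf : BddMeas f) : IsHarmonic 𝒱 H A (fun x => ∫ y, f y ∂(T x)) :=
  ⟨hT.continuousOn_integral hH hA hf, fun _ hV hVA _ hx =>
    hT.integral_integral hH hA hV hVA hf hx⟩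

theorem IsDirichletKernel.integral_le (hH : IsNormalBauerFamily 𝒱 H) {U : Set X}
    (hU : IsPSet 𝒱 H U) {A : Set X} (hAU : A ⊆ U) (hA : IsRegular 𝒱 H A) {T : Kernel X X}
    (hT : IsDirichletKernel 𝒱 H A T) {u : X → ℝ} (hu : BddMeas u)
    (hul : LowerSemicontinuousOn u (closure A)) (hus : ∀ x ∈ A, LocSuperAt 𝒱 H u x) {x : X}
    (hx : x ∈ A) : ∫ y, u y ∂(T x) ≤ u x := by
  have := hT.isMarkovKernel hH hA
  exact integral_le_of_super hH hU.1 (fun _ _ => subset_rfl) hU.2 hA.1 hA.2.1 hAU hT.1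
    (fun φ hφ => (hT.2 φ hφ.continuousOn).1)
    (fun φ _ hφb p hp W hW hWA => hT.integral_integral hH hA hW.1 hWA hφb hp) hu hul
    (fun p hp => hU.exists_fullChoice hH hA.1 hAU hp (hus p hp)) hx

end RegularKernel

/-! ### The sublevel sets of `g`. -/

section Geometry

variable {X : Type*} [TopologicalSpace X] [T2Space X] [LocallyCompactSpace X]
  [SecondCountableTopology X] [MeasurableSpace X] [BorelSpace X]

/-- The standing assumptions on the set `K` to be collapsed and its neighborhood `W₀`. -/
structure DarningData (𝒱 : Set (Set X)) (H : Set X → Kernel X X) (K W₀ : Set X) : Prop where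
  family : IsNormalBauerFamily 𝒱 H
  isCompact : IsCompact K
  nonempty : K.Nonempty
  regular : IsRegular 𝒱 H W₀
  isPSet : IsPSet 𝒱 H W₀
  subset : K ⊆ W₀
  regular_sdiff : IsRegular 𝒱 H (W₀ \ K)
  pos : ∀ x ∈ W₀ \ K, 0 < gFun 𝒱 H K W₀ x

/-- `O_t = K ∪ A_t`, the preimage of `U_t` in `X`. -/
def OSet (𝒱 : Set (Set X)) (H : Set X → Kernel X X) (K W₀ : Set X) (t : ℝ) : Set X :=
  {x ∈ W₀ | gFun 𝒱 H K W₀ x < t}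

variable {𝒱 : Set (Set X)} {H : Set X → Kernel X X} {K W₀ : Set X}

local notation "g" => gFun 𝒱 H K W₀
local notation "A" => ASet 𝒱 H K W₀
local notation "S" => SSet 𝒱 H K W₀
local notation "O" => OSet 𝒱 H K W₀

/-- The boundaries of `W₀ ∖ K` and of `A_t` consist of an outer part and a part in `K`; this gives
continuity of data that are `f` on the former and `0` on the latter. -/
theorem continuousOn_indicator_of_isClosed {s t : Set X} (hs : IsClosed s) (ht : IsClosed t)
    {r : Set X} (hsr : s ⊆ r) (htr : Disjoint t r) {f : X → ℝ} (hf : ContinuousOn f s) :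
    ContinuousOn (r.indicator f) (s ∪ t) := by
  refine ContinuousOn.union_of_isClosed (hf.congr fun x hx => indicator_of_mem (hsr hx) f)
    (continuousOn_const (c := (0 : ℝ)) |>.congr fun x hx =>
      indicator_of_notMem (fun h => htr.ne_of_mem hx h rfl) f) hs ht

namespace DarningData

theorem isOpen_W (d : DarningData 𝒱 H K W₀) : IsOpen W₀ := d.regular.1

theorem isClosed_K (d : DarningData 𝒱 H K W₀) : IsClosed K := d.isCompact.isClosed

theorem frontier_sdiff_subset (d : DarningData 𝒱 H K W₀) : frontier (W₀ \ K) ⊆ frontier W₀ ∪ K := by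
  rw [d.regular_sdiff.1.frontier_eq, d.isOpen_W.frontier_eq]
  rintro x ⟨hx, hx'⟩
  by_cases hxK : x ∈ K
  · exact Or.inr hxK
  · exact Or.inl ⟨closure_mono sdiff_subset hx, fun h => hx' ⟨h, hxK⟩⟩

theorem disjoint_frontier (d : DarningData 𝒱 H K W₀) : Disjoint K (frontier W₀) := by
  rw [Set.disjoint_left, d.isOpen_W.frontier_eq]
  exact fun x hx h => h.2 (d.subset hx)

theorem isDirichletKernel_sdiff (d : DarningData 𝒱 H K W₀) :
    IsDirichletKernel 𝒱 H (W₀ \ K) (harmonicKernel 𝒱 H (W₀ \ K)) :=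
  d.regular_sdiff.isDirichletKernel d.family

theorem g_eq_integral (_d : DarningData 𝒱 H K W₀) (x : X) : g x =
    ∫ y, (frontier W₀).indicator (fun _ => (1 : ℝ)) y ∂(harmonicKernel 𝒱 H (W₀ \ K) x) := by
  rw [integral_indicator isClosed_frontier.measurableSet]
  simp [gFun]

theorem g_solves (d : DarningData 𝒱 H K W₀) :
    SolvesDirichlet 𝒱 H (W₀ \ K) ((frontier W₀).indicator fun _ => (1 : ℝ)) g := by
  have h := d.isDirichletKernel_sdiff.2 ((frontier W₀).indicator fun _ => (1 : ℝ))
    ((continuousOn_indicator_of_isClosed isClosed_frontier d.isClosed_K subset_rfl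
      d.disjoint_frontier continuousOn_const).mono d.frontier_sdiff_subset)
  simp_rw [← d.g_eq_integral] at h
  exact h

theorem g_eq_zero (d : DarningData 𝒱 H K W₀) {x : X} (hx : x ∈ K) : g x = 0 := by
  rw [d.g_eq_integral, d.isDirichletKernel_sdiff.1.2 x (fun h => h.2 hx), integral_dirac,
    indicator_of_notMem (fun h => d.disjoint_frontier.ne_of_mem hx h rfl)]

theorem g_eq_one (d : DarningData 𝒱 H K W₀) {x : X} (hx : x ∈ frontier W₀) : g x = 1 := by
  have hx' : x ∉ W₀ := by
    rw [d.isOpen_W.frontier_eq] at hx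
    exact hx.2
  rw [d.g_eq_integral, d.isDirichletKernel_sdiff.1.2 x (fun h => hx' h.1), integral_dirac,
    indicator_of_mem hx]

theorem g_bddMeas (d : DarningData 𝒱 H K W₀) : BddMeas g := by
  have := d.isDirichletKernel_sdiff.isMarkovKernel d.family d.regular_sdiff
  have h := ((BddMeas.const (X := X) 1).indicator
    (isClosed_frontier (s := W₀)).measurableSet).integral_kernel (harmonicKernel 𝒱 H (W₀ \ K))
  simp_rw [← d.g_eq_integral] at h
  exact h

theorem g_nonneg (_d : DarningData 𝒱 H K W₀) (x : X) : 0 ≤ g x := ENNReal.toReal_nonneg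

theorem g_le_one (d : DarningData 𝒱 H K W₀) (x : X) : g x ≤ 1 := by
  have := d.isDirichletKernel_sdiff.isMarkovKernel d.family d.regular_sdiff
  exact measureReal_le_one

theorem continuousOn_g (d : DarningData 𝒱 H K W₀) : ContinuousOn g (closure W₀) := by
  have h : closure W₀ ⊆ closure (W₀ \ K) ∪ K := by
    have : W₀ ⊆ (W₀ \ K) ∪ K := subset_sdiff_union W₀ K
    exact (closure_mono this).trans_eq (by rw [closure_union, d.isClosed_K.closure_eq])
  refine ContinuousOn.mono (ContinuousOn.union_of_isClosed d.g_solves.1 ?_ isClosed_closure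
    d.isClosed_K) h
  exact (continuousOn_const (c := (0 : ℝ))).congr fun x hx => d.g_eq_zero hx

theorem isHarmonic_g (d : DarningData 𝒱 H K W₀) : IsHarmonic 𝒱 H (W₀ \ K) g := d.g_solves.2.2

theorem isOpen_O (d : DarningData 𝒱 H K W₀) (t : ℝ) : IsOpen (O t) :=
  (d.continuousOn_g.mono subset_closure).isOpen_inter_preimage d.isOpen_W isOpen_Iio

theorem K_subset_O (d : DarningData 𝒱 H K W₀) {t : ℝ} (ht : 0 < t) : K ⊆ O t := fun x hx =>
  ⟨d.subset hx, by rw [d.g_eq_zero hx]; exact ht⟩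

theorem A_eq (_d : DarningData 𝒱 H K W₀) (t : ℝ) : A t = O t \ K := by
  ext x
  exact ⟨fun h => ⟨⟨h.1.1, h.2⟩, h.1.2⟩, fun h => ⟨⟨h.1.1, h.2⟩, h.1.2⟩⟩

theorem isOpen_A (d : DarningData 𝒱 H K W₀) (t : ℝ) : IsOpen (A t) := by
  rw [d.A_eq]
  exact (d.isOpen_O t).sdiff d.isClosed_K

theorem A_subset (_d : DarningData 𝒱 H K W₀) (t : ℝ) : A t ⊆ W₀ \ K := fun _ hx => hx.1

theorem A_subset_O (d : DarningData 𝒱 H K W₀) (t : ℝ) : A t ⊆ O t := by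
  rw [d.A_eq]
  exact sdiff_subset

theorem O_eq (d : DarningData 𝒱 H K W₀) {t : ℝ} (ht : 0 < t) : O t = A t ∪ K := by
  rw [d.A_eq, sdiff_union_self, union_eq_left.2 (d.K_subset_O ht)]

theorem measurableSet_S (d : DarningData 𝒱 H K W₀) (t : ℝ) : MeasurableSet (S t) :=
  (d.isOpen_W.sdiff d.isClosed_K).measurableSet.inter
    (d.g_bddMeas.meas (measurableSet_singleton t))

/-- By continuity `g ≤ t < 1` on the closure, whereas `g = 1` on `frontier W₀`. -/
theorem closure_O_subset (d : DarningData 𝒱 H K W₀)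
    {t : ℝ} (ht : t < 1) : closure (O t) ⊆ {x ∈ W₀ | g x ≤ t} := by
  have h1 : IsClosed {x ∈ closure W₀ | g x ≤ t} :=
    d.continuousOn_g.preimage_isClosed_of_isClosed isClosed_closure isClosed_Iic
  have h2 : closure (O t) ⊆ {x ∈ closure W₀ | g x ≤ t} :=
    closure_minimal (fun x hx => ⟨subset_closure hx.1, hx.2.le⟩) h1
  intro x hx
  refine ⟨?_, (h2 hx).2⟩
  by_contra hxW
  have := d.g_eq_one (x := x) (by rw [d.isOpen_W.frontier_eq]; exact ⟨(h2 hx).1, hxW⟩)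
  linarith [(h2 hx).2]

theorem isCompact_closure_O (d : DarningData 𝒱 H K W₀) (t : ℝ) : IsCompact (closure (O t)) :=
  d.regular.2.1.of_isClosed_subset isClosed_closure (closure_mono fun _ hx => hx.1)

/-- Only an inclusion: a point of `S_t` need not a priori be a limit of points where `g < t`. That
`σ_t` lives on the frontier is therefore proved separately, in `ae_mem_frontier_O` and
`IsDarning.ae_mem_frontier`. -/
theorem frontier_O_subset (d : DarningData 𝒱 H K W₀)
    {t : ℝ} (ht0 : 0 < t) (ht : t < 1) : frontier (O t) ⊆ S t := by
  rw [(d.isOpen_O t).frontier_eq]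
  rintro x ⟨hx, hxO⟩
  obtain ⟨hxW, hxt⟩ := d.closure_O_subset ht hx
  have hge : t ≤ g x := by
    by_contra! h
    exact hxO ⟨hxW, h⟩
  refine ⟨⟨hxW, fun hxK => ?_⟩, le_antisymm hxt hge⟩
  rw [d.g_eq_zero hxK] at hge
  linarith

theorem disjoint_K_S (_d : DarningData 𝒱 H K W₀) (t : ℝ) : Disjoint K (S t) :=
  Set.disjoint_left.2 fun _ hx h => h.1.2 hx

theorem frontier_A_subset (d : DarningData 𝒱 H K W₀)
    {t : ℝ} : frontier (A t) ⊆ frontier (O t) ∪ K := by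
  rw [(d.isOpen_A t).frontier_eq, (d.isOpen_O t).frontier_eq]
  rintro x ⟨hx, hxA⟩
  by_cases hxK : x ∈ K
  · exact Or.inr hxK
  · refine Or.inl ⟨closure_mono (d.A_subset_O t) hx, fun h => hxA ?_⟩
    rw [d.A_eq]
    exact ⟨h, hxK⟩

theorem closure_O_eq (d : DarningData 𝒱 H K W₀)
    {t : ℝ} (ht : 0 < t) : closure (O t) = closure (A t) ∪ K := by
  rw [d.O_eq ht, closure_union, d.isClosed_K.closure_eq]

theorem S_subset_A (_d : DarningData 𝒱 H K W₀) {s t : ℝ} (hst : s < t) : S s ⊆ A t := fun x hx =>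
  ⟨hx.1, by rw [hx.2]; exact hst⟩

theorem closure_O_subset_O (d : DarningData 𝒱 H K W₀)
    {s t : ℝ} (hst : s < t) (ht : t < 1) : closure (O s) ⊆ O t := by
  intro x hx
  obtain ⟨h1, h2⟩ := d.closure_O_subset (hst.trans ht) hx
  exact ⟨h1, h2.trans_lt hst⟩

/-- The function `t - g` is a barrier at outer boundary points, and `g` is a barrier at boundary
points in `K`. -/
theorem regular_A (d : DarningData 𝒱 H K W₀)
    {t : ℝ} (ht0 : 0 < t) (ht : t < 1) : IsRegular 𝒱 H (A t) := by
  have hsub : A t ⊆ W₀ := (d.A_subset t).trans sdiff_subset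
  have hcl : closure (A t) ⊆ closure W₀ := closure_mono hsub
  have hharm : IsHarmonic 𝒱 H (A t) g := d.isHarmonic_g.mono (d.A_subset t)
  have htend : ∀ z ∈ frontier (A t), Tendsto g (𝓝[A t] z) (𝓝 (g z)) := fun z hz =>
    ((d.continuousOn_g z (hcl (frontier_subset_closure hz))).mono (hsub.trans subset_closure)).tendsto
  refine isRegular_of_isBarrier d.family d.isPSet (d.isOpen_A t)
    (d.regular.2.1.of_isClosed_subset isClosed_closure hcl) hsub fun z hz => ?_
  have hz' := htend z hz
  rcases d.frontier_A_subset hz with hzO | hzK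
  · have hzS := d.frontier_O_subset ht0 ht hzO
    rw [hzS.2] at hz'
    refine ⟨fun x => t + (-1) * g x, ?_, fun x hx => ?_, ?_, ?_⟩
    · exact (BddMeas.const t).add ((BddMeas.const (-1)).mul d.g_bddMeas)
    · have := hx.2
      linarith
    · exact (IsHarmonic.const d.family _ t).add d.family (hharm.const_mul (-1))
    · have := (tendsto_const_nhds (x := t)).add (hz'.const_mul (-1))
      simpa using this
  · rw [d.g_eq_zero hzK] at hz'
    exact ⟨g, d.g_bddMeas, fun x hx => d.pos x (d.A_subset t hx), hharm, hz'⟩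

end DarningData

end Geometry

/-! ### The darned kernels as kernels on `X`. -/

section Darned

variable {X : Type*} [TopologicalSpace X] [T2Space X] [LocallyCompactSpace X]
  [SecondCountableTopology X] [MeasurableSpace X] [BorelSpace X]

/-- The harmonic kernel of `A_t`. -/
noncomputable abbrev AKernel (𝒱 : Set (Set X)) (H : Set X → Kernel X X) (K W₀ : Set X) (t : ℝ) :
    Kernel X X :=
  harmonicKernel 𝒱 H (ASet 𝒱 H K W₀ t)

open Classical in
/-- The measures of the darned kernel for `U_t`, as measures on `X`. -/
noncomputable def darnMeasure (𝒱 : Set (Set X)) (H : Set X → Kernel X X) (K W₀ : Set X)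
    (σ : ℝ → Measure X) (t : ℝ) (x : X) : Measure X :=
  if x ∈ OSet 𝒱 H K W₀ t then
    (harmonicKernel 𝒱 H (ASet 𝒱 H K W₀ t) x).restrict (SSet 𝒱 H K W₀ t) +
      ENNReal.ofReal (1 - gFun 𝒱 H K W₀ x / t) • σ t
  else Measure.dirac x

/-- `σ r` is a probability measure on `S_r` for `0 < r < 1`. -/
def IsSphereFamily (𝒱 : Set (Set X)) (H : Set X → Kernel X X) (K W₀ : Set X)
    (σ : ℝ → Measure X) : Prop :=
  ∀ r ∈ Ioo (0 : ℝ) 1, IsProbabilityMeasure (σ r) ∧ σ r (SSet 𝒱 H K W₀ r)ᶜ = 0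

variable {𝒱 : Set (Set X)} {H : Set X → Kernel X X} {K W₀ : Set X} {σ : ℝ → Measure X}

local notation "g" => gFun 𝒱 H K W₀
local notation "A" => ASet 𝒱 H K W₀
local notation "S" => SSet 𝒱 H K W₀
local notation "O" => OSet 𝒱 H K W₀
local notation "T" => AKernel 𝒱 H K W₀
local notation "Q" => darnMeasure 𝒱 H K W₀ σ

theorem IsSphereFamily.ae_mem (hσ : IsSphereFamily 𝒱 H K W₀ σ) {t : ℝ} (ht : t ∈ Ioo (0 : ℝ) 1) :
    ∀ᵐ y ∂(σ t), y ∈ S t := mem_ae_iff.2 (hσ t ht).2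

theorem darnMeasure_of_mem {t : ℝ} {x : X} (hx : x ∈ O t) :
    Q t x = (T t x).restrict (S t) + ENNReal.ofReal (1 - g x / t) • σ t := if_pos hx

theorem darnMeasure_of_notMem {t : ℝ} {x : X} (hx : x ∉ O t) : Q t x = Measure.dirac x := if_neg hx

namespace DarningData

theorem isDirichletKernel (d : DarningData 𝒱 H K W₀) {t : ℝ} (ht : t ∈ Ioo (0 : ℝ) 1) :
    IsDirichletKernel 𝒱 H (A t) (T t) :=
  (d.regular_A ht.1 ht.2).isDirichletKernel d.family

theorem isMarkovKernel (d : DarningData 𝒱 H K W₀) {t : ℝ} (ht : t ∈ Ioo (0 : ℝ) 1) :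
    IsMarkovKernel (T t) :=
  (d.isDirichletKernel ht).isMarkovKernel d.family (d.regular_A ht.1 ht.2)

theorem ae_mem (d : DarningData 𝒱 H K W₀) {t : ℝ} (ht : t ∈ Ioo (0 : ℝ) 1) {x : X}
    (hx : x ∈ A t) : ∀ᵐ y ∂(T t x), y ∈ frontier (A t) ∧ (y ∈ frontier (O t) ∨ y ∈ K) := by
  filter_upwards [(d.isDirichletKernel ht).1.ae_mem_frontier hx] with y hy
  exact ⟨hy, d.frontier_A_subset hy⟩

/-- A harmonic function on `A_t` with constant boundary values on `K`. -/
theorem eq_integral_add (d : DarningData 𝒱 H K W₀) {t : ℝ} (ht : t ∈ Ioo (0 : ℝ) 1) {k : X → ℝ}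
    (hc : ContinuousOn k (closure (A t))) (hk : IsHarmonic 𝒱 H (A t) k) {c : ℝ}
    (hkK : ∀ x ∈ closure (A t) ∩ K, k x = c) {x : X} (hx : x ∈ A t) :
    k x = ∫ y in S t, k y ∂(T t x) + (1 - g x / t) * c := by
  have hA := d.regular_A ht.1 ht.2
  have hD := d.isDirichletKernel ht
  have := d.isMarkovKernel ht
  have hxc := subset_closure hx
  -- The harmonic measure lives on `S_t ∪ K`. Taking `k = 1` and `k = g` gives two equations for the
  -- masses of `S_t` and `K`, whence the mass of `K` is `1 - g x / t`.
  have main : ∀ (k : X → ℝ) (c : ℝ), ContinuousOn k (closure (A t)) → IsHarmonic 𝒱 H (A t) k →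
      (∀ x ∈ closure (A t) ∩ K, k x = c) →
      k x = ∫ y in S t, k y ∂(T t x) + (T t x).real K * c := by
    intro k c hc hk hkK
    have hbm := BddMeas.of_continuousOn hA.2.1 hc
    have hki : Integrable k (T t x) := by
      refine (hbm.integrable _).congr ?_
      filter_upwards [d.ae_mem ht hx] with y hy
      exact indicator_of_mem (frontier_subset_closure hy.1) k
    have h2 : ∀ᵐ y ∂(T t x), k y = (S t).indicator k y + K.indicator (fun _ => c) y := by
      filter_upwards [d.ae_mem ht hx] with y ⟨hy1, hy2⟩
      rcases hy2 with hy2 | hy2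
      · have hyS := d.frontier_O_subset ht.1 ht.2 hy2
        rw [indicator_of_mem hyS, indicator_of_notMem hyS.1.2, add_zero]
      · rw [indicator_of_notMem (fun h : y ∈ S t => h.1.2 hy2), indicator_of_mem hy2, zero_add]
        exact hkK y ⟨frontier_subset_closure hy1, hy2⟩
    calc k x = ∫ y, k y ∂(T t x) := (hD.integral_self hA hc hk hxc).symm
      _ = ∫ y, ((S t).indicator k y + K.indicator (fun _ => c) y) ∂(T t x) := integral_congr_ae h2
      _ = ∫ y in S t, k y ∂(T t x) + (T t x).real K * c := by
        rw [integral_add (hki.indicator (d.measurableSet_S t))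
          ((integrable_const c).indicator d.isClosed_K.measurableSet),
          integral_indicator (d.measurableSet_S t), integral_indicator d.isClosed_K.measurableSet]
        simp
  have hone := main (fun _ => 1) 1 continuousOn_const (IsHarmonic.const d.family _ 1)
    (fun _ _ => rfl)
  have hg := main g 0 (d.continuousOn_g.mono (closure_mono ((d.A_subset t).trans sdiff_subset)))
    (d.isHarmonic_g.mono (d.A_subset t)) (fun x hx => d.g_eq_zero hx.2)
  have hgt : ∫ y in S t, g y ∂(T t x) = (T t x).real (S t) * t := by
    rw [setIntegral_congr_fun (d.measurableSet_S t) (fun y hy => hy.2 : EqOn g (fun _ => t) (S t))]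
    simp
  rw [hgt] at hg
  simp only [integral_const, MeasurableSet.univ, measureReal_restrict_apply, univ_inter,
    smul_eq_mul, mul_one] at hone
  have hK : (T t x).real K = 1 - g x / t := by
    have ht0 := ht.1.ne'
    field_simp
    linear_combination (-t) * hone + hg
  rw [main k c hc hk hkK, hK]

theorem measure_S (d : DarningData 𝒱 H K W₀) {t : ℝ} (ht : t ∈ Ioo (0 : ℝ) 1) {x : X}
    (hx : x ∈ O t) : T t x (S t) = ENNReal.ofReal (g x / t) := by
  have := d.isMarkovKernel ht
  by_cases hxK : x ∈ K
  · rw [(d.isDirichletKernel ht).1.2 x (fun h => (d.A_subset t h).2 hxK), d.g_eq_zero hxK,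
      Measure.dirac_apply' _ (d.measurableSet_S t), indicator_of_notMem (fun h => h.1.2 hxK)]
    simp
  · have hxA : x ∈ A t := by rw [d.A_eq]; exact ⟨hx, hxK⟩
    have h := d.eq_integral_add ht (k := fun _ => 1) (c := 1) continuousOn_const
      (IsHarmonic.const d.family _ 1) (fun _ _ => rfl) hxA
    simp only [integral_const, MeasurableSet.univ, measureReal_restrict_apply, univ_inter,
      smul_eq_mul, mul_one] at h
    rw [← ENNReal.ofReal_toReal (measure_ne_top (T t x) (S t))]
    congr 1
    simp only [Measure.real] at h
    linarith

theorem one_sub_nonneg (_d : DarningData 𝒱 H K W₀) {t : ℝ} (ht : t ∈ Ioo (0 : ℝ) 1) {x : X}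
    (hx : x ∈ O t) : 0 ≤ 1 - g x / t := by
  rw [sub_nonneg, div_le_one ht.1]
  exact hx.2.le

theorem isProbabilityMeasure_darnMeasure (d : DarningData 𝒱 H K W₀)
    (hσ : IsSphereFamily 𝒱 H K W₀ σ) {t : ℝ} (ht : t ∈ Ioo (0 : ℝ) 1) (x : X) :
    IsProbabilityMeasure (Q t x) := by
  by_cases hx : x ∈ O t
  · have := (hσ t ht).1
    refine ⟨?_⟩
    rw [darnMeasure_of_mem hx, Measure.add_apply, Measure.restrict_apply_univ, d.measure_S ht hx,
      Measure.smul_apply, measure_univ, smul_eq_mul, mul_one,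
      ← ENNReal.ofReal_add (div_nonneg (d.g_nonneg x) ht.1.le) (d.one_sub_nonneg ht hx)]
    simp
  · rw [darnMeasure_of_notMem hx]
    infer_instance

theorem measurable_darnMeasure (d : DarningData 𝒱 H K W₀) (t : ℝ) :
    Measurable (Q t) := by
  classical
  refine Measurable.ite (d.isOpen_O t).measurableSet ?_ Measure.measurable_dirac
  refine Measure.measurable_of_measurable_coe _ fun s hs => ?_
  simp only [Measure.add_apply, Measure.smul_apply, smul_eq_mul, Measure.restrict_apply hs]
  refine ((T t).measurable_coe (hs.inter (d.measurableSet_S t))).add (Measurable.mul_const ?_ _)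
  exact (measurable_const.sub (d.g_bddMeas.meas.div_const t)).ennreal_ofReal

/-- The darned kernel for `U_t`, as a kernel on `X`. -/
noncomputable def darnKernel (d : DarningData 𝒱 H K W₀) (σ : ℝ → Measure X) (t : ℝ) : Kernel X X :=
  ⟨darnMeasure 𝒱 H K W₀ σ t, d.measurable_darnMeasure t⟩

theorem darnKernel_apply (d : DarningData 𝒱 H K W₀) (t : ℝ) (x : X) :
    d.darnKernel σ t x = Q t x := rfl

theorem isMarkovKernel_darnKernel (d : DarningData 𝒱 H K W₀)
    (hσ : IsSphereFamily 𝒱 H K W₀ σ) {t : ℝ} (ht : t ∈ Ioo (0 : ℝ) 1) :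
    IsMarkovKernel (d.darnKernel σ t) :=
  ⟨fun x => d.isProbabilityMeasure_darnMeasure hσ ht x⟩

theorem restrict_eq_zero (d : DarningData 𝒱 H K W₀) {t : ℝ} (ht : t ∈ Ioo (0 : ℝ) 1) {x : X}
    (hx : x ∈ K) : (T t x).restrict (S t) = 0 := by
  rw [Measure.restrict_eq_zero, d.measure_S ht (d.K_subset_O ht.1 hx), d.g_eq_zero hx]
  simp

/-- The measure does not depend on the point of `K`, which is why the kernel descends to `X₀`. -/
theorem darnMeasure_of_mem_K (d : DarningData 𝒱 H K W₀) {t : ℝ} (ht : t ∈ Ioo (0 : ℝ) 1) {x : X}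
    (hx : x ∈ K) : Q t x = σ t := by
  rw [darnMeasure_of_mem (d.K_subset_O ht.1 hx), d.restrict_eq_zero ht hx, d.g_eq_zero hx]
  simp

theorem integral_darnMeasure (d : DarningData 𝒱 H K W₀) (hσ : IsSphereFamily 𝒱 H K W₀ σ)
    {t : ℝ} (ht : t ∈ Ioo (0 : ℝ) 1) {f : X → ℝ} (hf : BddMeas f) {x : X}
    (hx : x ∈ O t) :
    ∫ y, f y ∂(Q t x) = ∫ y in S t, f y ∂(T t x) + (1 - g x / t) * ∫ y, f y ∂(σ t) := by
  have := (hσ t ht).1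
  have := d.isMarkovKernel ht
  rw [darnMeasure_of_mem hx, integral_add_measure (hf.integrable _)
    ((hf.integrable _).smul_measure ENNReal.ofReal_ne_top), integral_smul_measure,
    ENNReal.toReal_ofReal (d.one_sub_nonneg ht hx), smul_eq_mul]

/-- One formula covers the frontier too: there `g = t` removes the second term and the kernel of
`A_t` is Dirac. Continuity up to the boundary can then be read off. -/
theorem integral_darnMeasure_closure (d : DarningData 𝒱 H K W₀) (hσ : IsSphereFamily 𝒱 H K W₀ σ)
    {t : ℝ} (ht : t ∈ Ioo (0 : ℝ) 1) {f : X → ℝ} (hf : BddMeas f) {x : X}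
    (hx : x ∈ closure (O t)) :
    ∫ y, f y ∂(Q t x) =
      ∫ y, (S t).indicator f y ∂(T t x) + (1 - g x / t) * ∫ y, f y ∂(σ t) := by
  by_cases hxO : x ∈ O t
  · rw [d.integral_darnMeasure hσ ht hf hxO, integral_indicator (d.measurableSet_S t)]
  · have hxS : x ∈ S t := d.frontier_O_subset ht.1 ht.2
      (by rw [(d.isOpen_O t).frontier_eq]; exact ⟨hx, hxO⟩)
    rw [darnMeasure_of_notMem hxO, (d.isDirichletKernel ht).1.2 x (fun h => hxO (d.A_subset_O t h)),
      integral_dirac, integral_dirac, indicator_of_mem hxS, hxS.2, div_self ht.1.ne']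
    simp

/-- The first term is the Dirichlet solution on `closure (A_t)` with data `f` on the outer boundary
and `0` on `K`. It vanishes on `K`, so the pieces glue along the closed cover of `closure (O_t)`. -/
theorem continuousOn_integral_darnMeasure (d : DarningData 𝒱 H K W₀)
    (hσ : IsSphereFamily 𝒱 H K W₀ σ) {t : ℝ} (ht : t ∈ Ioo (0 : ℝ) 1) {f : X → ℝ} (hf : BddMeas f)
    (hfc : ContinuousOn f (frontier (O t))) :
    ContinuousOn (fun x => ∫ y, f y ∂(Q t x)) (closure (O t)) := by
  refine ContinuousOn.congr ?_ (fun x hx => d.integral_darnMeasure_closure hσ ht hf hx)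
  have hg : ContinuousOn (fun x => (1 - g x / t) * ∫ y, f y ∂(σ t)) (closure (O t)) := by
    have := d.continuousOn_g.mono (closure_mono fun x (hx : x ∈ O t) => hx.1)
    exact (continuousOn_const.sub (this.div_const t)).mul continuousOn_const
  refine ContinuousOn.add ?_ hg
  rw [d.closure_O_eq ht.1]
  refine ContinuousOn.union_of_isClosed ?_ ?_ isClosed_closure d.isClosed_K
  · refine ((d.isDirichletKernel ht).2 _ ?_).1
    exact (continuousOn_indicator_of_isClosed isClosed_frontier d.isClosed_K
      (d.frontier_O_subset ht.1 ht.2) (d.disjoint_K_S t) hfc).mono d.frontier_A_subset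
  · refine (continuousOn_const (c := (0 : ℝ))).congr fun x hx => ?_
    rw [integral_indicator (d.measurableSet_S t), d.restrict_eq_zero ht hx, integral_zero_measure]

theorem isHarmonic_integral_darnMeasure (d : DarningData 𝒱 H K W₀)
    (hσ : IsSphereFamily 𝒱 H K W₀ σ) {t : ℝ} (ht : t ∈ Ioo (0 : ℝ) 1) {f : X → ℝ}
    (hf : BddMeas f) : IsHarmonic 𝒱 H (A t) (fun x => ∫ y, f y ∂(Q t x)) := by
  have h1 := (d.isDirichletKernel ht).isHarmonic_integral d.family (d.regular_A ht.1 ht.2)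
    (hf.indicator (d.measurableSet_S t))
  have h2 := ((IsHarmonic.const d.family (A t) 1).add d.family
    ((d.isHarmonic_g.mono (d.A_subset t)).const_mul (-t⁻¹))).const_mul (∫ y, f y ∂(σ t))
  refine (h1.add d.family h2).congr d.family fun x hx => ?_
  simp only
  rw [d.integral_darnMeasure_closure hσ ht hf (subset_closure (d.A_subset_O t hx))]
  ring

/-- The darned kernel of `U_t` is reproduced by the kernels of the sets `V ⊆ A_t`. -/
theorem comp_darnKernel (d : DarningData 𝒱 H K W₀) (hσ : IsSphereFamily 𝒱 H K W₀ σ) {t : ℝ}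
    (ht : t ∈ Ioo (0 : ℝ) 1) {V : Set X} (hV : V ∈ 𝒱) (hVA : V ⊆ A t) :
    d.darnKernel σ t ∘ₖ H V = d.darnKernel σ t := by
  have := d.isMarkovKernel_darnKernel hσ ht
  have := d.family.isMarkovKernel hV
  ext1 x
  refine ext_of_forall_integral_eq_of_IsFiniteMeasure fun φ => ?_
  have hφ : BddMeas φ := ⟨φ.continuous.measurable, ‖φ‖, fun x => φ.norm_coe_le_norm x⟩
  rw [Kernel.integral_comp (φ.integrable _)]
  refine d.family.integral_eq_of_locHarmAt hV (h := fun x => ∫ y, φ y ∂(d.darnKernel σ t x)) ?_ ?_ x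
  · exact (d.continuousOn_integral_darnMeasure hσ ht hφ φ.continuous.continuousOn).mono
      (closure_mono (hVA.trans (d.A_subset_O t)))
  · exact fun y hy => (d.isHarmonic_integral_darnMeasure hσ ht hφ).locHarmAt (d.isOpen_A t) (hVA hy)

theorem integral_compatible (d : DarningData 𝒱 H K W₀) (hσ : IsSphereFamily 𝒱 H K W₀ σ)
    (hc : IsCompatible 𝒱 H K W₀ σ) {r t : ℝ} (hr : 0 < r) (hrt : r < t) (ht : t < 1) {f : X → ℝ}
    (hf : BddMeas f) :
    ∫ y, ∫ z in S t, f z ∂(T t y) ∂(σ r) = r / t * ∫ y, f y ∂(σ t) := by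
  have htI : t ∈ Ioo (0 : ℝ) 1 := ⟨hr.trans hrt, ht⟩
  have := (hσ r ⟨hr, hrt.trans ht⟩).1
  have := (hσ t htI).1
  have := d.isMarkovKernel htI
  have hmeas : (σ r).bind (T t) = (T t ∘ₖ Kernel.const Unit (σ r)) () := by
    rw [Kernel.comp_apply, Kernel.const_apply]
  have h1 : ∫ y, ∫ z in S t, f z ∂(T t y) ∂(σ r) =
      ∫ z in S t, f z ∂((σ r).bind (T t)) := by
    rw [hmeas, ← integral_indicator (d.measurableSet_S t), Kernel.integral_comp
      ((hf.indicator (d.measurableSet_S t)).integrable _), Kernel.const_apply]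
    simp_rw [integral_indicator (d.measurableSet_S t)]
  rw [h1, hc r t hr hrt ht, integral_smul_measure, Measure.restrict_eq_self_of_ae_mem (hσ.ae_mem htI),
    ENNReal.toReal_ofReal (div_nonneg hr.le htI.1.le), smul_eq_mul]

/-- By compatibility with `r = t/2`, the measure `σ_t / 2` is the restriction to `S_t` of a mixture
of harmonic measures of `A_t` at points of `S_{t/2}`, and these charge only `frontier (O_t)` within
`S_t`. -/
theorem ae_mem_frontier_O (d : DarningData 𝒱 H K W₀) (hσ : IsSphereFamily 𝒱 H K W₀ σ)
    (hc : IsCompatible 𝒱 H K W₀ σ) {t : ℝ} (ht : t ∈ Ioo (0 : ℝ) 1) :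
    ∀ᵐ y ∂(σ t), y ∈ frontier (O t) := by
  have hr : t / 2 ∈ Ioo (0 : ℝ) 1 := ⟨by linarith [ht.1], by linarith [ht.1, ht.2]⟩
  have := (hσ _ hr).1
  have := (hσ t ht).1
  have hb := d.integral_compatible hσ hc hr.1 (by linarith [ht.1]) ht.2
    ((BddMeas.const (X := X) 1).indicator (isClosed_frontier (s := O t)).measurableSet.compl)
  have h0 : ∫ y, ∫ z in S t, (frontier (O t))ᶜ.indicator (fun _ => (1 : ℝ)) z ∂(T t y) ∂(σ (t / 2))
      = 0 := by
    refine integral_eq_zero_of_ae ?_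
    filter_upwards [hσ.ae_mem hr] with y hy
    have hyA : y ∈ A t := d.S_subset_A (by linarith [ht.1]) hy
    refine integral_eq_zero_of_ae ?_
    filter_upwards [ae_restrict_of_ae (d.ae_mem ht hyA), ae_restrict_mem (d.measurableSet_S t)]
      with z hz hzS
    rcases hz.2 with h | h
    · exact indicator_of_notMem (not_not.2 h) _
    · exact absurd h hzS.1.2
  rw [h0] at hb
  have hpos : t / 2 / t ≠ 0 := by
    have := ht.1
    positivity
  have h2 := (mul_eq_zero.1 hb.symm).resolve_left hpos
  rw [integral_indicator isClosed_frontier.measurableSet.compl] at h2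
  simp only [integral_const, MeasurableSet.univ, measureReal_restrict_apply, univ_inter,
    smul_eq_mul, mul_one] at h2
  exact mem_ae_iff.2 ((measureReal_eq_zero_iff).1 h2)

theorem isBoundaryKernel_darnKernel (d : DarningData 𝒱 H K W₀) (hσ : IsSphereFamily 𝒱 H K W₀ σ)
    (hc : IsCompatible 𝒱 H K W₀ σ) {t : ℝ} (ht : t ∈ Ioo (0 : ℝ) 1) :
    IsBoundaryKernel (O t) (d.darnKernel σ t) := by
  refine ⟨fun x hx => ?_, fun x hx => darnMeasure_of_notMem hx⟩
  have h1 : ∀ᵐ y ∂((T t x).restrict (S t)), y ∈ frontier (O t) := by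
    by_cases hxK : x ∈ K
    · rw [d.restrict_eq_zero ht hxK]
      simp
    · have hxA : x ∈ A t := by rw [d.A_eq]; exact ⟨hx, hxK⟩
      filter_upwards [ae_restrict_of_ae (d.ae_mem ht hxA), ae_restrict_mem (d.measurableSet_S t)]
        with z hz hzS
      exact hz.2.resolve_right hzS.1.2
  have h2 : σ t (frontier (O t))ᶜ = 0 := mem_ae_iff.1 (d.ae_mem_frontier_O hσ hc ht)
  have h3 : (T t x).restrict (S t) (frontier (O t))ᶜ = 0 := mem_ae_iff.1 h1
  rw [d.darnKernel_apply, darnMeasure_of_mem hx, Measure.add_apply, Measure.smul_apply, h2, h3]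
  simp

/-- This is (H₁) at the point `x₀`: the two terms contribute the fractions `r/t`, by compatibility,
and `1 - r/t`, since `g = r` on `S_r`. -/
theorem integral_sigma_darnMeasure (d : DarningData 𝒱 H K W₀) (hσ : IsSphereFamily 𝒱 H K W₀ σ)
    (hc : IsCompatible 𝒱 H K W₀ σ) {r t : ℝ} (hr : 0 < r) (hrt : r < t) (ht : t < 1) {f : X → ℝ}
    (hf : BddMeas f) : ∫ y, ∫ z, f z ∂(Q t y) ∂(σ r) = ∫ y, f y ∂(σ t) := by
  have htI : t ∈ Ioo (0 : ℝ) 1 := ⟨hr.trans hrt, ht⟩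
  have hrI : r ∈ Ioo (0 : ℝ) 1 := ⟨hr, hrt.trans ht⟩
  have := (hσ r hrI).1
  have := d.isMarkovKernel htI
  have h1 : ∫ y, ∫ z, f z ∂(Q t y) ∂(σ r) =
      ∫ y, (∫ z, (S t).indicator f z ∂(T t y) + (1 - r / t) * ∫ z, f z ∂(σ t)) ∂(σ r) := by
    refine integral_congr_ae ?_
    filter_upwards [hσ.ae_mem hrI] with y hy
    rw [d.integral_darnMeasure_closure hσ htI hf
      (subset_closure (d.A_subset_O t (d.S_subset_A hrt hy))), hy.2]
  rw [h1, integral_add (((hf.indicator (d.measurableSet_S t)).integral_kernel (T t)).integrable _)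
    (integrable_const _)]
  simp_rw [integral_indicator (d.measurableSet_S t)]
  rw [d.integral_compatible hσ hc hr hrt ht hf]
  simp
  ring

/-- The darned kernels of the sets `U_s ⊆ U_t` are compatible. -/
theorem darnKernel_comp_darnKernel (d : DarningData 𝒱 H K W₀) (hσ : IsSphereFamily 𝒱 H K W₀ σ)
    (hc : IsCompatible 𝒱 H K W₀ σ) {s t : ℝ} (hs : 0 < s) (hst : s < t) (ht : t < 1) :
    d.darnKernel σ t ∘ₖ d.darnKernel σ s = d.darnKernel σ t := by
  have htI : t ∈ Ioo (0 : ℝ) 1 := ⟨hs.trans hst, ht⟩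
  have hsI : s ∈ Ioo (0 : ℝ) 1 := ⟨hs, hst.trans ht⟩
  have := d.isMarkovKernel_darnKernel hσ htI
  have := d.isMarkovKernel_darnKernel hσ hsI
  ext1 x
  refine ext_of_forall_integral_eq_of_IsFiniteMeasure fun φ => ?_
  have hφ : BddMeas φ := ⟨φ.continuous.measurable, ‖φ‖, fun x => φ.norm_coe_le_norm x⟩
  rw [Kernel.integral_comp (φ.integrable _)]
  have hk : BddMeas fun x => ∫ y, φ y ∂(d.darnKernel σ t x) := hφ.integral_kernel _
  simp only [d.darnKernel_apply] at hk ⊢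
  have hKt : ∀ y ∈ K, ∫ z, φ z ∂(Q t y) = ∫ z, φ z ∂(σ t) := fun y hy => by
    rw [d.darnMeasure_of_mem_K htI hy]
  by_cases hx : x ∈ O s
  · rw [d.integral_darnMeasure hσ hsI hk hx, d.integral_sigma_darnMeasure hσ hc hs hst ht hφ]
    by_cases hxK : x ∈ K
    · rw [d.restrict_eq_zero hsI hxK, d.g_eq_zero hxK, hKt x hxK]
      simp
    · have hxA : x ∈ A s := by rw [d.A_eq]; exact ⟨hx, hxK⟩
      -- The function `Q_t φ` is harmonic on `A_s` with the constant value `∫ φ dσ_t` on `K`. Its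
      -- representation on `A_s` is the integral against `Q_s`.
      refine (d.eq_integral_add hsI (k := fun x => ∫ y, φ y ∂(Q t x)) ?_ ?_
        (fun y hy => hKt y hy.2) hxA).symm
      · refine (d.continuousOn_integral_darnMeasure hσ htI hφ φ.continuous.continuousOn).mono ?_
        exact (closure_mono (d.A_subset_O s)).trans
          ((d.closure_O_subset_O hst ht).trans subset_closure)
      · exact (d.isHarmonic_integral_darnMeasure hσ htI hφ).mono fun y hy => ⟨hy.1, hy.2.trans hst⟩
  · rw [darnMeasure_of_notMem hx, integral_dirac]

/-- Only points of `K` need an argument. There `Q_t f = Q_{t/2} (Q_t f)`, and `Q_t f` is continuous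
on `S_{t/2} ⊆ A_t`, so the result for continuous boundary data applies. -/
theorem continuousOn_integral_darnMeasure_of_bddMeas (d : DarningData 𝒱 H K W₀)
    (hσ : IsSphereFamily 𝒱 H K W₀ σ) (hc : IsCompatible 𝒱 H K W₀ σ) {t : ℝ}
    (ht : t ∈ Ioo (0 : ℝ) 1) {f : X → ℝ} (hf : BddMeas f) :
    ContinuousOn (fun x => ∫ y, f y ∂(Q t x)) (O t) := by
  have hh := (d.isHarmonic_integral_darnMeasure hσ ht hf).1
  intro x hx
  by_cases hxK : x ∈ K
  · have hst : t / 2 < t := by linarith [ht.1]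
    have hsI : t / 2 ∈ Ioo (0 : ℝ) 1 := ⟨by linarith [ht.1], hst.trans ht.2⟩
    have := d.isMarkovKernel_darnKernel hσ ht
    have := d.isMarkovKernel_darnKernel hσ hsI
    have hxO := d.K_subset_O hsI.1 hxK
    have hk : BddMeas fun x => ∫ y, f y ∂(d.darnKernel σ t x) := hf.integral_kernel _
    have h1 := d.continuousOn_integral_darnMeasure hσ hsI hk
      (hh.mono ((d.frontier_O_subset hsI.1 hsI.2).trans (d.S_subset_A hst)))
    refine ((h1.mono subset_closure).continuousAt
      ((d.isOpen_O _).mem_nhds hxO)).congr ?_ |>.continuousWithinAt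
    refine Eventually.of_forall fun y => ?_
    have := Kernel.integral_comp (κ := d.darnKernel σ (t / 2)) (η := d.darnKernel σ t) (a := y)
      (hf.integrable _)
    rw [d.darnKernel_comp_darnKernel hσ hc hsI.1 hst ht.2] at this
    exact this.symm
  · have hxA : x ∈ A t := by rw [d.A_eq]; exact ⟨hx, hxK⟩
    exact (hh.continuousAt ((d.isOpen_A t).mem_nhds hxA)).continuousWithinAt

/-- The darned kernels preserve continuity. -/
theorem continuous_integral_darnMeasure (d : DarningData 𝒱 H K W₀)
    (hσ : IsSphereFamily 𝒱 H K W₀ σ) (hc : IsCompatible 𝒱 H K W₀ σ) {t : ℝ}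
    (ht : t ∈ Ioo (0 : ℝ) 1) {f : X → ℝ} (hf : Continuous f) :
    Continuous fun x => ∫ y, f y ∂(Q t x) := by
  -- The function `f` may be unbounded; in `O_t` only its values on the compact closure matter.
  let f' := (closure (O t)).indicator f
  have hf' : BddMeas f' := BddMeas.of_continuousOn (d.isCompact_closure_O t) hf.continuousOn
  have heq : EqOn f' f (closure (O t)) := fun y hy => indicator_of_mem hy f
  have h1 := d.continuousOn_integral_darnMeasure hσ ht hf'
    (hf.continuousOn.congr (heq.mono frontier_subset_closure))
  have h2 : ContinuousOn (fun x => ∫ y, f y ∂(Q t x)) (closure (O t)) := by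
    refine h1.congr fun x hx => ?_
    by_cases hxO : x ∈ O t
    · refine integral_congr_ae ?_
      filter_upwards [(d.isBoundaryKernel_darnKernel hσ hc ht).ae_mem_frontier hxO] with y hy
      exact (heq (frontier_subset_closure hy)).symm
    · simp only [darnMeasure_of_notMem hxO, integral_dirac]
      exact (heq hx).symm
  have h3 : ContinuousOn (fun x => ∫ y, f y ∂(Q t x)) (O t)ᶜ :=
    hf.continuousOn.congr fun x hx => by simp only [darnMeasure_of_notMem hx, integral_dirac]
  rw [← continuousOn_univ]
  refine (h2.union_of_isClosed h3 isClosed_closure (d.isOpen_O t).isClosed_compl).mono fun x _ => ?_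
  by_cases hx : x ∈ O t
  · exact Or.inl (subset_closure hx)
  · exact Or.inr hx

end DarningData

end Darned

/-! ### Topology and Borel structure of `X₀`. -/

section CollapseSpace

variable {X : Type*} {K : Set X}

theorem proj_of_mem {x : X} (hx : x ∈ K) : proj K x = point K := dif_pos hx

theorem proj_of_notMem {x : X} (hx : x ∉ K) : proj K x = (some ⟨x, hx⟩ : Option ↥(Kᶜ)) := dif_neg hx

theorem proj_eq_point_iff {x : X} : proj K x = point K ↔ x ∈ K := by
  refine ⟨fun h => ?_, proj_of_mem⟩
  by_contra hx
  rw [proj_of_notMem hx] at h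
  exact Option.some_ne_none _ h

theorem eq_of_proj_eq {x y : X} (hx : x ∉ K) (h : proj K x = proj K y) : x = y := by
  have hy : y ∉ K := fun hy => hx (proj_eq_point_iff.1 (h.trans (proj_of_mem hy)))
  rw [proj_of_notMem hx, proj_of_notMem hy] at h
  exact congrArg Subtype.val (Option.some_injective _ h)

theorem proj_eq_proj_iff {x y : X} : proj K x = proj K y ↔ x = y ∨ x ∈ K ∧ y ∈ K := by
  refine ⟨fun h => ?_, ?_⟩
  · by_cases hx : x ∈ K
    · exact Or.inr ⟨hx, proj_eq_point_iff.1 (h.symm.trans (proj_of_mem hx))⟩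
    · exact Or.inl (eq_of_proj_eq hx h)
  · rintro (rfl | ⟨hx, hy⟩)
    · rfl
    · rw [proj_of_mem hx, proj_of_mem hy]

theorem surjective_proj (hK : K.Nonempty) : Function.Surjective (proj K) := by
  intro p
  rcases p with _ | ⟨x, hx⟩
  · obtain ⟨x, hx⟩ := hK
    exact ⟨x, proj_of_mem hx⟩
  · exact ⟨x, proj_of_notMem hx⟩

/-- Sets that either contain `K` or do not meet it. -/
def IsSaturated (K s : Set X) : Prop := Disjoint s K ∨ K ⊆ s

theorem IsSaturated.preimage_image {s : Set X} (hs : IsSaturated K s) :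
    proj K ⁻¹' (proj K '' s) = s := by
  refine Subset.antisymm ?_ (subset_preimage_image _ _)
  rintro x ⟨y, hy, hxy⟩
  rcases proj_eq_proj_iff.1 hxy with rfl | ⟨hyK, hxK⟩
  · exact hy
  · rcases hs with hs | hs
    · exact absurd rfl (hs.ne_of_mem hy hyK)
    · exact hs hxK

/-- A section of the canonical map. -/
noncomputable def sec (hK : K.Nonempty) : Collapse K → X :=
  fun p => Option.elim (show Option ↥(Kᶜ) from p) hK.some Subtype.val

theorem sec_point (hK : K.Nonempty) : sec hK (point K) ∈ K := hK.some_mem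

theorem sec_proj (hK : K.Nonempty) {x : X} (hx : x ∉ K) : sec hK (proj K x) = x := by
  rw [proj_of_notMem hx]
  rfl

theorem proj_sec (hK : K.Nonempty) (p : Collapse K) : proj K (sec hK p) = p := by
  obtain ⟨x, rfl⟩ := surjective_proj hK p
  by_cases hx : x ∈ K
  · rw [proj_of_mem hx, proj_of_mem (sec_point hK)]
  · rw [sec_proj hK hx]

theorem comp_sec_proj {β : Type*} (hK : K.Nonempty) {v : X → β} {c : β} (hv : ∀ x ∈ K, v x = c)
    (x : X) : v (sec hK (proj K x)) = v x := by
  by_cases hx : x ∈ K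
  · rw [proj_of_mem hx, hv _ (sec_point hK), hv x hx]
  · rw [sec_proj hK hx]

variable [TopologicalSpace X]

theorem isOpen_collapse_iff {s : Set (Collapse K)} : IsOpen s ↔ IsOpen (proj K ⁻¹' s) :=
  isOpen_coinduced

theorem isClosed_collapse_iff {s : Set (Collapse K)} : IsClosed s ↔ IsClosed (proj K ⁻¹' s) := by
  rw [← isOpen_compl_iff, isOpen_collapse_iff, preimage_compl, isOpen_compl_iff]

theorem continuous_proj : Continuous (proj K) := continuous_coinduced_rng

theorem measurable_proj [MeasurableSpace X] [BorelSpace X] : Measurable (proj K) :=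
  continuous_proj.measurable

theorem isQuotientMap_proj (hK : K.Nonempty) : IsQuotientMap (proj K) :=
  ⟨⟨rfl⟩, surjective_proj hK⟩

theorem IsSaturated.isOpen_image {s : Set X} (hs : IsSaturated K s) (ho : IsOpen s) :
    IsOpen (proj K '' s) := by
  rw [isOpen_collapse_iff, hs.preimage_image]
  exact ho

/-- A closed set meeting `K` has the same image as its union with `K`, which is closed and
saturated. -/
theorem isClosedMap_proj (hK : IsClosed K) : IsClosedMap (proj K) := by
  intro C hC
  rw [isClosed_collapse_iff]
  by_cases h : Disjoint C K
  · rw [IsSaturated.preimage_image (Or.inl h)]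
    exact hC
  · obtain ⟨x, hxC, hxK⟩ := Set.not_disjoint_iff.1 h
    have : proj K '' C = proj K '' (C ∪ K) := by
      refine Subset.antisymm (image_mono subset_union_left) ?_
      rintro _ ⟨y, hy | hy, rfl⟩
      · exact ⟨y, hy, rfl⟩
      · exact ⟨x, hxC, by rw [proj_of_mem hxK, proj_of_mem hy]⟩
    rw [this, IsSaturated.preimage_image (Or.inr subset_union_right)]
    exact hC.union hK

theorem isClosed_point (hK : IsClosed K) : IsClosed {point K} := by
  rw [isClosed_collapse_iff]
  convert hK using 1
  ext x
  exact proj_eq_point_iff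

theorem closure_image_proj (hK : IsClosed K) (s : Set X) :
    closure (proj K '' s) = proj K '' closure s :=
  (isClosedMap_proj hK).closure_image_eq_of_continuous continuous_proj s

theorem preimage_closure_image (hK : IsClosed K) {s : Set X} (hs : IsSaturated K (closure s)) :
    proj K ⁻¹' closure (proj K '' s) = closure s := by
  rw [closure_image_proj hK, hs.preimage_image]

theorem preimage_frontier_image (hK : IsClosed K) {s : Set X} (hso : IsOpen s)
    (hs : IsSaturated K s) (hs' : IsSaturated K (closure s)) :
    proj K ⁻¹' frontier (proj K '' s) = frontier s := by
  rw [(hs.isOpen_image hso).frontier_eq, hso.frontier_eq, preimage_sdiff,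
    preimage_closure_image hK hs', hs.preimage_image]

theorem isOpenEmbedding_proj (hK : IsClosed K) :
    IsOpenEmbedding (fun x : ↥(Kᶜ) => proj K x) := by
  refine IsOpenEmbedding.of_continuous_injective_isOpenMap
    (continuous_proj.comp continuous_subtype_val)
    (fun x y h => Subtype.ext (eq_of_proj_eq x.2 h)) fun s hs => ?_
  have h1 : IsOpen (Subtype.val '' s) := hK.isOpen_compl.isOpenMap_subtype_val s hs
  have h2 : (fun x : ↥(Kᶜ) => proj K x) '' s = proj K '' (Subtype.val '' s) := by
    rw [image_image]
  rw [h2]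
  refine IsSaturated.isOpen_image (Or.inl (Set.disjoint_left.2 ?_)) h1
  rintro _ ⟨x, -, rfl⟩
  exact x.2

/-- Off `K` the projection is an open embedding, and `{x₀}` is closed; hence the Borel sets of `X₀`
are those with Borel preimage. -/
theorem measurableSet_collapse_iff [MeasurableSpace X] [BorelSpace X] (hK : IsClosed K)
    (hne : K.Nonempty) {s : Set (Collapse K)} :
    MeasurableSet s ↔ MeasurableSet (proj K ⁻¹' s) := by
  refine ⟨fun h => measurable_proj h, fun h => ?_⟩
  have hs : s = (fun x : ↥(Kᶜ) => proj K x) '' (Subtype.val ⁻¹' (proj K ⁻¹' s)) ∪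
      (s ∩ {point K}) := by
    ext p
    obtain ⟨x, rfl⟩ := surjective_proj hne p
    by_cases hx : x ∈ K
    · simp only [mem_union, mem_inter_iff, mem_singleton_iff, proj_eq_point_iff.2 hx, and_true]
      refine ⟨Or.inr, ?_⟩
      rintro (⟨y, hy, hyx⟩ | h)
      · rw [← hyx]
        exact hy
      · exact h
    · simp only [mem_union, mem_inter_iff, mem_singleton_iff, proj_eq_point_iff, hx, and_false,
        or_false]
      refine ⟨fun h => ⟨⟨x, hx⟩, h, rfl⟩, ?_⟩
      rintro ⟨y, hy, hyx⟩
      rw [← hyx]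
      exact hy
  rw [hs]
  refine ((isOpenEmbedding_proj hK).measurableEmbedding.measurableSet_image.2
    (measurable_subtype_coe h)).union ?_
  have := (isClosed_point hK).measurableSet
  by_cases hp : point K ∈ s
  · rwa [inter_eq_right.2 (singleton_subset_iff.2 hp)]
  · rw [inter_singleton_eq_empty.2 hp]
    exact MeasurableSet.empty

theorem measurable_collapse_iff [MeasurableSpace X] [BorelSpace X] (hK : IsClosed K)
    (hne : K.Nonempty) {β : Type*} [MeasurableSpace β] {f : Collapse K → β} :
    Measurable f ↔ Measurable (f ∘ proj K) :=
  ⟨fun h => h.comp measurable_proj, fun h _ ht => (measurableSet_collapse_iff hK hne).2 (h ht)⟩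

theorem measurable_sec [MeasurableSpace X] [BorelSpace X] (hK : IsClosed K) (hne : K.Nonempty) :
    Measurable (sec hne) := by
  classical
  rw [measurable_collapse_iff hK hne]
  have : sec hne ∘ proj K = K.piecewise (fun _ => sec hne (point K)) id := by
    ext x
    by_cases hx : x ∈ K
    · simp [hx, proj_of_mem hx]
    · simp [hx, sec_proj hne hx]
  rw [this]
  exact Measurable.piecewise hK.measurableSet measurable_const measurable_id

theorem measurableSingletonClass_collapse [T1Space X] (hK : IsClosed K) (hne : K.Nonempty) :
    MeasurableSingletonClass (Collapse K) := by
  refine ⟨fun p => IsClosed.measurableSet ?_⟩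
  obtain ⟨x, rfl⟩ := surjective_proj hne p
  have := isClosedMap_proj hK {x} isClosed_singleton
  rwa [image_singleton] at this

/-- Since the projection is a measurable embedding off `K`, no measurability of `f` is required.
This matters for functions controlled only on an open set `W`. -/
theorem integral_map_proj [MeasurableSpace X] [BorelSpace X] (hK : IsClosed K)
    {μ : Measure X} (hμ : ∀ᵐ x ∂μ, x ∉ K) (f : Collapse K → ℝ) :
    ∫ p, f p ∂(μ.map (proj K)) = ∫ x, f (proj K x) ∂μ := by
  have hval : MeasurableEmbedding (Subtype.val : ↥(Kᶜ) → X) :=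
    MeasurableEmbedding.subtype_coe hK.measurableSet.compl
  have hμ' : (μ.comap (Subtype.val : ↥(Kᶜ) → X)).map Subtype.val = μ := by
    rw [hval.map_comap, Subtype.range_coe]
    exact Measure.restrict_eq_self_of_ae_mem hμ
  rw [← hμ', Measure.map_map measurable_proj measurable_subtype_coe, hval.integral_map]
  exact (isOpenEmbedding_proj hK).measurableEmbedding.integral_map f

theorem integral_map_proj_dirac [MeasurableSpace X] [BorelSpace X] [T1Space X] (hK : IsClosed K)
    (hne : K.Nonempty) (x : X) (f : Collapse K → ℝ) :
    ∫ p, f p ∂((Measure.dirac x).map (proj K)) = f (proj K x) := by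
  have := measurableSingletonClass_collapse hK hne
  rw [Measure.map_dirac' measurable_proj, integral_dirac]

theorem lowerSemicontinuousOn_collapse {β : Type*} [Preorder β] {u : Collapse K → β} {U : Set (Collapse K)}
    (hU : IsOpen U) (hu : LowerSemicontinuousOn (u ∘ proj K) (proj K ⁻¹' U)) :
    LowerSemicontinuousOn u U := by
  intro p hp a ha
  refine mem_nhdsWithin_of_mem_nhds ?_
  have hO : IsOpen {q | q ∈ U ∧ a < u q} := by
    rw [isOpen_collapse_iff, isOpen_iff_mem_nhds]
    rintro x ⟨hxU, hxa⟩
    have hU' : proj K ⁻¹' U ∈ 𝓝 x := (hU.preimage continuous_proj).mem_nhds hxU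
    have := hu x hxU a hxa
    rw [nhdsWithin_eq_nhds.2 hU'] at this
    filter_upwards [this, hU'] with y hy hyU
    exact ⟨hyU, hy⟩
  filter_upwards [hO.mem_nhds ⟨hp, ha⟩] with q hq using hq.2

theorem continuousOn_collapse_iff {β : Type*} [TopologicalSpace β] (hne : K.Nonempty)
    {f : Collapse K → β} {U : Set (Collapse K)} (hU : IsOpen U) :
    ContinuousOn f U ↔ ContinuousOn (f ∘ proj K) (proj K ⁻¹' U) :=
  (isQuotientMap_proj hne).continuousOn_isOpen_iff hU

end CollapseSpace

/-! ### Kernels on `X₀` induced by kernels on `X`. -/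

section Lifts

variable {X : Type*} [TopologicalSpace X] [MeasurableSpace X] [BorelSpace X] {K : Set X}

/-- The kernel `T` on `X₀` is induced by the kernel `P` on `X`. -/
def Lifts (T : Kernel (Collapse K) (Collapse K)) (P : Kernel X X) : Prop :=
  ∀ x, T (proj K x) = (P x).map (proj K)

/-- Together with `Lifts.ext`, this reduces (H₁) on `X₀` to identities between kernels on `X`. -/
theorem Lifts.comp {T T' : Kernel (Collapse K) (Collapse K)} {P P' : Kernel X X} (h : Lifts T P)
    (h' : Lifts T' P') : Lifts (T ∘ₖ T') (P ∘ₖ P') := by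
  intro x
  ext s hs
  rw [Measure.map_apply measurable_proj hs, Kernel.comp_apply' _ _ _ hs,
    Kernel.comp_apply' _ _ _ (measurable_proj hs), h' x,
    lintegral_map (T.measurable_coe hs) measurable_proj]
  refine lintegral_congr fun y => ?_
  rw [h y, Measure.map_apply measurable_proj hs]

theorem Lifts.ext (hne : K.Nonempty) {T T' : Kernel (Collapse K) (Collapse K)} {P : Kernel X X}
    (h : Lifts T P) (h' : Lifts T' P) : T = T' := by
  ext1 p
  obtain ⟨x, rfl⟩ := surjective_proj hne p
  rw [h x, h' x]

theorem Lifts.isBoundaryKernel (hne : K.Nonempty) {T : Kernel (Collapse K) (Collapse K)}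
    {P : Kernel X X} (h : Lifts T P) {U : Set (Collapse K)} {V : Set X}
    (hUV : proj K ⁻¹' U = V) (hf : proj K ⁻¹' frontier U = frontier V)
    (hP : IsBoundaryKernel V P) : IsBoundaryKernel U T := by
  subst hUV
  refine ⟨fun p hp => ?_, fun p hp => ?_⟩ <;> obtain ⟨x, rfl⟩ := surjective_proj hne p
  · rw [h x, Measure.map_apply measurable_proj isClosed_frontier.measurableSet.compl,
      preimage_compl, hf]
    exact hP.1 x hp
  · rw [h x, hP.2 x hp, Measure.map_dirac' measurable_proj]

theorem Lifts.integral {T : Kernel (Collapse K) (Collapse K)}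
    {P : Kernel X X} (h : Lifts T P) {f : Collapse K → ℝ} (hf : Measurable f) (x : X) :
    ∫ p, f p ∂(T (proj K x)) = ∫ y, f (proj K y) ∂(P x) := by
  rw [h x, integral_map measurable_proj.aemeasurable hf.aestronglyMeasurable]

/-- A kernel on `X` whose measures at the points of `K` have the same image induces a kernel on
`X₀`. -/
noncomputable def descend (hK : IsClosed K) (hne : K.Nonempty) (P : Kernel X X) :
    Kernel (Collapse K) (Collapse K) :=
  (P.map (proj K)).comap (sec hne) (measurable_sec hK hne)

theorem lifts_descend (hK : IsClosed K) (hne : K.Nonempty) {P : Kernel X X} {μ : Measure (Collapse K)}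
    (hP : ∀ x ∈ K, (P x).map (proj K) = μ) : Lifts (descend hK hne P) P := by
  intro x
  rw [descend, Kernel.comap_apply, Kernel.map_apply _ measurable_proj]
  exact comp_sec_proj hne hP x

end Lifts

/-! ### The axioms of a normal Bauer family on `X₀`. -/

section DarnedFamily

variable {X : Type*} [TopologicalSpace X] [T2Space X] [LocallyCompactSpace X]
  [SecondCountableTopology X] [MeasurableSpace X] [BorelSpace X]
  {𝒱 : Set (Set X)} {H : Set X → Kernel X X} {K W₀ : Set X} {σ : ℝ → Measure X}
  {H₀ : Set (Collapse K) → Kernel (Collapse K) (Collapse K)}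

local notation "g" => gFun 𝒱 H K W₀
local notation "A" => ASet 𝒱 H K W₀
local notation "S" => SSet 𝒱 H K W₀
local notation "O" => OSet 𝒱 H K W₀
local notation "T" => AKernel 𝒱 H K W₀
local notation "Q" => darnMeasure 𝒱 H K W₀ σ
local notation "U" => USet 𝒱 H K W₀

/-- From inside `V` the measures live on the frontier, where `P` is Dirac. This is (H₁) for two
equal sets. -/
theorem IsBoundaryKernel.comp_self {P : Kernel X X} {V : Set X} (hV : IsOpen V)
    (hP : IsBoundaryKernel V P) : P ∘ₖ P = P := by
  ext x s hs
  rw [Kernel.comp_apply' _ _ _ hs]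
  by_cases hx : x ∈ V
  · rw [← lintegral_indicator_one hs]
    refine lintegral_congr_ae ?_
    filter_upwards [hP.ae_mem_frontier hx] with y hy
    rw [hV.frontier_eq] at hy
    rw [hP.2 y hy.2, Measure.dirac_apply' _ hs]
  · rw [hP.2 x hx, lintegral_dirac' _ (P.measurable_coe hs), hP.2 x hx]

theorem isSaturated_of_closure {V : Set X} (hVK : closure V ∩ K = ∅) :
    IsSaturated K V ∧ IsSaturated K (closure V) := by
  have h : Disjoint (closure V) K := disjoint_iff_inter_eq_empty.2 hVK
  exact ⟨Or.inl (h.mono_left subset_closure), Or.inl h⟩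

namespace DarningData

theorem USet_eq (d : DarningData 𝒱 H K W₀) {t : ℝ} (ht : 0 < t) : U t = proj K '' O t := by
  obtain ⟨z, hz⟩ := d.nonempty
  rw [d.O_eq ht, image_union, USet]
  ext p
  simp only [mem_insert_iff, mem_union]
  rw [or_comm]
  refine or_congr_right ⟨fun h => ⟨z, hz, by rw [h, proj_of_mem hz]⟩, ?_⟩
  rintro ⟨x, hx, rfl⟩
  exact proj_of_mem hx

theorem isSaturated_O (d : DarningData 𝒱 H K W₀) {t : ℝ} (ht : 0 < t) : IsSaturated K (O t) :=
  Or.inr (d.K_subset_O ht)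

theorem isSaturated_closure_O (d : DarningData 𝒱 H K W₀) {t : ℝ} (ht : 0 < t) :
    IsSaturated K (closure (O t)) := Or.inr ((d.K_subset_O ht).trans subset_closure)

theorem preimage_U (d : DarningData 𝒱 H K W₀) {t : ℝ} (ht : 0 < t) : proj K ⁻¹' U t = O t := by
  rw [d.USet_eq ht, (d.isSaturated_O ht).preimage_image]

theorem preimage_closure_U (d : DarningData 𝒱 H K W₀) {t : ℝ} (ht : 0 < t) :
    proj K ⁻¹' closure (U t) = closure (O t) := by
  rw [d.USet_eq ht, preimage_closure_image d.isClosed_K (d.isSaturated_closure_O ht)]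

theorem preimage_frontier_U (d : DarningData 𝒱 H K W₀) {t : ℝ} (ht : 0 < t) :
    proj K ⁻¹' frontier (U t) = frontier (O t) := by
  rw [d.USet_eq ht, preimage_frontier_image d.isClosed_K (d.isOpen_O t) (d.isSaturated_O ht)
    (d.isSaturated_closure_O ht)]

theorem isOpen_U (d : DarningData 𝒱 H K W₀) {t : ℝ} (ht : 0 < t) : IsOpen (U t) := by
  rw [isOpen_collapse_iff, d.preimage_U ht]
  exact d.isOpen_O t

/-- On the compact part of `closure W₀` outside the preimage of `N`, `g` has a positive lower bound
`c`, so `g ≤ c/2` forces membership in `N`. The bound `1/2` keeps `t` below `1`. -/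
theorem exists_closure_U_subset (d : DarningData 𝒱 H K W₀) {N : Set (Collapse K)}
    (hN : IsOpen N) (hp : point K ∈ N) : ∃ t ∈ Ioo (0 : ℝ) 1, closure (U t) ⊆ N := by
  have hKN : K ⊆ proj K ⁻¹' N := fun x hx => by
    rw [mem_preimage, proj_of_mem hx]
    exact hp
  have hC : IsCompact (closure W₀ \ proj K ⁻¹' N) :=
    d.regular.2.1.diff (hN.preimage continuous_proj)
  obtain ⟨c, hc0, hc⟩ := hC.exists_forall_le' (a := 0) (d.continuousOn_g.mono sdiff_subset)
    (fun x hx => by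
      by_cases hxW : x ∈ W₀
      · exact d.pos x ⟨hxW, fun h => hx.2 (hKN h)⟩
      · rw [d.g_eq_one (by rw [d.isOpen_W.frontier_eq]; exact ⟨hx.1, hxW⟩)]
        exact one_pos)
  have ht : min (c / 2) (1 / 2) ∈ Ioo (0 : ℝ) 1 :=
    ⟨by positivity, (min_le_right _ _).trans_lt (by norm_num)⟩
  refine ⟨_, ht, ?_⟩
  rw [d.USet_eq ht.1, closure_image_proj d.isClosed_K, image_subset_iff]
  intro x hx
  obtain ⟨hxW, hxg⟩ := d.closure_O_subset ht.2 hx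
  by_contra hxN
  have := hc x ⟨subset_closure hxW, hxN⟩
  linarith [min_le_left (c / 2) (1 / 2)]

theorem point_mem_U (_d : DarningData 𝒱 H K W₀) (t : ℝ) : point K ∈ U t := mem_insert _ _

theorem U_mem_VZero (_d : DarningData 𝒱 H K W₀) {t : ℝ} (ht : t ∈ Ioo (0 : ℝ) 1) :
    U t ∈ VZero 𝒱 H K W₀ := Or.inl ⟨t, ht, rfl⟩

theorem closure_image_subset (d : DarningData 𝒱 H K W₀) {V : Set X} {N : Set (Collapse K)}
    (h : closure (proj K '' V) ⊆ N) : closure V ⊆ proj K ⁻¹' N := by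
  rwa [closure_image_proj d.isClosed_K, image_subset_iff] at h

theorem exists_mem_VZero (d : DarningData 𝒱 H K W₀) {N : Set (Collapse K)}
    (hN : IsOpen N) {p : Collapse K} (hp : p ∈ N) :
    ∃ W ∈ VZero 𝒱 H K W₀, p ∈ W ∧ closure W ⊆ N := by
  obtain ⟨x, rfl⟩ := surjective_proj d.nonempty p
  by_cases hx : x ∈ K
  · rw [proj_of_mem hx] at hp ⊢
    obtain ⟨t, ht, hsub⟩ := d.exists_closure_U_subset hN hp
    exact ⟨U t, d.U_mem_VZero ht, d.point_mem_U t, hsub⟩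
  · have hO : IsOpen (proj K ⁻¹' N \ K) := (hN.preimage continuous_proj).sdiff d.isClosed_K
    obtain ⟨V, hV, hxV, hVO⟩ := exists_mem_basis d.family.isBasis
      (eventually_smallSets_closure_subset (hO.mem_nhds ⟨hp, hx⟩))
    have hVK : closure V ∩ K = ∅ := disjoint_iff_inter_eq_empty.1
      (Set.disjoint_left.2 fun y hy => (hVO hy).2)
    refine ⟨proj K '' V, Or.inr ⟨V, hV, hVK, rfl⟩, ⟨x, hxV, rfl⟩, ?_⟩
    rw [closure_image_proj d.isClosed_K, image_subset_iff]
    exact fun y hy => (hVO hy).1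

theorem isOpen_of_mem_VZero (d : DarningData 𝒱 H K W₀) {W : Set (Collapse K)}
    (hW : W ∈ VZero 𝒱 H K W₀) : IsOpen W := by
  rcases hW with ⟨t, ht, rfl⟩ | ⟨V, hV, hVK, rfl⟩
  · exact d.isOpen_U ht.1
  · exact (isSaturated_of_closure hVK).1.isOpen_image (d.family.isBasis.isOpen hV)

theorem isCompact_closure_of_mem_VZero (d : DarningData 𝒱 H K W₀) {W : Set (Collapse K)}
    (hW : W ∈ VZero 𝒱 H K W₀) : IsCompact (closure W) := by
  rcases hW with ⟨t, ht, rfl⟩ | ⟨V, hV, hVK, rfl⟩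
  · rw [d.USet_eq ht.1, closure_image_proj d.isClosed_K]
    exact (d.isCompact_closure_O t).image continuous_proj
  · rw [closure_image_proj d.isClosed_K]
    exact (d.family.isCompact_closure V hV).image continuous_proj

theorem isTopologicalBasis_VZero (d : DarningData 𝒱 H K W₀) :
    TopologicalSpace.IsTopologicalBasis (VZero 𝒱 H K W₀) := by
  refine TopologicalSpace.isTopologicalBasis_of_isOpen_of_nhds
    (fun W hW => d.isOpen_of_mem_VZero hW) fun p N hp hN => ?_
  obtain ⟨W, hW, hpW, hWN⟩ := d.exists_mem_VZero hN hp
  exact ⟨W, hW, hpW, subset_closure.trans hWN⟩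

theorem isLocalChoice_VZero (d : DarningData 𝒱 H K W₀) {N : Set (Collapse K)} (hN : IsOpen N) :
    IsLocalChoice (VZero 𝒱 H K W₀) N (fullChoice (VZero 𝒱 H K W₀) N) := by
  refine fun p hp => ⟨subset_rfl, fun M hM => ?_⟩
  obtain ⟨M', hM', hM'o, hpM'⟩ := mem_nhds_iff.1 hM
  obtain ⟨W, hW, hpW, hWN⟩ := d.exists_mem_VZero (hN.inter hM'o) ⟨hp, hpM'⟩
  exact ⟨W, ⟨hW, hWN.trans inter_subset_left, hpW⟩,
    subset_closure.trans (hWN.trans (inter_subset_right.trans hM'))⟩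

theorem S_nonempty (_d : DarningData 𝒱 H K W₀) (hσ : IsSphereFamily 𝒱 H K W₀ σ) {t : ℝ}
    (ht : t ∈ Ioo (0 : ℝ) 1) : (S t).Nonempty := by
  have := (hσ t ht).1
  exact (hσ.ae_mem ht).exists

/-- The set `S_t` carries a probability measure and so is non-empty; thus `U_t` grows strictly with
`t` and determines `t`. -/
theorem le_of_U_subset (d : DarningData 𝒱 H K W₀) (hσ : IsSphereFamily 𝒱 H K W₀ σ) {s t : ℝ}
    (hs : s ∈ Ioo (0 : ℝ) 1) (ht : t ∈ Ioo (0 : ℝ) 1) (h : U s ⊆ U t) : s ≤ t := by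
  by_contra! hts
  obtain ⟨x, hx⟩ := d.S_nonempty hσ ht
  have h1 : O s ⊆ O t := by
    rw [← d.preimage_U hs.1, ← d.preimage_U ht.1]
    exact preimage_mono h
  have := (h1 (d.A_subset_O s (d.S_subset_A hts hx))).2
  rw [hx.2] at this
  exact lt_irrefl _ this

theorem image_W_eq (d : DarningData 𝒱 H K W₀) :
    insert (point K) (proj K '' (W₀ \ K)) = proj K '' W₀ := by
  obtain ⟨z, hz⟩ := d.nonempty
  ext p
  constructor
  · rintro (rfl | ⟨x, hx, rfl⟩)
    · exact ⟨z, d.subset hz, proj_of_mem hz⟩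
    · exact ⟨x, hx.1, rfl⟩
  · rintro ⟨x, hx, rfl⟩
    by_cases hxK : x ∈ K
    · exact Or.inl (proj_of_mem hxK)
    · exact Or.inr ⟨x, ⟨hx, hxK⟩, rfl⟩

theorem preimage_image_W (d : DarningData 𝒱 H K W₀) : proj K ⁻¹' (proj K '' W₀) = W₀ :=
  IsSaturated.preimage_image (Or.inr d.subset)

theorem isOpen_image_W (d : DarningData 𝒱 H K W₀) : IsOpen (proj K '' W₀) :=
  IsSaturated.isOpen_image (Or.inr d.subset) d.isOpen_W

/-- The splitting over `S_t` and `K` for functions that need not be harmonic: subtract `c` to make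
the integrand vanish on `K`. -/
theorem integral_AKernel (d : DarningData 𝒱 H K W₀) {t : ℝ} (ht : t ∈ Ioo (0 : ℝ) 1) {f : X → ℝ}
    (hf : BddMeas f) {c : ℝ} (hfK : ∀ x ∈ K, f x = c) {x : X} (hx : x ∈ A t) :
    ∫ y, f y ∂(T t x) = ∫ y in S t, f y ∂(T t x) + (1 - g x / t) * c := by
  have := d.isMarkovKernel ht
  have h1 : ∫ y, (f y - c) ∂(T t x) = ∫ y in S t, (f y - c) ∂(T t x) := by
    rw [← integral_indicator (d.measurableSet_S t)]
    refine integral_congr_ae ?_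
    filter_upwards [d.ae_mem ht hx] with y hy
    rcases hy.2 with h | h
    · rw [indicator_of_mem (d.frontier_O_subset ht.1 ht.2 h)]
    · rw [indicator_of_notMem (fun hS : y ∈ S t => hS.1.2 h), hfK y h, sub_self]
  have h2 : (T t x).real (S t) = g x / t := by
    rw [Measure.real, d.measure_S ht (d.A_subset_O t hx),
      ENNReal.toReal_ofReal (div_nonneg (d.g_nonneg x) ht.1.le)]
  rw [integral_sub (hf.integrable _) (integrable_const _),
    integral_sub (hf.integrable _) (integrable_const _)] at h1
  simp only [integral_const, probReal_univ, smul_eq_mul, one_mul, MeasurableSet.univ,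
    measureReal_restrict_apply, univ_inter, h2] at h1
  linarith

end DarningData

/-- The kernels `H₀ V`, `V ∈ 𝒱₀`, are the kernels `H V` and the darned kernels. -/
structure IsDarned (d : DarningData 𝒱 H K W₀) (σ : ℝ → Measure X)
    (H₀ : Set (Collapse K) → Kernel (Collapse K) (Collapse K)) : Prop where
  agree : ∀ V ∈ 𝒱, closure V ∩ K = ∅ → Lifts (H₀ (proj K '' V)) (H V)
  darned : ∀ t ∈ Ioo (0 : ℝ) 1, Lifts (H₀ (U t)) (d.darnKernel σ t)

namespace IsDarned

variable {d : DarningData 𝒱 H K W₀}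

/-- The mean value inequality on `X₀` for a positive function induced by a function on `X`. -/
theorem lintegral_le {T₀ : Kernel (Collapse K) (Collapse K)} {P : Kernel X X} [IsMarkovKernel P]
    (hT : Lifts T₀ P) (hK : IsClosed K) (hne : K.Nonempty) {v : X → ℝ} (hv : BddMeas v)
    (hv0 : ∀ x, 0 ≤ v x) {x : X} (hvK : (∀ᵐ y ∂(P x), y ∉ K) ∨ ∃ c, ∀ y ∈ K, v y = c)
    (hx : x ∉ K ∨ ∃ c, ∀ y ∈ K, v y = c) (hle : ∫ y, v y ∂(P x) ≤ v x) :
    ∫⁻ p, ENNReal.ofReal (v (sec hne p)) ∂(T₀ (proj K x)) ≤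
      ENNReal.ofReal (v (sec hne (proj K x))) := by
  have hm : Measurable fun p => ENNReal.ofReal (v (sec hne p)) :=
    (hv.meas.comp (measurable_sec hK hne)).ennreal_ofReal
  have hvx : v (sec hne (proj K x)) = v x := by
    rcases hx with hx | ⟨c, hc⟩
    · rw [sec_proj hne hx]
    · exact comp_sec_proj hne hc x
  rw [hT x, lintegral_map hm measurable_proj, hvx]
  calc ∫⁻ y, ENNReal.ofReal (v (sec hne (proj K y))) ∂(P x) = ∫⁻ y, ENNReal.ofReal (v y) ∂(P x) := by
        rcases hvK with h | ⟨c, hc⟩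
        · refine lintegral_congr_ae ?_
          filter_upwards [h] with y hy
          rw [sec_proj hne hy]
        · simp_rw [comp_sec_proj hne hc]
    _ = ENNReal.ofReal (∫ y, v y ∂(P x)) :=
        (ofReal_integral_eq_lintegral_ofReal (hv.integrable _) (ae_of_all _ hv0)).symm
    _ ≤ ENNReal.ofReal (v x) := ENNReal.ofReal_le_ofReal hle

/-- A superharmonic function on `W₀ ∖ K` which has its maximal value on `K` induces a positive
hyperharmonic function on `{x₀} ∪ (W₀ ∖ K)`. -/
theorem isPosHyperharmonic (hd : IsDarned d σ H₀) (hσ : IsSphereFamily 𝒱 H K W₀ σ) {v : X → ℝ}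
    (hv : BddMeas v) (hv0 : ∀ x, 0 ≤ v x) {c : ℝ} (hvc : ∀ x, v x ≤ c) (hvK : ∀ x ∈ K, v x = c)
    (hvl : LowerSemicontinuousOn v W₀) (hvs : ∀ x ∈ W₀ \ K, LocSuperAt 𝒱 H v x) :
    IsPosHyperharmonic H₀ (fullChoice (VZero 𝒱 H K W₀) (proj K '' W₀)) (proj K '' W₀)
      (fun p => ENNReal.ofReal (v (sec d.nonempty p))) := by
  constructor
  · refine lowerSemicontinuousOn_collapse d.isOpen_image_W ?_
    rw [d.preimage_image_W]
    have : (fun p => ENNReal.ofReal (v (sec d.nonempty p))) ∘ proj K =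
        fun x => ENNReal.ofReal (v x) := by
      ext x
      simp only [Function.comp_apply, comp_sec_proj d.nonempty hvK]
    rw [this]
    exact ENNReal.continuous_ofReal.comp_lowerSemicontinuousOn hvl
      (fun _ _ h => ENNReal.ofReal_le_ofReal h)
  · rintro p hp W ⟨hW, hWc, hpW⟩
    obtain ⟨x, rfl⟩ := surjective_proj d.nonempty p
    rcases hW with ⟨t, ht, rfl⟩ | ⟨V, hV, hVK, rfl⟩
    · have hMarkov := d.isMarkovKernel_darnKernel hσ ht
      refine lintegral_le (hd.darned t ht) d.isClosed_K d.nonempty hv hv0 (Or.inr ⟨c, hvK⟩)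
        (Or.inr ⟨c, hvK⟩) ?_
      have hxO : x ∈ O t := by
        rw [← d.preimage_U ht.1]
        exact hpW
      by_cases hxK : x ∈ K
      · rw [hvK x hxK]
        simpa using integral_mono (hv.integrable (d.darnKernel σ t x)) (integrable_const c) hvc
      · have hxA : x ∈ A t := by rw [d.A_eq]; exact ⟨hxO, hxK⟩
        have := (hσ t ht).1
        have hσc : ∫ y, v y ∂(σ t) ≤ c := by
          simpa using integral_mono (hv.integrable (σ t)) (integrable_const c) hvc
        -- Replacing the mean over `σ_t` by the maximal value `c`, which `v` takes on `K`, turns the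
        -- darned kernel into that of `A_t`; there `v` dominates its mean values.
        calc ∫ y, v y ∂(d.darnKernel σ t x)
            = ∫ y in S t, v y ∂(T t x) + (1 - g x / t) * ∫ y, v y ∂(σ t) :=
              d.integral_darnMeasure hσ ht hv hxO
          _ ≤ ∫ y in S t, v y ∂(T t x) + (1 - g x / t) * c := by
              gcongr
              exact d.one_sub_nonneg ht hxO
          _ = ∫ y, v y ∂(T t x) := (d.integral_AKernel ht hv hvK hxA).symm
          _ ≤ v x := by
              refine (d.isDirichletKernel ht).integral_le d.family d.isPSet
                ((d.A_subset t).trans sdiff_subset) (d.regular_A ht.1 ht.2) hv (hvl.mono ?_)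
                (fun y hy => hvs y (d.A_subset t hy)) hxA
              exact (closure_mono (d.A_subset_O t)).trans
                fun y hy => (d.closure_O_subset ht.2 hy).1
    · have hMarkov := d.family.isMarkovKernel hV
      refine lintegral_le (hd.agree V hV hVK) d.isClosed_K d.nonempty hv hv0 (Or.inr ⟨c, hvK⟩)
        (Or.inr ⟨c, hvK⟩) ?_
      have hVW : closure V ⊆ W₀ := by
        have := d.closure_image_subset hWc
        rwa [d.preimage_image_W] at this
      refine d.family.integral_le hV hv (hvl.mono hVW) (fun y hy => hvs y ?_) x
      exact ⟨hVW (subset_closure hy), fun hyK =>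
        (disjoint_iff_inter_eq_empty.2 hVK).ne_of_mem (subset_closure hy) hyK rfl⟩

/-- `{x₀} ∪ (W₀ ∖ K)` is a `𝒫`-set. -/
theorem isPSet_image_W (hd : IsDarned d σ H₀) (hσ : IsSphereFamily 𝒱 H K W₀ σ) :
    IsPSet (VZero 𝒱 H K W₀) H₀ (proj K '' W₀) := by
  refine ⟨d.isOpen_image_W, ?_⟩
  rintro _ ⟨x, hx, rfl⟩ _ ⟨y, hy, rfl⟩ hxy
  have hgl : LowerSemicontinuousOn (fun x => 1 + (-1) * g x) W₀ :=
    (continuousOn_const.add (continuousOn_const.mul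
      (d.continuousOn_g.mono subset_closure))).lowerSemicontinuousOn
  have hgb : BddMeas fun x => 1 + (-1) * g x :=
    (BddMeas.const 1).add ((BddMeas.const (-1)).mul d.g_bddMeas)
  have hgh : ∀ x ∈ W₀ \ K, LocSuperAt 𝒱 H (fun x => 1 + (-1) * g x) x := fun x hx =>
    (((IsHarmonic.const d.family (W₀ \ K) 1).add d.family
      (d.isHarmonic_g.const_mul (-1))).locHarmAt d.regular_sdiff.1 hx).locSuperAt
  have hg0 : ∀ x, 0 ≤ 1 + (-1) * g x := fun x => by linarith [d.g_le_one x]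
  have hgK : ∀ x ∈ K, 1 + (-1) * g x = 1 := fun x hx => by rw [d.g_eq_zero hx]; ring
  by_cases hgxy : g x = g y
  · have hne : x ≠ y := fun h => hxy (by rw [h])
    have hgx : 0 < g x := by
      by_cases hxK : x ∈ K
      · have hyK : y ∉ K := fun h => hxy (by rw [proj_of_mem hxK, proj_of_mem h])
        rw [hgxy]
        exact d.pos y ⟨hy, hyK⟩
      · exact d.pos x ⟨hx, hxK⟩
    obtain ⟨u, hu, hu0, hul, hus, hune⟩ := d.isPSet.2.exists_real d.family d.isOpen_W
      (fun _ _ => subset_rfl) hx hy hne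
    obtain ⟨C, hC⟩ := hu.bdd
    have hC0 : 0 ≤ C := (abs_nonneg _).trans (hC x)
    -- With this `N`, the cap in `min (u + N (1 - g)) N` is active on `K` but not at `x` and `y`,
    -- where `u - N g ≤ C - (C + 1) < 0`. At these two points the function still differs as `u`
    -- does.
    let N : ℝ := (C + 1) / g x
    have hN0 : 0 ≤ N := div_nonneg (by linarith) hgx.le
    have hNg : N * g x = C + 1 := div_mul_cancel₀ _ hgx.ne'
    let v : X → ℝ := fun z => min (u z + (0 + N * (1 + (-1) * g z))) N
    have huC : ∀ z, u z ≤ C := fun z => (le_abs_self _).trans (hC z)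
    have hsb : BddMeas fun z => 0 + N * (1 + (-1) * g z) :=
      (BddMeas.const 0).add ((BddMeas.const N).mul hgb)
    have husup : ∀ z ∈ W₀, LocSuperAt 𝒱 H u z := fun z hz => by
      filter_upwards [eventually_smallSets_closure_subset (d.isOpen_W.mem_nhds hz)] with W hW hWV hzW
      exact hus z hz W ⟨hWV, hW, hzW⟩
    have hv := hd.isPosHyperharmonic hσ (v := v) (c := N) ((hu.add hsb).min (BddMeas.const N))
      (fun z => le_min (add_nonneg (hu0 z) (by have := mul_nonneg hN0 (hg0 z); linarith)) hN0)
      (fun z => min_le_right _ _)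
      (fun z hz => by
        refine min_eq_right ?_
        rw [hgK z hz]
        linarith [hu0 z])
      ((hul.add (lowerSemicontinuousOn_const_add_mul hgl 0 hN0)).inf lowerSemicontinuousOn_const)
      (fun z hz => ((husup z hz.1).add d.family hu hsb
        ((hgh z hz).const_add_mul d.family hgb 0 hN0)).min d.family (hu.add hsb) (BddMeas.const N)
        (locSuperAt_const d.family N z))
    refine ⟨_, hv, fun h => hune ?_⟩
    have hvK : ∀ z ∈ K, v z = N := fun z hz => by
        refine min_eq_right ?_
        rw [hgK z hz]
        linarith [hu0 z]
    have hv0 : ∀ z, 0 ≤ v z := fun z =>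
      le_min (add_nonneg (hu0 z) (by have := mul_nonneg hN0 (hg0 z); linarith)) hN0
    rw [comp_sec_proj d.nonempty hvK, comp_sec_proj d.nonempty hvK,
      ENNReal.ofReal_eq_ofReal_iff (hv0 x) (hv0 y)] at h
    have hvx : v x = u x + (0 + N * (1 + (-1) * g x)) := min_eq_left (by linarith [huC x])
    have hvy : v y = u y + (0 + N * (1 + (-1) * g y)) := min_eq_left (by
      rw [← hgxy]
      linarith [huC y])
    rw [hvx, hvy, hgxy] at h
    linarith
  · refine ⟨_, hd.isPosHyperharmonic hσ hgb hg0 (c := 1) (fun z => by linarith [d.g_nonneg z]) hgK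
      hgl hgh, fun h => hgxy ?_⟩
    rw [comp_sec_proj d.nonempty hgK, comp_sec_proj d.nonempty hgK,
      ENNReal.ofReal_eq_ofReal_iff (hg0 x) (hg0 y)] at h
    linarith

/-- The sets `U_t` inherit separation from the larger `𝒫`-set. For the other sets, hyperharmonic
functions on `V` are transported; no `U_t` fits inside, since it contains `x₀`. -/
theorem isPSet_of_mem_VZero (hd : IsDarned d σ H₀) (hσ : IsSphereFamily 𝒱 H K W₀ σ)
    {W : Set (Collapse K)} (hW : W ∈ VZero 𝒱 H K W₀) : IsPSet (VZero 𝒱 H K W₀) H₀ W := by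
  have hWo := d.isOpen_of_mem_VZero hW
  refine ⟨hWo, fun p hp q hq hpq => ?_⟩
  rcases hW with ⟨t, ht, rfl⟩ | ⟨V, hV, hVK, rfl⟩
  · have hsub : U t ⊆ proj K '' W₀ := by
      rw [d.USet_eq ht.1]
      exact image_mono fun x hx => hx.1
    obtain ⟨u, hu, hne⟩ := (hd.isPSet_image_W hσ).2 p (hsub hp) q (hsub hq) hpq
    exact ⟨u, ⟨hu.1.mono hsub, fun z hz W hW =>
      hu.2 z (hsub hz) W ⟨hW.1, hW.2.1.trans hsub, hW.2.2⟩⟩, hne⟩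
  · obtain ⟨x, hx, rfl⟩ := hp
    obtain ⟨y, hy, rfl⟩ := hq
    have hdisj := disjoint_iff_inter_eq_empty.2 hVK
    have hnot : ∀ z ∈ closure V, z ∉ K := fun z hz hzK => hdisj.ne_of_mem hz hzK rfl
    have hpre := (isSaturated_of_closure hVK).1.preimage_image
    obtain ⟨v, hv, hv0, hvl, hvs, hne⟩ := (d.family.isPSet hV).2.exists_real d.family
      (d.family.isBasis.isOpen hV) (fun _ _ => subset_rfl) hx hy (fun h => hpq (by rw [h]))
    refine ⟨fun p => ENNReal.ofReal (v (sec d.nonempty p)), ⟨?_, ?_⟩, ?_⟩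
    · refine lowerSemicontinuousOn_collapse hWo ?_
      rw [hpre]
      have h1 : LowerSemicontinuousOn (fun x => ENNReal.ofReal (v x)) V :=
        ENNReal.continuous_ofReal.comp_lowerSemicontinuousOn hvl
          (fun _ _ h => ENNReal.ofReal_le_ofReal h)
      have he : ∀ z ∈ V, ((fun p => ENNReal.ofReal (v (sec d.nonempty p))) ∘ proj K) z =
          ENNReal.ofReal (v z) := fun z hz => by
        simp only [Function.comp_apply, sec_proj d.nonempty (hnot z (subset_closure hz))]
      intro z hz a ha
      rw [he z hz] at ha
      filter_upwards [h1 z hz a ha, self_mem_nhdsWithin] with w hw hwV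
      rw [he w hwV]
      exact hw
    · rintro _ ⟨z, hz, rfl⟩ W ⟨hW, hWc, hzW⟩
      rcases hW with ⟨t, ht, rfl⟩ | ⟨V', hV', hVK', rfl⟩
      · obtain ⟨w, hw, hwp⟩ := hWc (subset_closure (d.point_mem_U t))
        exact absurd (proj_eq_point_iff.1 hwp) (hnot w (subset_closure hw))
      · have hMarkov := d.family.isMarkovKernel hV'
        have hsub : closure V' ⊆ V := by
          have := d.closure_image_subset hWc
          rwa [hpre] at this
        have hzV' : z ∈ V' := by
          rw [← (isSaturated_of_closure hVK').1.preimage_image]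
          exact hzW
        refine lintegral_le (hd.agree V' hV' hVK') d.isClosed_K d.nonempty hv hv0 (Or.inl ?_)
          (Or.inl (hnot z (subset_closure hz))) (hvs z hz V' ⟨hV', hsub, hzV'⟩)
        filter_upwards [(d.family.isBoundaryKernel _ hV').ae_mem_frontier hzV'] with w hw
        exact hnot w (subset_closure (hsub (frontier_subset_closure hw)))
    · simp only [sec_proj d.nonempty (hnot x (subset_closure hx)),
        sec_proj d.nonempty (hnot y (subset_closure hy))]
      rwa [ne_eq, ENNReal.ofReal_eq_ofReal_iff (hv0 x) (hv0 y)]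

theorem isNormalBauerFamily (hd : IsDarned d σ H₀) (hσ : IsSphereFamily 𝒱 H K W₀ σ)
    (hc : IsCompatible 𝒱 H K W₀ σ) : IsNormalBauerFamily (VZero 𝒱 H K W₀) H₀ where
  isBasis := d.isTopologicalBasis_VZero
  isCompact_closure V hV := d.isCompact_closure_of_mem_VZero hV
  isBoundaryKernel := by
    rintro _ (⟨t, ht, rfl⟩ | ⟨V, hV, hVK, rfl⟩)
    · exact (hd.darned t ht).isBoundaryKernel d.nonempty (d.preimage_U ht.1)
        (d.preimage_frontier_U ht.1) (d.isBoundaryKernel_darnKernel hσ hc ht)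
    · obtain ⟨h1, h2⟩ := isSaturated_of_closure hVK
      exact (hd.agree V hV hVK).isBoundaryKernel d.nonempty h1.preimage_image
        (preimage_frontier_image d.isClosed_K (d.family.isBasis.isOpen hV) h1 h2)
        (d.family.isBoundaryKernel V hV)
  comp_eq := by
    rintro _ (⟨t, ht, rfl⟩ | ⟨V, hV, hVK, rfl⟩) _ (⟨s, hs, rfl⟩ | ⟨V', hV', hVK', rfl⟩) hsub
    · refine Lifts.ext d.nonempty ((hd.darned t ht).comp (hd.darned s hs)) ?_
      rcases (d.le_of_U_subset hσ hs ht hsub).eq_or_lt with rfl | hst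
      · rw [(d.isBoundaryKernel_darnKernel hσ hc hs).comp_self (d.isOpen_O s)]
        exact hd.darned s hs
      · rw [d.darnKernel_comp_darnKernel hσ hc hs.1 hst ht.2]
        exact hd.darned t ht
    · refine Lifts.ext d.nonempty ((hd.darned t ht).comp (hd.agree V' hV' hVK')) ?_
      rw [d.comp_darnKernel hσ ht hV']
      · exact hd.darned t ht
      · intro x hx
        rw [d.A_eq, ← d.preimage_U ht.1]
        exact ⟨hsub ⟨x, hx, rfl⟩, fun hxK =>
          (disjoint_iff_inter_eq_empty.2 hVK').ne_of_mem (subset_closure hx) hxK rfl⟩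
    · obtain ⟨w, hw, hwp⟩ := hsub (d.point_mem_U s)
      exact absurd rfl ((disjoint_iff_inter_eq_empty.2 hVK).ne_of_mem (subset_closure hw)
        (proj_eq_point_iff.1 hwp))
    · refine Lifts.ext d.nonempty ((hd.agree V hV hVK).comp (hd.agree V' hV' hVK')) ?_
      rw [d.family.comp_eq V hV V' hV']
      · exact hd.agree V hV hVK
      · rw [← (isSaturated_of_closure hVK).1.preimage_image]
        exact image_subset_iff.1 hsub
  continuous_integral := by
    rintro _ (⟨t, ht, rfl⟩ | ⟨V, hV, hVK, rfl⟩) f hf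
    · rw [(isQuotientMap_proj d.nonempty).continuous_iff]
      refine (d.continuous_integral_darnMeasure hσ hc ht (hf.comp continuous_proj)).congr
        fun x => ((hd.darned t ht).integral hf.measurable x).symm
    · rw [(isQuotientMap_proj d.nonempty).continuous_iff]
      refine (d.family.continuous_integral V hV _ (hf.comp continuous_proj)).congr
        fun x => ((hd.agree V hV hVK).integral hf.measurable x).symm
  normal := by
    rintro _ (⟨t, ht, rfl⟩ | ⟨V, hV, hVK, rfl⟩) p <;>
      obtain ⟨x, rfl⟩ := surjective_proj d.nonempty p
    · rw [hd.darned t ht x, Measure.map_apply measurable_proj MeasurableSet.univ, preimage_univ]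
      exact (d.isProbabilityMeasure_darnMeasure hσ ht x).measure_univ
    · rw [hd.agree V hV hVK x, Measure.map_apply measurable_proj MeasurableSet.univ, preimage_univ]
      exact d.family.normal V hV x
  separates V hV := ⟨_, d.isLocalChoice_VZero (d.isOpen_of_mem_VZero hV),
    (hd.isPSet_of_mem_VZero hσ hV).2⟩
  continuousOn_integral := by
    rintro W hW f hf ⟨C, hC⟩
    have hf' : BddMeas (f ∘ proj K) := ⟨hf.comp measurable_proj, C, fun x => hC _⟩
    rw [continuousOn_collapse_iff d.nonempty (d.isOpen_of_mem_VZero hW)]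
    rcases hW with ⟨t, ht, rfl⟩ | ⟨V, hV, hVK, rfl⟩
    · rw [d.preimage_U ht.1]
      exact (d.continuousOn_integral_darnMeasure_of_bddMeas hσ hc ht hf').congr
        fun x _ => (hd.darned t ht).integral hf x
    · rw [(isSaturated_of_closure hVK).1.preimage_image]
      exact (d.family.continuousOn_integral V hV _ hf'.meas hf'.bdd).congr
        fun x _ => (hd.agree V hV hVK).integral hf x

end IsDarned

end DarnedFamily

/-! ### Existence, uniqueness, and harmonicity at `x₀`. -/

section Darning

variable {X : Type*} [TopologicalSpace X] [T2Space X] [LocallyCompactSpace X]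
  [SecondCountableTopology X] [MeasurableSpace X] [BorelSpace X]
  {𝒱 : Set (Set X)} {H : Set X → Kernel X X} {K W₀ : Set X} {σ : ℝ → Measure X}
  {H₀ : Set (Collapse K) → Kernel (Collapse K) (Collapse K)}

local notation "g" => gFun 𝒱 H K W₀
local notation "A" => ASet 𝒱 H K W₀
local notation "S" => SSet 𝒱 H K W₀
local notation "O" => OSet 𝒱 H K W₀
local notation "T" => AKernel 𝒱 H K W₀
local notation "Q" => darnMeasure 𝒱 H K W₀ σ
local notation "U" => USet 𝒱 H K W₀

theorem notMem_of_mem_closure {V : Set X} (hVK : closure V ∩ K = ∅) {x : X} (hx : x ∈ closure V) :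
    x ∉ K := fun hxK => (disjoint_iff_inter_eq_empty.2 hVK).ne_of_mem hx hxK rfl

namespace DarningData

open Classical in
/-- The darned family of kernels on `X₀`. -/
noncomputable def darnedFamily (d : DarningData 𝒱 H K W₀) (σ : ℝ → Measure X)
    (W : Set (Collapse K)) : Kernel (Collapse K) (Collapse K) :=
  descend d.isClosed_K d.nonempty
    (if h : ∃ r ∈ Ioo (0 : ℝ) 1, W = U r then d.darnKernel σ h.choose else H (proj K ⁻¹' W))

theorem isDarned_darnedFamily (d : DarningData 𝒱 H K W₀) (hσ : IsSphereFamily 𝒱 H K W₀ σ) :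
    IsDarned d σ (d.darnedFamily σ) where
  agree V hV hVK := by
    have hn : ¬ ∃ r ∈ Ioo (0 : ℝ) 1, proj K '' V = U r := by
      rintro ⟨r, -, h⟩
      have hp := d.point_mem_U r
      rw [← h] at hp
      obtain ⟨w, hw, hwp⟩ := hp
      exact notMem_of_mem_closure hVK (subset_closure hw) (proj_eq_point_iff.1 hwp)
    rw [darnedFamily, dif_neg hn, (isSaturated_of_closure hVK).1.preimage_image]
    refine lifts_descend _ _ (μ := Measure.dirac (point K)) fun x hx => ?_
    rw [(d.family.isBoundaryKernel V hV).2 x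
      (fun h => notMem_of_mem_closure hVK (subset_closure h) hx),
      Measure.map_dirac' measurable_proj, proj_of_mem hx]
  darned t ht := by
    have he : ∃ r ∈ Ioo (0 : ℝ) 1, U t = U r := ⟨t, ht, rfl⟩
    -- The radius is recovered from the set by strict monotonicity, so the chosen kernel is the one
    -- for `t`.
    have het : he.choose = t := le_antisymm
      (d.le_of_U_subset hσ he.choose_spec.1 ht he.choose_spec.2.ge)
      (d.le_of_U_subset hσ ht he.choose_spec.1 he.choose_spec.2.le)
    rw [darnedFamily, dif_pos he, het]
    refine lifts_descend _ _ (μ := (σ t).map (proj K)) fun x hx => ?_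
    rw [d.darnKernel_apply, d.darnMeasure_of_mem_K ht hx]

/-- Compatible measures give a normal Bauer family on `X₀`. -/
theorem isDarning_darnedFamily (d : DarningData 𝒱 H K W₀) (hσ : IsSphereFamily 𝒱 H K W₀ σ)
    (hc : IsCompatible 𝒱 H K W₀ σ) : IsDarning 𝒱 H K W₀ σ (d.darnedFamily σ) where
  agree V hV hVK x := (d.isDarned_darnedFamily hσ).agree V hV hVK x
  isNormalBauerFamily := (d.isDarned_darnedFamily hσ).isNormalBauerFamily hσ hc
  apply_point t ht := by
    obtain ⟨z, hz⟩ := d.nonempty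
    rw [← proj_of_mem hz, (d.isDarned_darnedFamily hσ).darned t ht z, d.darnKernel_apply,
      d.darnMeasure_of_mem_K ht hz]

end DarningData

namespace IsDarning

theorem ae_mem_frontier (hD : IsDarning 𝒱 H K W₀ σ H₀) (d : DarningData 𝒱 H K W₀) {t : ℝ}
    (ht : t ∈ Ioo (0 : ℝ) 1) : ∀ᵐ y ∂(σ t), y ∈ frontier (O t) := by
  have h := (hD.isNormalBauerFamily.isBoundaryKernel _ (d.U_mem_VZero ht)).1 _ (d.point_mem_U t)
  rw [hD.apply_point t ht,
    Measure.map_apply measurable_proj isClosed_frontier.measurableSet.compl, preimage_compl,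
    d.preimage_frontier_U ht.1] at h
  exact mem_ae_iff.2 h

/-- The integrals of continuous functions on `X₀` with respect to the kernel for `U_t` are harmonic
on `A_t`. -/
theorem isHarmonic_integral (hD : IsDarning 𝒱 H K W₀ σ H₀) (d : DarningData 𝒱 H K W₀) {t : ℝ}
    (ht : t ∈ Ioo (0 : ℝ) 1) {F : Collapse K → ℝ} (hF : Continuous F) (hFb : BddMeas F) :
    IsHarmonic 𝒱 H (A t) fun x => ∫ p, F p ∂(H₀ (U t) (proj K x)) := by
  have hB := hD.isNormalBauerFamily
  have hUt := d.U_mem_VZero ht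
  have hcont := hB.continuous_integral _ hUt F hF
  refine ⟨(hcont.comp continuous_proj).continuousOn, fun V hV hVA x _ => ?_⟩
  have hVK : closure V ∩ K = ∅ := disjoint_iff_inter_eq_empty.1
    (Set.disjoint_left.2 fun y hy => (hVA hy).1.2)
  have hVm : proj K '' V ∈ VZero 𝒱 H K W₀ := Or.inr ⟨V, hV, hVK, rfl⟩
  have hsub : proj K '' V ⊆ U t :=
    (image_mono (subset_closure.trans hVA)).trans (subset_insert _ _)
  have := hB.isMarkovKernel hUt
  have := hB.isMarkovKernel hVm
  have h1 := Kernel.integral_comp (κ := H₀ (proj K '' V)) (η := H₀ (U t)) (a := proj K x)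
    (hFb.integrable _)
  rw [hB.comp_eq _ hUt _ hVm hsub, hD.agree V hV hVK,
    integral_map measurable_proj.aemeasurable hcont.measurable.aestronglyMeasurable] at h1
  exact h1.symm

/-- The uniqueness step: the integral of a suitable continuous function is harmonic on `A_t` and
constant on `K`, hence given by `eq_integral_add`. The section brings the measure back to `X`, where
bounded continuous test functions identify it. -/
theorem map_sec_eq (hD : IsDarning 𝒱 H K W₀ σ H₀) (d : DarningData 𝒱 H K W₀)
    (hσ : IsSphereFamily 𝒱 H K W₀ σ) {t : ℝ} (ht : t ∈ Ioo (0 : ℝ) 1) {y : X} (hy : y ∈ A t) :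
    (H₀ (U t) (proj K y)).map (sec d.nonempty) = Q t y := by
  have hB := hD.isNormalBauerFamily
  have hUt := d.U_mem_VZero ht
  have hyO := d.A_subset_O t hy
  have hbd := hB.isBoundaryKernel _ hUt
  have := hB.isProbabilityMeasure hUt (proj K y)
  have := d.isProbabilityMeasure_darnMeasure hσ ht y
  have hsec := measurable_sec d.isClosed_K d.nonempty
  have := Measure.isProbabilityMeasure_map (μ := H₀ (U t) (proj K y)) hsec.aemeasurable
  refine ext_of_forall_integral_eq_of_IsFiniteMeasure fun φ => ?_
  have hφ : BddMeas φ := ⟨φ.continuous.measurable, ‖φ‖, fun x => φ.norm_coe_le_norm x⟩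
  -- The cutoff `χ` makes `φ` vanish on `K`, so that it descends to a continuous function on `X₀`,
  -- without changing it on the frontier that carries the measures.
  obtain ⟨χ, hχ0, hχ1, hχI⟩ := exists_continuous_zero_one_of_isClosed d.isClosed_K
    (isClosed_frontier (s := O t))
    ((d.disjoint_K_S t).mono_right (d.frontier_O_subset ht.1 ht.2))
  let f : X → ℝ := fun x => φ x * χ x
  have hfc : Continuous f := φ.continuous.mul χ.continuous
  have hfb : BddMeas f := hφ.mul ⟨χ.continuous.measurable, 1, fun x => by
    rw [abs_of_nonneg (hχI x).1]; exact (hχI x).2⟩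
  have hf1 : ∀ x ∈ frontier (O t), f x = φ x := fun x hx => by
    simp only [f, hχ1 hx, Pi.one_apply, mul_one]
  have hf0 : ∀ x ∈ K, f x = 0 := fun x hx => by simp only [f, hχ0 hx, Pi.zero_apply, mul_zero]
  let F : Collapse K → ℝ := fun p => f (sec d.nonempty p)
  have hFp : ∀ x, F (proj K x) = f x := comp_sec_proj d.nonempty hf0
  have hFc : Continuous F := (isQuotientMap_proj d.nonempty).continuous_iff.2
    (hfc.congr fun x => (hFp x).symm)
  have hFb : BddMeas F := ⟨hFc.measurable, hfb.bdd.imp fun C hC p => hC _⟩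
  let k : X → ℝ := fun x => ∫ p, F p ∂(H₀ (U t) (proj K x))
  have hkc : Continuous k := (hB.continuous_integral _ hUt F hFc).comp continuous_proj
  have hkK : ∀ x ∈ K, k x = ∫ z, φ z ∂(σ t) := fun x hx => by
    simp only [k]
    rw [proj_of_mem hx, hD.apply_point t ht,
      integral_map measurable_proj.aemeasurable hFc.measurable.aestronglyMeasurable]
    refine integral_congr_ae ?_
    filter_upwards [hD.ae_mem_frontier d ht] with z hz
    rw [hFp, hf1 z hz]
  have hkφ : ∀ x ∈ frontier (O t), k x = φ x := fun x hx => by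
    have hxU : proj K x ∉ U t := fun h => by
      rw [(d.isOpen_O t).frontier_eq, ← d.preimage_U ht.1] at hx
      exact hx.2 h
    simp only [k]
    rw [hbd.2 _ hxU, integral_dirac' _ _ hFc.stronglyMeasurable, hFp, hf1 x hx]
  calc ∫ x, φ x ∂((H₀ (U t) (proj K y)).map (sec d.nonempty))
      = ∫ p, φ (sec d.nonempty p) ∂(H₀ (U t) (proj K y)) :=
        integral_map hsec.aemeasurable hφ.meas.aestronglyMeasurable
    _ = k y := by
        refine integral_congr_ae ?_
        filter_upwards [hbd.ae_mem_frontier (mem_insert_of_mem _ ⟨y, hy, rfl⟩)] with p hp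
        refine (hf1 _ ?_).symm
        rw [← d.preimage_frontier_U ht.1, mem_preimage, proj_sec]
        exact hp
    _ = ∫ x in S t, k x ∂(T t y) + (1 - g y / t) * ∫ z, φ z ∂(σ t) :=
        d.eq_integral_add ht hkc.continuousOn (hD.isHarmonic_integral d ht hFc hFb)
          (fun x hx => hkK x hx.2) hy
    _ = ∫ x in S t, φ x ∂(T t y) + (1 - g y / t) * ∫ z, φ z ∂(σ t) := by
        congr 1
        refine integral_congr_ae ?_
        filter_upwards [ae_restrict_of_ae (d.ae_mem ht hy), ae_restrict_mem (d.measurableSet_S t)]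
          with z hz hzS
        exact hkφ z (hz.2.resolve_right hzS.1.2)
    _ = ∫ x, φ x ∂(Q t y) := (d.integral_darnMeasure hσ ht hφ hyO).symm

/-- The kernels for the sets `U_t` are determined by the measures `σ_t`. -/
theorem isDarned (hD : IsDarning 𝒱 H K W₀ σ H₀) (d : DarningData 𝒱 H K W₀)
    (hσ : IsSphereFamily 𝒱 H K W₀ σ) : IsDarned d σ H₀ where
  agree V hV hVK x := hD.agree V hV hVK x
  darned t ht x := by
    rw [d.darnKernel_apply]
    by_cases hxK : x ∈ K
    · rw [proj_of_mem hxK, hD.apply_point t ht, d.darnMeasure_of_mem_K ht hxK]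
    by_cases hxO : x ∈ O t
    · have hxA : x ∈ A t := by rw [d.A_eq]; exact ⟨hxO, hxK⟩
      rw [← hD.map_sec_eq d hσ ht hxA,
        Measure.map_map measurable_proj (measurable_sec d.isClosed_K d.nonempty)]
      have : proj K ∘ sec d.nonempty = id := funext fun p => proj_sec d.nonempty p
      rw [this, Measure.map_id]
    · have hxU : proj K x ∉ U t := fun h => hxO (by rw [← d.preimage_U ht.1]; exact h)
      rw [(hD.isNormalBauerFamily.isBoundaryKernel _ (d.U_mem_VZero ht)).2 _ hxU,
        darnMeasure_of_notMem hxO, Measure.map_dirac' measurable_proj]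

theorem apply_eq (hD : IsDarning 𝒱 H K W₀ σ H₀) (d : DarningData 𝒱 H K W₀)
    (hσ : IsSphereFamily 𝒱 H K W₀ σ) {t : ℝ} (ht : t ∈ Ioo (0 : ℝ) 1) {B : Set (Collapse K)}
    (hB : MeasurableSet B) {y : X} (hy : y ∈ A t) :
    H₀ (U t) (proj K y) B = T t y (proj K ⁻¹' B ∩ S t) +
      ENNReal.ofReal (1 - g y / t) * σ t (proj K ⁻¹' B) := by
  rw [(hD.isDarned d hσ).darned t ht y, Measure.map_apply measurable_proj hB, d.darnKernel_apply,
    darnMeasure_of_mem (d.A_subset_O t hy), Measure.add_apply,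
    Measure.restrict_apply (measurable_proj hB), Measure.smul_apply, smul_eq_mul]

/-- The measures `σ_t` of a normal Bauer family on `X₀` are compatible. -/
theorem isCompatible (hD : IsDarning 𝒱 H K W₀ σ H₀) (d : DarningData 𝒱 H K W₀)
    (hσ : IsSphereFamily 𝒱 H K W₀ σ) : IsCompatible 𝒱 H K W₀ σ := by
  intro r t hr hrt ht
  have hrI : r ∈ Ioo (0 : ℝ) 1 := ⟨hr, hrt.trans ht⟩
  have htI : t ∈ Ioo (0 : ℝ) 1 := ⟨hr.trans hrt, ht⟩
  have := (hσ r hrI).1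
  have := (hσ t htI).1
  have hSm := d.measurableSet_S t
  ext B hB
  let E := B ∩ S t
  have hE : MeasurableSet E := hB.inter hSm
  have hpre : proj K ⁻¹' (proj K '' E) = E := IsSaturated.preimage_image
    (Or.inl ((d.disjoint_K_S t).symm.mono_left inter_subset_right))
  have hEm : MeasurableSet (proj K '' E) := by
    rw [measurableSet_collapse_iff d.isClosed_K d.nonempty, hpre]
    exact hE
  have hsub : U r ⊆ U t :=
    insert_subset_insert (image_mono fun x hx => ⟨hx.1, hx.2.trans hrt⟩)
  -- This is (H₁) for `U_r ⊆ U_t`, evaluated at the point `x₀`.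
  have h1 := congrArg (fun P : Kernel (Collapse K) (Collapse K) => P (point K) (proj K '' E))
    (hD.isNormalBauerFamily.comp_eq _ (d.U_mem_VZero htI) _ (d.U_mem_VZero hrI) hsub)
  simp only [Kernel.comp_apply' _ _ _ hEm] at h1
  rw [hD.apply_point r hrI, hD.apply_point t htI, Measure.map_apply measurable_proj hEm, hpre,
    lintegral_map (Kernel.measurable_coe _ hEm) measurable_proj] at h1
  have h2 : ∫⁻ y, H₀ (U t) (proj K y) (proj K '' E) ∂(σ r) =
      ∫⁻ y, (T t y E + ENNReal.ofReal (1 - r / t) * σ t E) ∂(σ r) := by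
    refine lintegral_congr_ae ?_
    filter_upwards [hσ.ae_mem hrI] with y hy
    rw [hD.apply_eq d hσ htI hEm (d.S_subset_A hrt hy), hpre, hy.2,
      inter_eq_left.2 (inter_subset_right : E ⊆ S t)]
  rw [h2, lintegral_add_right _ measurable_const, lintegral_const, measure_univ, mul_one] at h1
  -- Splitting the right-hand side in the same proportions lets the finite term `(1 - r/t) σ_t E` be
  -- cancelled.
  have h3 : σ t E = ENNReal.ofReal (r / t) * σ t E + ENNReal.ofReal (1 - r / t) * σ t E := by
    rw [← add_mul, ← ENNReal.ofReal_add (div_nonneg hr.le htI.1.le)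
      (sub_nonneg.2 ((div_le_one htI.1).2 hrt.le))]
    simp
  have h4 := h1.trans h3
  rw [ENNReal.add_left_inj (ENNReal.mul_ne_top ENNReal.ofReal_ne_top (measure_ne_top _ _))] at h4
  rw [Measure.restrict_apply hB, Measure.bind_apply hE (Kernel.aemeasurable _),
    Measure.smul_apply, Measure.restrict_apply hB, smul_eq_mul]
  exact h4

end IsDarning

namespace IsDarned

variable {d : DarningData 𝒱 H K W₀}

theorem integral_image (hd : IsDarned d σ H₀) {V : Set X} (hV : V ∈ 𝒱) (hVK : closure V ∩ K = ∅)
    (h : Collapse K → ℝ) (x : X) :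
    ∫ p, h p ∂(H₀ (proj K '' V) (proj K x)) = ∫ y, h (proj K y) ∂(H V x) := by
  rw [hd.agree V hV hVK x]
  have hbd := d.family.isBoundaryKernel V hV
  by_cases hx : x ∈ V
  · refine integral_map_proj d.isClosed_K ?_ h
    filter_upwards [hbd.ae_mem_frontier hx] with y hy
    exact notMem_of_mem_closure hVK (frontier_subset_closure hy)
  · rw [hbd.2 x hx, integral_map_proj_dirac d.isClosed_K d.nonempty, integral_dirac]

/-- On open sets which do not contain `x₀`, functions induced by harmonic functions on `X` are
harmonic. -/
theorem isHarmonic_of_notMem (hd : IsDarned d σ H₀) {W : Set (Collapse K)} (hW : IsOpen W)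
    (hp : point K ∉ W) {h : Collapse K → ℝ} (hh : IsHarmonic 𝒱 H (proj K ⁻¹' W) (h ∘ proj K)) :
    IsHarmonic (VZero 𝒱 H K W₀) H₀ W h := by
  refine ⟨(continuousOn_collapse_iff d.nonempty hW).2 hh.1, ?_⟩
  rintro _ (⟨t, ht, rfl⟩ | ⟨V, hV, hVK, rfl⟩) hVW p hpW
  · exact absurd (hVW (subset_closure (d.point_mem_U t))) hp
  · obtain ⟨x, rfl⟩ := surjective_proj d.nonempty p
    rw [hd.integral_image hV hVK]
    exact hh.2 V hV (d.closure_image_subset hVW) x hpW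

/-- The function induced by `g` serves as witness: it is positive and harmonic off `x₀` and tends to
`0` at `x₀`. -/
theorem isStronglyStable_point (hd : IsDarned d σ H₀) (hσ : IsSphereFamily 𝒱 H K W₀ σ) :
    IsStronglyStable (VZero 𝒱 H K W₀) H₀ {point K} := by
  have hgp : ∀ x, g (sec d.nonempty (proj K x)) = g x :=
    comp_sec_proj d.nonempty fun x hx => d.g_eq_zero hx
  have hcomp : (fun p => g (sec d.nonempty p)) ∘ proj K = g := funext hgp
  have hpre : proj K ⁻¹' (proj K '' W₀ \ {point K}) = W₀ \ K := by
    rw [preimage_sdiff, d.preimage_image_W]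
    congr 1
    ext x
    exact proj_eq_point_iff
  have hpW : point K ∈ proj K '' W₀ := by
    rw [← d.image_W_eq]
    exact mem_insert _ _
  refine ⟨isCompact_singleton, singleton_nonempty _, proj K '' W₀, hd.isPSet_image_W hσ,
    singleton_subset_iff.2 hpW, fun p => g (sec d.nonempty p), ?_, ?_, ?_⟩
  · refine hd.isHarmonic_of_notMem (d.isOpen_image_W.sdiff (isClosed_point d.isClosed_K))
      (fun h => h.2 rfl) ?_
    rw [hcomp, hpre]
    exact d.isHarmonic_g
  · intro p hp
    obtain ⟨x, rfl⟩ := surjective_proj d.nonempty p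
    refine (d.pos x ?_).trans_eq (hgp x).symm
    rw [← hpre]
    exact hp
  · intro z hz
    have hz' : z = point K := (isClosed_point d.isClosed_K).frontier_subset hz
    subst hz'
    have hc : ContinuousOn (fun p => g (sec d.nonempty p)) (proj K '' W₀) := by
      rw [continuousOn_collapse_iff d.nonempty d.isOpen_image_W, hcomp, d.preimage_image_W]
      exact d.continuousOn_g.mono subset_closure
    have h1 := (hc _ hpW).mono (sdiff_subset (t := {point K}))
    have h2 : g (sec d.nonempty (point K)) = 0 := d.g_eq_zero (sec_point d.nonempty)
    rw [ContinuousWithinAt, h2] at h1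
    exact h1

section RemovablePoint

variable {W : Set (Collapse K)} {h : Collapse K → ℝ}

/-- The values in `U_t` of a function on a neighborhood of `x₀` which is harmonic off `x₀`. -/
theorem eq_setIntegral_add (d : DarningData 𝒱 H K W₀) (hW : IsOpen W)
    (hc : ContinuousOn h W) (hh : IsHarmonic 𝒱 H (proj K ⁻¹' (W \ {point K})) (h ∘ proj K)) {t : ℝ}
    (ht : t ∈ Ioo (0 : ℝ) 1) (htW : closure (U t) ⊆ W) {x : X} (hx : x ∈ A t) :
    h (proj K x) = ∫ y in S t, (closure (O t)).indicator (h ∘ proj K) y ∂(T t x) +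
      (1 - g x / t) * h (point K) := by
  have hOW : closure (O t) ⊆ proj K ⁻¹' W := by
    rw [← d.preimage_closure_U ht.1]
    exact preimage_mono htW
  have hkc := (continuousOn_collapse_iff d.nonempty hW).1 hc
  have hsub : A t ⊆ proj K ⁻¹' (W \ {point K}) := fun y hy =>
    ⟨hOW (subset_closure (d.A_subset_O t hy)), fun hp => hy.1.2 (proj_eq_point_iff.1 hp)⟩
  have h1 := d.eq_integral_add ht (k := h ∘ proj K) (c := h (point K))
    (hkc.mono ((closure_mono (d.A_subset_O t)).trans hOW)) (hh.mono hsub)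
    (fun y hy => by rw [Function.comp_apply, proj_of_mem hy.2]) hx
  rw [Function.comp_apply] at h1
  rw [h1]
  congr 1
  refine integral_congr_ae ?_
  filter_upwards [ae_restrict_of_ae (d.ae_mem ht hx), ae_restrict_mem (d.measurableSet_S t)]
    with z hz hzS
  rw [indicator_of_mem (frontier_subset_closure (hz.2.resolve_right hzS.1.2))]

theorem bddMeas_indicator (d : DarningData 𝒱 H K W₀) (hW : IsOpen W)
    (hc : ContinuousOn h W) {t : ℝ} (ht : t ∈ Ioo (0 : ℝ) 1) (htW : closure (U t) ⊆ W) :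
    BddMeas ((closure (O t)).indicator (h ∘ proj K)) := by
  refine BddMeas.of_continuousOn (d.isCompact_closure_O t)
    (((continuousOn_collapse_iff d.nonempty hW).1 hc).mono ?_)
  rw [← d.preimage_closure_U ht.1]
  exact preimage_mono htW

theorem integral_indicator_sigma (d : DarningData 𝒱 H K W₀) (hσ : IsSphereFamily 𝒱 H K W₀ σ)
    (hcp : IsCompatible 𝒱 H K W₀ σ) {t : ℝ} (ht : t ∈ Ioo (0 : ℝ) 1) :
    ∫ y, (closure (O t)).indicator (h ∘ proj K) y ∂(σ t) = ∫ y, h (proj K y) ∂(σ t) := by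
  refine integral_congr_ae ?_
  filter_upwards [d.ae_mem_frontier_O hσ hcp ht] with z hz
  rw [indicator_of_mem (frontier_subset_closure hz), Function.comp_apply]

/-- Integrate the representation of `h` on `A_t` over `σ_r`: `g = r` on `S_r`, and compatibility
turns the first term into `(r/t) ∫ h dσ_t`. -/
theorem integral_sigma_sub (d : DarningData 𝒱 H K W₀) (hσ : IsSphereFamily 𝒱 H K W₀ σ)
    (hcp : IsCompatible 𝒱 H K W₀ σ) (hW : IsOpen W)
    (hc : ContinuousOn h W) (hh : IsHarmonic 𝒱 H (proj K ⁻¹' (W \ {point K})) (h ∘ proj K))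
    {r t : ℝ} (hr : 0 < r) (hrt : r < t) (ht : t < 1) (htW : closure (U t) ⊆ W) :
    ∫ y, h (proj K y) ∂(σ r) - h (point K) =
      r / t * (∫ y, h (proj K y) ∂(σ t) - h (point K)) := by
  have hrI : r ∈ Ioo (0 : ℝ) 1 := ⟨hr, hrt.trans ht⟩
  have htI : t ∈ Ioo (0 : ℝ) 1 := ⟨hr.trans hrt, ht⟩
  have := (hσ r hrI).1
  have := d.isMarkovKernel htI
  have hb := bddMeas_indicator d hW hc htI htW
  have h1 : ∫ y, h (proj K y) ∂(σ r) =
      ∫ y, (∫ z, (S t).indicator ((closure (O t)).indicator (h ∘ proj K)) z ∂(T t y) +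
        (1 - r / t) * h (point K)) ∂(σ r) := by
    refine integral_congr_ae ?_
    filter_upwards [hσ.ae_mem hrI] with y hy
    rw [eq_setIntegral_add d hW hc hh htI htW (d.S_subset_A hrt hy), hy.2,
      integral_indicator (d.measurableSet_S t)]
  rw [h1, integral_add (((hb.indicator (d.measurableSet_S t)).integral_kernel (T t)).integrable _)
    (integrable_const _)]
  simp_rw [integral_indicator (d.measurableSet_S t)]
  rw [d.integral_compatible hσ hcp hr hrt ht hb, integral_indicator_sigma d hσ hcp htI]
  simp only [integral_const, probReal_univ, smul_eq_mul, one_mul]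
  ring

theorem integral_sigma_eq_iff (d : DarningData 𝒱 H K W₀) (hσ : IsSphereFamily 𝒱 H K W₀ σ)
    (hcp : IsCompatible 𝒱 H K W₀ σ) (hW : IsOpen W)
    (hc : ContinuousOn h W) (hh : IsHarmonic 𝒱 H (proj K ⁻¹' (W \ {point K})) (h ∘ proj K))
    {r t : ℝ} (hr : 0 < r) (hrt : r < t) (ht : t < 1) (htW : closure (U t) ⊆ W) :
    ∫ y, h (proj K y) ∂(σ r) = h (point K) ↔ ∫ y, h (proj K y) ∂(σ t) = h (point K) := by
  have h1 := integral_sigma_sub d hσ hcp hW hc hh hr hrt ht htW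
  have h2 : r / t ≠ 0 := (div_pos hr (hr.trans hrt)).ne'
  rw [← sub_eq_zero, h1, mul_eq_zero, or_iff_right h2, sub_eq_zero]

theorem integral_U_point (hd : IsDarned d σ H₀) (hσ : IsSphereFamily 𝒱 H K W₀ σ) {t : ℝ}
    (ht : t ∈ Ioo (0 : ℝ) 1) {x : X} (hx : x ∈ K) :
    ∫ p, h p ∂(H₀ (U t) (proj K x)) = ∫ y, h (proj K y) ∂(σ t) := by
  rw [hd.darned t ht x, d.darnKernel_apply, d.darnMeasure_of_mem_K ht hx]
  refine integral_map_proj d.isClosed_K ?_ h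
  filter_upwards [hσ.ae_mem ht] with y hy using hy.1.2

theorem integral_U (hd : IsDarned d σ H₀) (hσ : IsSphereFamily 𝒱 H K W₀ σ)
    (hcp : IsCompatible 𝒱 H K W₀ σ) (hW : IsOpen W)
    (hc : ContinuousOn h W) (hh : IsHarmonic 𝒱 H (proj K ⁻¹' (W \ {point K})) (h ∘ proj K))
    {t : ℝ} (ht : t ∈ Ioo (0 : ℝ) 1) (htW : closure (U t) ⊆ W)
    (hm : ∫ y, h (proj K y) ∂(σ t) = h (point K)) (x : X) :
    ∫ p, h p ∂(H₀ (U t) (proj K x)) = h (proj K x) := by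
  by_cases hxK : x ∈ K
  · rw [hd.integral_U_point hσ ht hxK, hm, proj_of_mem hxK]
  by_cases hxO : x ∈ O t
  · have hxA : x ∈ A t := by rw [d.A_eq]; exact ⟨hxO, hxK⟩
    have hae := (d.isBoundaryKernel_darnKernel hσ hcp ht).ae_mem_frontier hxO
    rw [hd.darned t ht x, integral_map_proj d.isClosed_K]
    · have h1 : ∫ y, h (proj K y) ∂(d.darnKernel σ t x) =
          ∫ y, (closure (O t)).indicator (h ∘ proj K) y ∂(Q t x) := by
        refine integral_congr_ae ?_
        filter_upwards [hae] with y hy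
        rw [indicator_of_mem (frontier_subset_closure hy), Function.comp_apply]
      rw [h1, d.integral_darnMeasure hσ ht (bddMeas_indicator d hW hc ht htW) hxO,
        integral_indicator_sigma d hσ hcp ht, hm, ← eq_setIntegral_add d hW hc hh ht htW hxA]
    · filter_upwards [hae] with y hy
      exact (d.frontier_O_subset ht.1 ht.2 hy).1.2
  · rw [hd.darned t ht x, d.darnKernel_apply, darnMeasure_of_notMem hxO,
      integral_map_proj_dirac d.isClosed_K d.nonempty]

theorem tfae_isHarmonic (hd : IsDarned d σ H₀) (hσ : IsSphereFamily 𝒱 H K W₀ σ)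
    (hcp : IsCompatible 𝒱 H K W₀ σ) (hW : IsOpen W) (hp : point K ∈ W)
    (hc : ContinuousOn h W) (hh : IsHarmonic 𝒱 H (proj K ⁻¹' (W \ {point K})) (h ∘ proj K)) :
    List.TFAE [
      IsHarmonic (VZero 𝒱 H K W₀) H₀ W h,
      ∀ r ∈ Ioo (0 : ℝ) 1, closure (U r) ⊆ W → ∫ x, h (proj K x) ∂(σ r) = h (point K),
      ∃ r ∈ Ioo (0 : ℝ) 1, closure (U r) ⊆ W ∧ ∫ x, h (proj K x) ∂(σ r) = h (point K)] := by
  tfae_have 1 → 2 := by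
    intro ha r hr hrW
    obtain ⟨z, hz⟩ := d.nonempty
    have := ha.2 _ (d.U_mem_VZero hr) hrW _ hp
    rwa [← proj_of_mem hz, hd.integral_U_point hσ hr hz, proj_of_mem hz] at this
  tfae_have 2 → 1 := by
    refine fun hb => ⟨hc, ?_⟩
    rintro _ (⟨t, ht, rfl⟩ | ⟨V, hV, hVK, rfl⟩) hVW p hpW <;>
      obtain ⟨x, rfl⟩ := surjective_proj d.nonempty p
    · exact hd.integral_U hσ hcp hW hc hh ht hVW (hb t ht hVW) x
    · rw [hd.integral_image hV hVK]
      -- The point may be `x₀`, where `h` is not known to be harmonic; but then `x ∉ V` and the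
      -- kernel is Dirac.
      by_cases hxV : x ∈ V
      · have hsub : closure V ⊆ proj K ⁻¹' (W \ {point K}) := fun y hy =>
          ⟨d.closure_image_subset hVW hy, fun hy' =>
            notMem_of_mem_closure hVK hy (proj_eq_point_iff.1 hy')⟩
        exact hh.2 V hV hsub x (hsub (subset_closure hxV))
      · rw [(d.family.isBoundaryKernel V hV).2 x hxV, integral_dirac]
  tfae_have 2 → 3 := by
    intro hb
    obtain ⟨t, ht, htW⟩ := d.exists_closure_U_subset hW hp
    exact ⟨t, ht, htW, hb t ht htW⟩
  tfae_have 3 → 2 := by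
    rintro ⟨s, hs, hsW, hm⟩ r hr hrW
    rcases lt_trichotomy r s with h1 | rfl | h1
    · exact (integral_sigma_eq_iff d hσ hcp hW hc hh hr.1 h1 hs.2 hsW).2 hm
    · exact hm
    · exact (integral_sigma_eq_iff d hσ hcp hW hc hh hs.1 h1 hr.2 hrW).1 hm
  tfae_finish

end RemovablePoint

end IsDarned

end Darning

end Bauer

theorem theorem2p2 {X : Type*} [TopologicalSpace X] [T2Space X] [LocallyCompactSpace X]
    [SecondCountableTopology X] [MeasurableSpace X] [BorelSpace X]
    (𝒱 : Set (Set X)) (H : Set X → Kernel X X) (hH : Bauer.IsNormalBauerFamily 𝒱 H)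
    (K : Set X) (hK : Bauer.IsStronglyStable 𝒱 H K)
    (W₀ : Set X) (hW₀ : Bauer.IsRegular 𝒱 H W₀) (hW₀P : Bauer.IsPSet 𝒱 H W₀) (hKW₀ : K ⊆ W₀)
    (hW₀K : Bauer.IsRegular 𝒱 H (W₀ \ K)) (hg : ∀ x ∈ W₀ \ K, 0 < Bauer.gFun 𝒱 H K W₀ x)
    (σ : ℝ → Measure X)
    (hσ : ∀ r ∈ Ioo (0 : ℝ) 1,
      IsProbabilityMeasure (σ r) ∧ σ r (Bauer.SSet 𝒱 H K W₀ r)ᶜ = 0) :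
    ((∃ H₀, Bauer.IsDarning 𝒱 H K W₀ σ H₀) ↔ Bauer.IsCompatible 𝒱 H K W₀ σ) ∧
    ∀ H₀, Bauer.IsDarning 𝒱 H K W₀ σ H₀ →
      (∀ t ∈ Ioo (0 : ℝ) 1, ∀ B : Set (Bauer.Collapse K), MeasurableSet B →
        ∀ y ∈ Bauer.ASet 𝒱 H K W₀ t,
          H₀ (Bauer.USet 𝒱 H K W₀ t) (Bauer.proj K y) B =
            Bauer.harmonicKernel 𝒱 H (Bauer.ASet 𝒱 H K W₀ t) y
                (Bauer.proj K ⁻¹' B ∩ Bauer.SSet 𝒱 H K W₀ t) +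
              ENNReal.ofReal (1 - Bauer.gFun 𝒱 H K W₀ y / t) * σ t (Bauer.proj K ⁻¹' B)) ∧
      Bauer.IsStronglyStable (Bauer.VZero 𝒱 H K W₀) H₀ {Bauer.point K} ∧
      Bauer.IsPSet (Bauer.VZero 𝒱 H K W₀) H₀
        (insert (Bauer.point K) (Bauer.proj K '' (W₀ \ K))) ∧
      ∀ W : Set (Bauer.Collapse K), IsOpen W → Bauer.point K ∈ W →
        ∀ h : Bauer.Collapse K → ℝ, ContinuousOn h W →
          Bauer.IsHarmonic 𝒱 H (Bauer.proj K ⁻¹' (W \ {Bauer.point K})) (h ∘ Bauer.proj K) →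
          List.TFAE [
            Bauer.IsHarmonic (Bauer.VZero 𝒱 H K W₀) H₀ W h,
            ∀ r ∈ Ioo (0 : ℝ) 1, closure (Bauer.USet 𝒱 H K W₀ r) ⊆ W →
              ∫ x, h (Bauer.proj K x) ∂(σ r) = h (Bauer.point K),
            ∃ r ∈ Ioo (0 : ℝ) 1, closure (Bauer.USet 𝒱 H K W₀ r) ⊆ W ∧
              ∫ x, h (Bauer.proj K x) ∂(σ r) = h (Bauer.point K)] := by
  have d : Bauer.DarningData 𝒱 H K W₀ :=
    ⟨hH, hK.1, hK.2.1, hW₀, hW₀P, hKW₀, hW₀K, hg⟩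
  refine ⟨⟨fun ⟨H₀, hD⟩ => hD.isCompatible d hσ,
    fun hc => ⟨_, d.isDarning_darnedFamily hσ hc⟩⟩, fun H₀ hD => ?_⟩
  have hd := hD.isDarned d hσ
  refine ⟨fun t ht B hB y hy => hD.apply_eq d hσ ht hB hy, hd.isStronglyStable_point hσ, ?_,
    fun W hW hp h hc hh => hd.tfae_isHarmonic hσ (hD.isCompatible d hσ) hW hp hc hh⟩
  rw [d.image_W_eq]
  exact hd.isPSet_image_W hσ
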